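/- Let $K_0$ be a non-Archimedean local field of characteristic $\neq 2$ with ring of integers $O_{K_0}$, let $K/K_0$ be a finite separable field extension with ring of integers $O_K$, and let $B$ be a quaternion $K$-algebra with canonical involution $x\mapsto\bar x$. Let $*$ be an orthogonal involution of $B$ (an involution fixing $K$ elementwise), and let $\gamma\in B^\times$ be an element such that $\bar\gamma+\gamma=0$ and $x^*=\gamma\bar x\gamma^{-1}$ for all $x\in B$. Let $O_B$ be a maximal $O_K$-order in $B$ that is stable under $*$. Let $(V,\psi)$ be a $K_0$-valued $(-1,*)$-hermitian $B$-module of rank $n$, that is, $V$ is a free left $B$-module of finite rank $n$ and $\psi:V\times V\to K_0$ is a non-degenerate $K_0$-bilinear pairing with $\psi(y,x)=-\psi(x,y)$ and $\psi(bx,y)=\psi(x,b^*y)$ for all $b\in B$ and $x,y\in V$. An $O_B$-lattice $L$ in $V$ is a finitely generated $O_B$-submodule of $V$ that generates $V$ over $B$; it is self-dual if it equals $L^\vee=\{x\in V \mid \psi(x,L)\subseteq O_{K_0}\}$. When $B$ is a division algebra, let $\Pi$ be a prime element of $O_B$ such that $\Pi\bar\Pi$ is a uniformizer of $K$, and let $\operatorname{ord}_\Pi$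 be the valuation on $B$ normalized by $\operatorname{ord}_\Pi(\Pi)=1$ (it does not depend on the choice of $\Pi$). Then: (i) There does not exist any self-dual $O_B$-lattice in $(V,\psi)$ if and only if $B$ is a division algebra, $n$ is odd and $\operatorname{ord}_\Pi(\gamma)$ is even. (ii) Any two self-dual $O_B$-lattices $L_1$ and $L_2$ in $(V,\psi)$, if they exist, are isometric, i.e. there is an $O_B$-linear isomorphism $L_1\simeq L_2$ preserving $\psi$. -/

import Mathlib

open scoped ValuativeRel Quaternion

noncomputable section

namespace QuatHerm

/-- `O_K`: the integral closure in `K` of the ring of integers `O_{K₀}` of the local field `K₀`. -/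
abbrev IntegerRing (K₀ K : Type*) [Field K₀] [ValuativeRel K₀] [Field K] [Algebra K₀ K] :
    Subalgebra 𝒪[K₀] K :=
  integralClosure 𝒪[K₀] K

/-- `B` is a quaternion algebra over `K` (a field with `2 ≠ 0`): it has a `K`-basis `1, i, j, ij`
with `i² = a`, `j² = b`, `ji = -ij` for some nonzero `a, b ∈ K`. -/
def IsQuaternionAlgebra (K B : Type*) [Field K] [Ring B] [Algebra K B] : Prop :=
  ∃ a b : K, a ≠ 0 ∧ b ≠ 0 ∧ Nonempty (B ≃ₐ[K] ℍ[K,a,b])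

/-- The reduced trace of a quaternion algebra over a field with `2 ≠ 0`: half the trace of the
multiplication by `x` on the four-dimensional space `B`. -/
def reducedTrace (K : Type*) {B : Type*} [Field K] [Ring B] [Algebra K B] (x : B) : K :=
  2⁻¹ * LinearMap.trace K B (LinearMap.mulLeft K x)

/-- The canonical involution `x ↦ x̄ = Trd(x) - x` of a quaternion algebra. -/
def conj (K : Type*) {B : Type*} [Field K] [Ring B] [Algebra K B] (x : B) : B :=
  algebraMap K B (reducedTrace K x) - x

/-- An orthogonal involution of a quaternion `K`-algebra (`2 ≠ 0` in `K`): an involution of the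
first kind (that is, `K`-linear) whose space of symmetric elements has dimension
`2 * (2 + 1) / 2 = 3`. -/
structure IsOrthogonalInvolution {K B : Type*} [Field K] [Ring B] [Algebra K B]
    (s : B →ₗ[K] B) : Prop where
  map_one : s 1 = 1
  map_mul : ∀ x y, s (x * y) = s y * s x
  involutive : ∀ x, s (s x) = x
  finrank_symmetric : Module.finrank K (LinearMap.eqLocus s LinearMap.id) = 3

/-- An `R`-order of the `K`-algebra `B`, where `R` is a domain with field of fractions `K`:
a subring containing `R`, finitely generated as an `R`-module, which spans `B` over `K`. -/
def IsOrder {R : Type*} (K : Type*) {B : Type*} [CommRing R] [Field K] [Ring B] [Algebra R B]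
    [Algebra K B] (O : Subalgebra R B) : Prop :=
  (Subalgebra.toSubmodule O).FG ∧ Submodule.span K (O : Set B) = ⊤

/-- `(V, ψ)` is a `K₀`-valued `(ε, *)`-hermitian `B`-module, where `*` is given by `s`. -/
structure IsHermitianForm {K₀ B V : Type*} [Field K₀] [Ring B] [AddCommGroup V] [Module K₀ V]
    [Module B V] (ε : K₀) (s : B → B) (ψ : LinearMap.BilinForm K₀ V) : Prop where
  nondegenerate : ψ.Nondegenerate
  symm : ∀ x y, ψ y x = ε * ψ x y
  smul_left : ∀ (b : B) (x y : V), ψ (b • x) y = ψ x (s b • y)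

/-- A lattice over the order `O` of `B` in the `B`-module `V`: a finitely generated `O`-submodule
of `V` which generates `V` over `B`. -/
def IsLattice {R B V : Type*} [CommRing R] [Ring B] [Algebra R B] [AddCommGroup V] [Module B V]
    {O : Subalgebra R B} (L : Submodule O V) : Prop :=
  L.FG ∧ Submodule.span B (L : Set V) = ⊤

/-- The dual `L^∨ = {x ∈ V | ψ(x, L) ⊆ O_{K₀}}`. -/
def dual {K₀ V : Type*} [Field K₀] [ValuativeRel K₀] [AddCommGroup V] [Module K₀ V]
    (ψ : LinearMap.BilinForm K₀ V) (L : Set V) : Set V :=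
  {x | ∀ y ∈ L, ψ x y ∈ 𝒪[K₀]}

/-- `L` is a self-dual `O`-lattice in `(V, ψ)`. -/
def IsSelfDualLattice {K₀ R B V : Type*} [Field K₀] [ValuativeRel K₀] [CommRing R] [Ring B]
    [Algebra R B] [AddCommGroup V] [Module K₀ V] [Module B V] {O : Subalgebra R B}
    (ψ : LinearMap.BilinForm K₀ V) (L : Submodule O V) : Prop :=
  IsLattice L ∧ dual ψ (L : Set V) = (L : Set V)

/-- `L₁` and `L₂` are isometric: there is an `O`-linear isomorphism `L₁ ≃ L₂` preserving `ψ`. -/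
def AreIsometric {K₀ R B V : Type*} [Field K₀] [CommRing R] [Ring B]
    [Algebra R B] [AddCommGroup V] [Module K₀ V] [Module B V] {O : Subalgebra R B}
    (ψ : LinearMap.BilinForm K₀ V) (L₁ L₂ : Submodule O V) : Prop :=
  ∃ f : L₁ ≃ₗ[O] L₂, ∀ x y : L₁, ψ (f x : V) (f y : V) = ψ (x : V) (y : V)

/-- `B` is a division algebra. -/
def IsDivision (B : Type*) [Ring B] : Prop :=
  Nontrivial B ∧ ∀ x : B, x ≠ 0 → IsUnit x

/-- `Π` is a prime element of the maximal order `O` of the division quaternion algebra `B`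
(the non-units of `O` are exactly the elements of `Π O`), normalized so that `Π Π̄` is
a uniformizer of `K`. Here `R` stands for the ring of integers of `K`. -/
structure IsPrimeElement {R : Type*} (K : Type*) {B : Type*} [CommRing R] [Field K] [Ring B]
    [Algebra R B] [Algebra K B] (O : Subalgebra R B) (P : Bˣ) : Prop where
  mem : (P : B) ∈ O
  nonunits_eq : ∀ x : O, x ∈ nonunits O ↔ ∃ y : O, (x : B) = P * y
  mul_conj : ∃ ϖ : R, Irreducible ϖ ∧ (P : B) * conj K (P : B) = algebraMap R B ϖ

/-- `ord_Π(x)`, the largest `r ∈ ℤ` such that `x ∈ Π^r O`. -/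
def ordAt {R B : Type*} [CommRing R] [Ring B] [Algebra R B] (O : Subalgebra R B) (P x : Bˣ) : ℤ :=
  sSup {r : ℤ | ((P ^ (-r) * x : Bˣ) : B) ∈ O}

end QuatHerm

end

noncomputable section

namespace QuatHerm

open IsLocalRing

/-! Write `R` for the ring of integers of `K`. Because `γ` is skew and `*` is the canonical
involution twisted by `γ`, the skew form `ψ` equals `-Tr_{K/K₀} Trd (γ⁻¹ h(x, y))` for a unique
`B`-valued form `h` that is hermitian for the canonical involution (`exists_herm`). Self-duality for
`ψ` then says that `L` consists of the `x` for which `δ γ⁻¹ h(x, L)` lies in the trace dual of `O`,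
where `δ⁻¹` generates the codifferent of `K/K₀` (`exists_mem_dual_iff`).

If `B` is split, then `O` is a matrix order, it is its own trace dual, and `γ`, which normalizes it,
is a scalar times a unit. The condition becomes `c h(x, L) ⊆ O` with `c` a nonzero scalar. If `B` is
a division algebra, then `O` is the ring of elements of integral norm and its trace dual is `Π⁻¹ O`.
Scalars have even order, so the parity of `ord γ` decides between `c h(x, L) ⊆ O` (odd) and `c h(x,
L) ⊆ Π O` (even).

So the theorem is about unimodular and `Π`-modular lattices for a hermitian form. A unimodular
lattice has an orthonormal basis (`exists_orthonormal_span`), and `V` itself has one because `Nrd`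
is onto `K`; this gives existence and uniqueness. In a `Π`-modular lattice every `h(x, x)` lies in
`K ∩ Π O = ϖ R`, so only hyperbolic planes split off (`exists_hyperbolic_span`): such a lattice is
unique and forces even rank. Conversely an orthonormal basis of even length regroups into hyperbolic
planes (`exists_hyperbolic_basis`).

The residue characteristic may be 2, so the lattice arguments never halve. Their substitutes are an
element of `O` of reduced trace 1 and the solvability of `t² - t + m = 0` for `m` in the maximal
ideal. -/

/-- Quadratic polynomials `t² - t + m` with `m` in the maximal ideal have a root in that ideal. -/
def HasQuadraticRoots (R : Type*) [CommRing R] [IsLocalRing R] : Prop :=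
  ∀ m ∈ maximalIdeal R, ∃ t ∈ maximalIdeal R, t * t - t + m = 0

/-! ### Henselian rings and the ring of integers of `K` -/

/-- For finite `M` the completion is a quotient of `Â ⊗ M`, and `A → Â` is onto, so `M` already maps
onto its completion. -/
theorem isPrecomplete_of_finite {A M : Type*} [CommRing A] [AddCommGroup M] [Module A M]
    [Module.Finite A M] (I : Ideal A) [IsPrecomplete I A] : IsPrecomplete I M := by
  rw [← AdicCompletion.of_surjective_iff]
  intro x
  obtain ⟨z, rfl⟩ := AdicCompletion.ofTensorProduct_surjective_of_finite I M x
  induction z using TensorProduct.induction_on with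
  | zero => exact ⟨0, by simp⟩
  | tmul a m =>
    obtain ⟨r, rfl⟩ := AdicCompletion.of_surjective I A a
    refine ⟨r • m, ?_⟩
    rw [AdicCompletion.ofTensorProduct_tmul]
    ext n
    rfl
  | add a b ha hb =>
    obtain ⟨u, hu⟩ := ha
    obtain ⟨w, hw⟩ := hb
    exact ⟨u + w, by rw [map_add, map_add, hu, hw]⟩

theorem exists_pow_idempotent {M : Type*} [Monoid M] [Finite M] (x : M) :
    ∃ n, 0 < n ∧ x ^ n * x ^ n = x ^ n := by
  obtain ⟨a, b, hab, h⟩ := Finite.exists_ne_map_eq_of_infinite (fun n : ℕ => x ^ n)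
  wlog hlt : a < b generalizing a b
  · exact this b a hab.symm h.symm (by omega)
  obtain ⟨d, rfl⟩ := Nat.exists_eq_add_of_lt hlt
  have key : ∀ c j, x ^ (a + c) = x ^ (a + c + j * (d + 1)) := by
    intro c j
    induction j with
    | zero => simp
    | succ j ih =>
      rw [ih, show a + c + j * (d + 1) = a + (c + j * (d + 1)) by ring, pow_add, h, ← pow_add]
      congr 1; ring
  -- From exponent `a` on, the powers have period `d + 1`; this exponent is a multiple of the period
  -- and at least `a`.
  refine ⟨(a + 1) * (d + 1), by positivity, ?_⟩
  rw [← pow_add]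
  have := key ((a + 1) * (d + 1) - a) (a + 1)
  have h1 : a + ((a + 1) * (d + 1) - a) = (a + 1) * (d + 1) := by
    have : a ≤ (a + 1) * (d + 1) := by nlinarith
    omega
  rw [h1] at this
  exact this.symm

/-- In the finite quotient some power of `x` is idempotent. Hensel lifts it to an idempotent of the
domain `R`, that is to 0 or 1, so `1 - x ^ n` or `x ^ n` lies in `1 + I` and is a unit. -/
theorem isLocalRing_of_henselianRing {R : Type*} [CommRing R] [IsDomain R] (I : Ideal R)
    [HenselianRing R I] [Finite (R ⧸ I)] : IsLocalRing R := by
  have hu : ∀ x : R, x - 1 ∈ I → IsUnit x := by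
    intro x hx
    have := HenselianRing.jac (I := I) hx
    rw [Ideal.mem_jacobson_bot] at this
    simpa using this 1
  refine IsLocalRing.of_isUnit_or_isUnit_one_sub_self fun x => ?_
  obtain ⟨n, hn, h⟩ := exists_pow_idempotent (Ideal.Quotient.mk I x)
  rw [← map_pow] at h
  obtain ⟨e, he, hex⟩ := HenselianRing.is_henselian (I := I) (Polynomial.X ^ 2 - Polynomial.X)
    (by monicity!) (x ^ n) (by
      rw [← Ideal.Quotient.eq_zero_iff_mem]
      simp [pow_two] at h ⊢
      simp [h]) (by
      -- The derivative `2e - 1` at an idempotent `e` is its own inverse.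
      refine IsUnit.of_mul_eq_one (Ideal.Quotient.mk I (2 * x ^ n - 1)) ?_
      simp only [Polynomial.derivative_X_pow, Polynomial.derivative_X,
        Polynomial.eval_sub, map_sub, map_mul, map_one]
      simp
      simp at h
      rw [map_ofNat]
      linear_combination 4 * h)
  have he' : e * (e - 1) = 0 := by
    simp [Polynomial.IsRoot] at he
    linear_combination he
  rcases mul_eq_zero.1 he' with h0 | h0
  · right
    have hxn : IsUnit (1 - x ^ n) := hu _ (by
      rw [h0] at hex
      simpa using hex)
    exact isUnit_of_dvd_unit (by simpa using sub_dvd_pow_sub_pow 1 x n) hxn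
  · left
    have hxn : IsUnit (x ^ n) := hu _ (by
      rw [sub_eq_zero.1 h0] at hex
      simpa using I.neg_mem hex)
    exact (isUnit_pow_iff hn.ne').1 hxn

/-- The Hensel ideal `I` may be a proper power of the maximal ideal (ramification), so an
approximate root modulo `I` is needed first. It comes from iterating `a ↦ a² + m`. -/
theorem hasQuadraticRoots_of_henselianRing {R : Type*} [CommRing R] [IsLocalRing R] (I : Ideal R)
    [HenselianRing R I] (hI : I ≤ maximalIdeal R) {e : ℕ} (he : maximalIdeal R ^ e ≤ I) :
    HasQuadraticRoots R := by
  intro m hm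
  have key : ∀ k : ℕ, ∃ a ∈ maximalIdeal R, a * a - a + m ∈ maximalIdeal R ^ (k + 1) := by
    intro k
    induction k with
    | zero => exact ⟨0, Ideal.zero_mem _, by simpa using hm⟩
    | succ k ih =>
      obtain ⟨a, ha, h⟩ := ih
      have ha' : a * a + m ∈ maximalIdeal R := Ideal.add_mem _ (Ideal.mul_mem_left _ _ ha) hm
      -- With `f(a) = a² - a + m` and `a' = a² + m` one has `f(a') = f(a) (a' + a)`, which gains one
      -- power of the maximal ideal.
      refine ⟨a * a + m, ha', ?_⟩
      rw [pow_succ]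
      convert Ideal.mul_mem_mul h (Ideal.add_mem _ ha' ha) using 1
      ring
  obtain ⟨a, ha, h⟩ := key e
  obtain ⟨t, ht, hta⟩ := HenselianRing.is_henselian (I := I)
    (Polynomial.X ^ 2 - Polynomial.X + Polynomial.C m) (by monicity!) a (by
      simpa [pow_two] using he (Ideal.pow_le_pow_right (Nat.le_succ e) h)) (by
      apply IsUnit.map
      have : IsUnit (1 - 2 * a) := by
        by_contra hc
        have := Ideal.add_mem _ ((mem_maximalIdeal _).2 hc) (Ideal.mul_mem_left _ 2 ha)
        simp at this
      simpa [neg_sub, one_add_one_eq_two] using this.neg)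
  refine ⟨t, by simpa using Ideal.add_mem _ (hI hta) ha, ?_⟩
  simpa [Polynomial.IsRoot, pow_two] using ht

/-- Being finite over `A`, `S` is complete for the extended maximal ideal `I` and `S ⧸ I` is finite.
Hence `S` is Henselian and local, and a local Dedekind domain that is not a field is a discrete
valuation ring. -/
theorem dvr_of_finite_of_isAdicComplete {A S : Type*} [CommRing A] [IsDomain A]
    [IsDiscreteValuationRing A] [Finite (ResidueField A)] [IsAdicComplete (maximalIdeal A) A]
    [CommRing S] [IsDedekindDomain S] [Algebra A S] [Module.Finite A S] [FaithfulSMul A S] :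
    ∃ _ : IsDiscreteValuationRing S, Finite (ResidueField S) ∧ HasQuadraticRoots S := by
  set I := (maximalIdeal A).map (algebraMap A S) with hI
  have hI0 : I ≠ ⊥ := by
    rw [hI, Ne, Ideal.map_eq_bot_iff_of_injective (FaithfulSMul.algebraMap_injective _ _)]
    exact IsDiscreteValuationRing.not_a_field _
  have hItop : I ≠ ⊤ := by
    obtain ⟨Q, hQ, hQc⟩ := Ideal.exists_ideal_over_maximal_of_isIntegral (S := S) (maximalIdeal A)
      (by rw [(RingHom.injective_iff_ker_eq_bot _).1 (FaithfulSMul.algebraMap_injective A S)]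
          exact bot_le)
    exact ne_top_of_le_ne_top hQ.ne_top (Ideal.map_le_iff_le_comap.2 hQc.ge)
  have : IsNoetherianRing S := inferInstance
  have hpre : IsPrecomplete I S := IsPrecomplete.map_algebraMap_iff.2 (isPrecomplete_of_finite _)
  have hhaus : IsHausdorff I S := IsHausdorff.of_isDomain (I := I) (h := hItop)
  have hc : IsAdicComplete I S := {}
  have hfin : Finite (S ⧸ I) := by
    let : Field (A ⧸ maximalIdeal A) := Ideal.Quotient.field _
    have : Finite (A ⧸ maximalIdeal A) := inferInstanceAs (Finite (ResidueField A))
    let : Algebra (A ⧸ maximalIdeal A) (S ⧸ I) :=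
      Ideal.Quotient.algebraQuotientOfLEComap Ideal.le_comap_map
    have : IsScalarTower A (A ⧸ maximalIdeal A) (S ⧸ I) := IsScalarTower.of_algebraMap_eq' rfl
    have : Module.Finite (A ⧸ maximalIdeal A) (S ⧸ I) :=
      Module.Finite.of_restrictScalars_finite A _ _
    exact Module.finite_of_finite (A ⧸ maximalIdeal A)
  have hloc := isLocalRing_of_henselianRing I
  have hnf : ¬ IsField S := by
    intro h
    let := h.toField
    rcases Ideal.eq_bot_or_top I with h | h
    · exact hI0 h
    · exact hItop h
  have hdvr : IsDiscreteValuationRing S :=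
    ((IsDiscreteValuationRing.TFAE S hnf).out 0 2).2 ‹_›
  have hle : I ≤ maximalIdeal _ := le_maximalIdeal hItop
  refine ⟨hdvr, ?_, ?_⟩
  · exact Finite.of_surjective _ (Ideal.Quotient.factor_surjective hle)
  · obtain ⟨ϖ, hϖ⟩ := IsDiscreteValuationRing.exists_irreducible S
    obtain ⟨e, he⟩ := IsDiscreteValuationRing.ideal_eq_span_pow_irreducible hI0 hϖ
    refine hasQuadraticRoots_of_henselianRing I hle (e := e) ?_
    rw [he, hϖ.maximalIdeal_eq, Ideal.span_singleton_pow]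

section LocalField

variable (K₀ K : Type*) [Field K₀] [ValuativeRel K₀] [TopologicalSpace K₀]
  [IsNonarchimedeanLocalField K₀] [Field K] [Algebra K₀ K] [FiniteDimensional K₀ K]
  [Algebra.IsSeparable K₀ K]

theorem isAdicComplete_integer : IsAdicComplete 𝓂[K₀] 𝒪[K₀] :=
  letI := IsTopologicalAddGroup.rightUniformSpace K₀
  haveI := isUniformAddGroup_of_addCommGroup (G := K₀)
  inferInstance

instance isFractionRing_integerRing : IsFractionRing (IntegerRing K₀ K) K :=
  IsIntegralClosure.isFractionRing_of_finite_extension 𝒪[K₀] K₀ K (IntegerRing K₀ K)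

/-- The arithmetic of `B` below works over any discrete valuation ring with these two properties;
`K₀` returns only when `ψ` is compared with a `B`-valued form. -/
theorem integerRing_structure :
    ∃ _ : IsDiscreteValuationRing (IntegerRing K₀ K),
      Finite (ResidueField (IntegerRing K₀ K)) ∧ HasQuadraticRoots (IntegerRing K₀ K) := by
  have := IsIntegralClosure.finite 𝒪[K₀] K₀ K (IntegerRing K₀ K)
  have : IsDedekindDomain (IntegerRing K₀ K) :=
    IsIntegralClosure.isDedekindDomain 𝒪[K₀] K₀ K (IntegerRing K₀ K)
  have := isAdicComplete_integer K₀
  have : FaithfulSMul 𝒪[K₀] (IntegerRing K₀ K) := by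
    rw [faithfulSMul_iff_algebraMap_injective]
    intro x y hxy
    have h : algebraMap K₀ K (x : K₀) = algebraMap K₀ K (y : K₀) := congrArg Subtype.val hxy
    exact Subtype.ext ((algebraMap K₀ K).injective h)
  exact dvr_of_finite_of_isAdicComplete (A := 𝒪[K₀])

end LocalField

/-! ### Reduced trace, reduced norm and canonical involution -/

section Quaternion

variable (K : Type*) {B : Type*} [Field K] [Ring B] [Algebra K B]

/-- The reduced trace as a linear map. -/
def trd : B →ₗ[K] K :=
  (2⁻¹ : K) • (LinearMap.trace K B ∘ₗ (Algebra.lmul K B).toLinearMap)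

theorem trd_apply (x : B) : trd K x = reducedTrace K x := rfl

theorem conj_eq (x : B) : conj K x = algebraMap K B (trd K x) - x := rfl

/-- The reduced norm of a quaternion algebra. -/
def nrd (x : B) : K := 2⁻¹ * (trd K x ^ 2 - trd K (x * x))

variable {K}

theorem trd_mul_comm (x y : B) : trd K (x * y) = trd K (y * x) := by
  simp only [trd, LinearMap.smul_apply, LinearMap.comp_apply, AlgHom.toLinearMap_apply, map_mul]
  rw [LinearMap.trace_mul_comm]

theorem conj_add (x y : B) : conj K (x + y) = conj K x + conj K y := by
  simp only [conj_eq, map_add]; abel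

theorem conj_neg (x : B) : conj K (-x) = -conj K x := by
  simp only [conj_eq, map_neg]; abel

theorem conj_sub (x y : B) : conj K (x - y) = conj K x - conj K y := by
  rw [sub_eq_add_neg, conj_add, conj_neg, sub_eq_add_neg]

theorem conj_zero : conj K (0 : B) = 0 := by simp [conj_eq]

theorem add_conj (x : B) : x + conj K x = algebraMap K B (trd K x) := by
  rw [conj_eq]; abel

end Quaternion

section Transfer

variable {K B : Type*} [Field K] [Ring B] [Algebra K B] {a b : K} (h2 : (2 : K) ≠ 0)
  (e : B ≃ₐ[K] ℍ[K,a,b])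

include h2 in
theorem trd_quaternionAlgebra (x : ℍ[K,a,b]) : trd K x = 2 * x.re := by
  rw [trd_apply, reducedTrace, LinearMap.trace_eq_matrix_trace K (QuaternionAlgebra.basisOneIJK a 0 b)]
  simp only [Matrix.trace, Matrix.diag, Fin.sum_univ_four, LinearMap.toMatrix_apply]
  simp [QuaternionAlgebra.basisOneIJK]
  field_simp
  ring

theorem trd_algEquiv {B' : Type*} [Ring B'] [Algebra K B'] (e : B ≃ₐ[K] B') (x : B) :
    trd K (e x) = trd K x := by
  rw [trd_apply, trd_apply, reducedTrace, reducedTrace, ← LinearMap.trace_conj' _ e.toLinearEquiv]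
  congr 2
  ext y
  simp [LinearEquiv.conj_apply]

theorem conj_algEquiv {B' : Type*} [Ring B'] [Algebra K B'] (e : B ≃ₐ[K] B') (x : B) :
    conj K (e x) = e (conj K x) := by
  simp [conj_eq, trd_algEquiv e]

theorem nrd_algEquiv {B' : Type*} [Ring B'] [Algebra K B'] (e : B ≃ₐ[K] B') (x : B) :
    nrd K (e x) = nrd K x := by
  rw [nrd, nrd, trd_algEquiv e, ← map_mul, trd_algEquiv e]

include h2 in
theorem conj_quaternionAlgebra (x : ℍ[K,a,b]) : conj K x = star x := by
  rw [conj_eq, trd_quaternionAlgebra h2, QuaternionAlgebra.algebraMap_eq]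
  ext <;> simp
  ring

include h2 in
theorem nrd_quaternionAlgebra (x : ℍ[K,a,b]) : algebraMap K _ (nrd K x) = x * star x := by
  rw [nrd, trd_quaternionAlgebra h2, trd_quaternionAlgebra h2, QuaternionAlgebra.algebraMap_eq]
  ext <;> simp <;> field_simp <;> ring

end Transfer

/-- A quaternion algebra over a field in which `2 ≠ 0`. -/
structure Quat (K B : Type*) [Field K] [Ring B] [Algebra K B] : Prop where
  two_ne_zero : (2 : K) ≠ 0
  isQuaternion : IsQuaternionAlgebra K B

namespace Quat

variable {K B : Type*} [Field K] [Ring B] [Algebra K B] (hq : Quat K B)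

include hq

theorem finite : Module.Finite K B := by
  obtain ⟨-, a, b, -, -, ⟨e⟩⟩ := hq
  exact Module.Finite.equiv e.symm.toLinearEquiv

theorem nontrivial : Nontrivial B := by
  obtain ⟨-, a, b, -, -, ⟨e⟩⟩ := hq
  exact e.toEquiv.nontrivial

theorem finrank_eq : Module.finrank K B = 4 := by
  obtain ⟨-, a, b, -, -, ⟨e⟩⟩ := hq
  rw [e.toLinearEquiv.finrank_eq, QuaternionAlgebra.finrank_eq_four]

theorem algebraMap_injective : Function.Injective (algebraMap K B) :=
  haveI := hq.nontrivial
  (algebraMap K B).injective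

theorem conj_mul (x y : B) : conj K (x * y) = conj K y * conj K x := by
  obtain ⟨h2, a, b, -, -, ⟨e⟩⟩ := hq
  apply e.injective
  rw [← conj_algEquiv, map_mul, map_mul, ← conj_algEquiv, ← conj_algEquiv]
  simp only [conj_quaternionAlgebra h2, star_mul]

theorem conj_conj (x : B) : conj K (conj K x) = x := by
  obtain ⟨h2, a, b, -, -, ⟨e⟩⟩ := hq
  apply e.injective
  rw [← conj_algEquiv, ← conj_algEquiv]
  simp only [conj_quaternionAlgebra h2, star_star]

theorem conj_algebraMap (c : K) : conj K (algebraMap K B c) = algebraMap K B c := by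
  obtain ⟨h2, a, b, -, -, ⟨e⟩⟩ := hq
  apply e.injective
  rw [← conj_algEquiv, conj_quaternionAlgebra h2]
  simp

theorem conj_one : conj K (1 : B) = 1 := by
  simpa using hq.conj_algebraMap 1

theorem trd_algebraMap (c : K) : trd K (algebraMap K B c) = 2 * c := by
  apply hq.algebraMap_injective
  rw [← add_conj, hq.conj_algebraMap, ← map_add, two_mul]

theorem trd_conj (x : B) : trd K (conj K x) = trd K x := by
  apply hq.algebraMap_injective
  rw [← add_conj, hq.conj_conj, ← add_conj, add_comm]

theorem mul_conj (x : B) : x * conj K x = algebraMap K B (nrd K x) := by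
  obtain ⟨h2, a, b, -, -, ⟨e⟩⟩ := hq
  apply e.injective
  rw [map_mul, ← conj_algEquiv, AlgEquiv.commutes, ← nrd_algEquiv e, nrd_quaternionAlgebra h2,
    conj_quaternionAlgebra h2]

theorem nrd_conj (x : B) : nrd K (conj K x) = nrd K x := by
  rw [nrd, nrd, ← hq.conj_mul, hq.trd_conj, hq.trd_conj]

theorem conj_mul_self (x : B) : conj K x * x = algebraMap K B (nrd K x) := by
  have := hq.mul_conj (conj K x)
  rwa [hq.conj_conj, hq.nrd_conj] at this

theorem nrd_mul (x y : B) : nrd K (x * y) = nrd K x * nrd K y := by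
  apply hq.algebraMap_injective
  rw [← hq.mul_conj, hq.conj_mul, map_mul, ← hq.mul_conj x, mul_assoc, ← mul_assoc y, hq.mul_conj y,
    ← mul_assoc, ← Algebra.commutes, mul_assoc, Algebra.commutes]

theorem nrd_algebraMap (c : K) : nrd K (algebraMap K B c) = c * c := by
  apply hq.algebraMap_injective
  rw [← hq.mul_conj, hq.conj_algebraMap, map_mul]

theorem nrd_one : nrd K (1 : B) = 1 := by
  simpa using hq.nrd_algebraMap 1

/-- The reduced norm as a monoid homomorphism. -/
def nrdHom : B →* K where
  toFun := nrd K
  map_one' := hq.nrd_one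
  map_mul' := hq.nrd_mul

theorem mul_self (x : B) :
    x * x = algebraMap K B (trd K x) * x - algebraMap K B (nrd K x) := by
  have := hq.conj_mul_self x
  rw [conj_eq, sub_mul] at this
  rw [← this]; abel

theorem nrd_add (x y : B) : nrd K (x + y) = nrd K x + nrd K y + trd K (x * conj K y) := by
  apply hq.algebraMap_injective
  rw [← hq.mul_conj, map_add, map_add, ← hq.mul_conj, ← hq.mul_conj, ← add_conj, hq.conj_mul,
    hq.conj_conj, conj_add]
  noncomm_ring

theorem isUnit_iff (x : B) : IsUnit x ↔ nrd K x ≠ 0 := by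
  constructor
  · intro h h0
    have := h.map hq.nrdHom
    exact this.ne_zero h0
  · intro h
    have h1 : algebraMap K B (nrd K x)⁻¹ * algebraMap K B (nrd K x) = 1 := by
      rw [← map_mul, inv_mul_cancel₀ h, map_one]
    rw [isUnit_iff_exists]
    refine ⟨algebraMap K B (nrd K x)⁻¹ * conj K x, ?_, ?_⟩
    · rw [← mul_assoc, ← Algebra.commutes, mul_assoc, hq.mul_conj, h1]
    · rw [mul_assoc, hq.conj_mul_self, h1]

/-- Multiplying by `1, i, j, ij` and taking the trace reads off the coordinates up to nonzero
factors. -/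
theorem trd_nondegenerate {x : B} (h : ∀ y, trd K (x * y) = 0) : x = 0 := by
  obtain ⟨h2, a, b, ha, hb, ⟨e⟩⟩ := hq
  have h' : ∀ y : ℍ[K,a,b], (e x * y).re = 0 := by
    intro y
    have := h (e.symm y)
    rw [← trd_algEquiv e, map_mul, trd_quaternionAlgebra h2] at this
    simpa [h2] using this
  have h1 := h' ⟨1, 0, 0, 0⟩
  have h3 := h' ⟨0, 1, 0, 0⟩
  have h4 := h' ⟨0, 0, 1, 0⟩
  have h5 := h' ⟨0, 0, 0, 1⟩
  simp [ha, hb] at h1 h3 h4 h5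
  apply e.injective
  ext <;> simp [*]

theorem nrd_zero : nrd K (0 : B) = 0 := by simpa using hq.nrd_algebraMap 0

theorem trd_one : trd K (1 : B) = 2 := by simpa using hq.trd_algebraMap 1

theorem nrd_smul (c : K) (x : B) : nrd K (c • x) = c * c * nrd K x := by
  rw [Algebra.smul_def, hq.nrd_mul, hq.nrd_algebraMap]

theorem isSimpleRing : IsSimpleRing B := by
  have := hq.nontrivial
  refine IsSimpleRing.of_eq_bot_or_eq_top fun I => ?_
  by_contra! hI
  obtain ⟨x, hx, hx0⟩ : ∃ x ∈ I, x ≠ 0 := by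
    by_contra! h
    refine hI.1 (le_bot_iff.1 fun x hx => ?_)
    simpa using h x hx
  obtain ⟨y, hy⟩ : ∃ y, trd K (x * y) ≠ 0 := by
    by_contra! h
    exact hx0 (hq.trd_nondegenerate h)
  obtain ⟨h2, a, b, ha, hb, ⟨e⟩⟩ := hq
  set z := x * y with hz
  have hzI : z ∈ I := I.mul_mem_right _ _ hx
  rw [← trd_algEquiv e, trd_quaternionAlgebra h2] at hy
  have hre : (e z).re ≠ 0 := by simpa [h2] using hy
  -- The sum of the conjugates of `z` by `1, i, j, ij` is four times its scalar part, so a two-sided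
  -- ideal containing `z` contains 1.
  have key : (1 : ℍ[K,a,b]) = ⟨(4 * (e z).re)⁻¹, 0, 0, 0⟩ *
      (e z + ⟨0, a⁻¹, 0, 0⟩ * e z * ⟨0, 1, 0, 0⟩ + ⟨0, 0, b⁻¹, 0⟩ * e z * ⟨0, 0, 1, 0⟩ +
        ⟨0, 0, 0, -a⁻¹ * b⁻¹⟩ * e z * ⟨0, 0, 0, 1⟩) := by
    have h4 : (4 : K) ≠ 0 := by
      have : (4 : K) = 2 * 2 := by norm_num
      rw [this]; exact mul_ne_zero h2 h2
    ext <;> simp <;> field_simp <;> ring_nf <;> simp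
  apply hI.2
  rw [← TwoSidedIdeal.one_mem_iff]
  have h1 := congrArg e.symm key
  simp only [map_one, map_mul, map_add, AlgEquiv.symm_apply_apply] at h1
  rw [h1]
  refine I.mul_mem_left _ _ (I.add_mem (I.add_mem (I.add_mem hzI ?_) ?_) ?_) <;>
  exact I.mul_mem_right _ _ (I.mul_mem_left _ _ hzI)

/-- A quaternion algebra which is not a division algebra is a matrix algebra. -/
theorem exists_algEquiv_matrix (hnd : ¬ IsDivision B) :
    Nonempty (B ≃ₐ[K] Matrix (Fin 2) (Fin 2) K) := by
  have := hq.nontrivial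
  have := hq.finite
  have := hq.isSimpleRing
  have : IsArtinianRing B := IsArtinianRing.of_finite K B
  obtain ⟨n, hn, D, _, _, _, ⟨e⟩⟩ := IsSimpleRing.exists_algEquiv_matrix_divisionRing_finite K B
  have hf := e.toLinearEquiv.finrank_eq
  rw [hq.finrank_eq, Module.finrank_matrix] at hf
  simp only [Fintype.card_fin] at hf
  have hn2 : n ≤ 2 := by
    by_contra! h
    have : 0 < Module.finrank K D := Module.finrank_pos
    nlinarith
  have hn0 := hn.out
  have : n = 1 ∨ n = 2 := by omega
  rcases this with rfl | rfl
  · exfalso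
    apply hnd
    refine ⟨hq.nontrivial, fun x hx => ?_⟩
    have e' : B ≃+* D := e.toRingEquiv.trans (Matrix.uniqueRingEquiv)
    have : IsUnit (e' x) := by
      rw [isUnit_iff_ne_zero]
      simpa using hx
    simpa using this.map e'.symm
  · have hD : Module.finrank K D = 1 := by omega
    have hb : Function.Bijective (algebraMap K D) := by
      refine ⟨(algebraMap K D).injective, fun d => ?_⟩
      obtain ⟨c, hc⟩ := (finrank_eq_one_iff_of_nonzero' (1 : D) one_ne_zero).1 hD d
      exact ⟨c, by rw [← hc, Algebra.smul_def, mul_one]⟩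
    exact ⟨e.trans (AlgEquiv.ofBijective (Algebra.ofId K D) hb).symm.mapMatrix⟩

end Quat

/-! ### Fractions over a discrete valuation ring -/

section DVR

variable (R K : Type*) [CommRing R] [IsDomain R] [IsDiscreteValuationRing R] [Field K]
  [Algebra R K] [IsFractionRing R K]

/-- The image of `R` in its field of fractions. -/
def integers : Subring K := (algebraMap R K).range

variable {R K}

omit [IsDomain R] [IsDiscreteValuationRing R] [IsFractionRing R K] in
theorem algebraMap_mem_integers (r : R) : algebraMap R K r ∈ integers R K := ⟨r, rfl⟩

omit [IsDiscreteValuationRing R] [IsDomain R] in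
theorem algebraMap_eq_zero_iff' {r : R} : algebraMap R K r = 0 ↔ r = 0 :=
  IsFractionRing.to_map_eq_zero_iff

/-- This dichotomy plays the role of the valuation of `K` in what follows. -/
theorem mem_integers_or (x : K) :
    x ∈ integers R K ∨ x ≠ 0 ∧ ∃ m ∈ maximalIdeal R, algebraMap R K m = x⁻¹ := by
  by_cases hx : x ∈ integers R K
  · exact Or.inl hx
  right
  have hx0 : x ≠ 0 := by rintro rfl; exact hx (Subring.zero_mem _)
  refine ⟨hx0, ?_⟩
  rcases ValuationRing.isInteger_or_isInteger R x with ⟨r, hr⟩ | ⟨r, hr⟩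
  · exact absurd ⟨r, hr⟩ hx
  · refine ⟨r, ?_, hr⟩
    rw [mem_maximalIdeal]
    intro hu
    obtain ⟨u, rfl⟩ := hu
    apply hx
    refine ⟨(u⁻¹ : Rˣ), ?_⟩
    rw [← inv_inv x, ← hr]
    refine eq_inv_of_mul_eq_one_left ?_
    rw [← map_mul]; simp

/-- If `x` were not integral, `m = x⁻¹` would lie in the maximal ideal and `D = (D x ^ k) m ^ k` in
all of its powers, contradicting Krull's intersection theorem. -/
theorem mem_integers_of_pow {x D : K} (hD : D ≠ 0) (h : ∀ k : ℕ, D * x ^ k ∈ integers R K) :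
    x ∈ integers R K := by
  rcases mem_integers_or (R := R) x with hx | ⟨hx0, m, hm, hmx⟩
  · exact hx
  exfalso
  obtain ⟨d, hd⟩ := h 0
  rw [pow_zero, mul_one] at hd
  have hd0 : d ∈ (⨅ i : ℕ, maximalIdeal R ^ i) := by
    rw [Ideal.mem_iInf]
    intro k
    obtain ⟨r, hr⟩ := h k
    have : d = r * m ^ k := by
      apply IsFractionRing.injective R K
      rw [map_mul, map_pow, hmx, hr, hd, inv_pow, mul_assoc, mul_inv_cancel₀ (pow_ne_zero _ hx0),
        mul_one]
    rw [this]
    exact Ideal.mul_mem_left _ _ (Ideal.pow_mem_pow hm k)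
  rw [Ideal.iInf_pow_eq_bot_of_isLocalRing _ (Ideal.IsPrime.ne_top'), Ideal.mem_bot] at hd0
  exact hD (by rw [← hd, hd0, map_zero])

omit [IsDiscreteValuationRing R] in
theorem exists_mul_mem_integers {N : Submodule R K} (hN : N.FG) :
    ∃ d : R, d ≠ 0 ∧ ∀ x ∈ N, algebraMap R K d * x ∈ integers R K := by
  obtain ⟨S, rfl⟩ := hN
  obtain ⟨b, hb⟩ := IsLocalization.exist_integer_multiples_of_finset (nonZeroDivisors R) S
  refine ⟨b, nonZeroDivisors.ne_zero b.2, fun x hx => ?_⟩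
  induction hx using Submodule.span_induction with
  | mem x hx =>
    obtain ⟨r, hr⟩ := hb x hx
    exact ⟨r, by rw [hr, Algebra.smul_def]⟩
  | zero => rw [mul_zero]; exact Subring.zero_mem _
  | add x y _ _ hx hy => rw [mul_add]; exact Subring.add_mem _ hx hy
  | smul r x _ hx =>
    rw [Algebra.smul_def, mul_left_comm]
    exact Subring.mul_mem _ ⟨r, rfl⟩ hx

theorem exists_eq_unit_mul_zpow {x : K} (hx : x ≠ 0) {ϖ : R} (hϖ : Irreducible ϖ) :
    ∃ (u : Rˣ) (k : ℤ), x = algebraMap R K u * algebraMap R K ϖ ^ k := by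
  have key : ∀ r : R, algebraMap R K r ≠ 0 → ∃ (u : Rˣ) (k : ℕ),
      algebraMap R K r = algebraMap R K u * algebraMap R K ϖ ^ k := by
    intro r hr
    obtain ⟨k, u, rfl⟩ := IsDiscreteValuationRing.eq_unit_mul_pow_irreducible
      (x := r) (fun h => hr (by rw [h, map_zero])) hϖ
    exact ⟨u, k, by rw [map_mul, map_pow]⟩
  rcases mem_integers_or (R := R) x with ⟨r, rfl⟩ | ⟨-, m, -, hm⟩
  · obtain ⟨u, k, h⟩ := key r hx
    exact ⟨u, k, by rw [h, zpow_natCast]⟩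
  · obtain ⟨u, k, h⟩ := key m (by rw [hm]; exact inv_ne_zero hx)
    refine ⟨u⁻¹, -k, ?_⟩
    have hu : algebraMap R K (u⁻¹ : Rˣ) = (algebraMap R K u)⁻¹ := by
      refine eq_inv_of_mul_eq_one_left ?_
      rw [← map_mul]; simp
    rw [← inv_inv x, ← hm, h, hu, mul_inv, zpow_neg, zpow_natCast]

omit [IsDomain R] [IsDiscreteValuationRing R] in
theorem unit_mul_zpow_mem_integers {ϖ : R} (hϖ : Irreducible ϖ) (u : Rˣ) (k : ℤ) :
    algebraMap R K u * algebraMap R K ϖ ^ k ∈ integers R K ↔ 0 ≤ k := by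
  constructor
  · rintro ⟨r, hr⟩
    by_contra! hk
    obtain ⟨j, rfl⟩ : ∃ j : ℕ, k = -(j + 1 : ℕ) := ⟨(-k - 1).toNat, by omega⟩
    have hϖ0 : algebraMap R K ϖ ≠ 0 := by rw [Ne, algebraMap_eq_zero_iff']; exact hϖ.ne_zero
    rw [zpow_neg, zpow_natCast, ← div_eq_mul_inv, eq_div_iff (pow_ne_zero _ hϖ0), ← map_pow,
      ← map_mul] at hr
    have h := IsFractionRing.injective R K hr
    apply hϖ.not_isUnit
    refine isUnit_of_dvd_unit ?_ u.isUnit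
    rw [← h]
    exact Dvd.dvd.mul_left (dvd_pow_self _ (Nat.succ_ne_zero _)) _
  · intro hk
    obtain ⟨j, rfl⟩ := Int.eq_ofNat_of_zero_le hk
    rw [zpow_natCast, ← map_pow, ← map_mul]
    exact ⟨_, rfl⟩

/-- In a complete discrete valuation ring `s + c s² = m` is solvable if `c m` lies in the
maximal ideal. -/
theorem HasQuadraticRoots.exists_root (hR : HasQuadraticRoots R) {c m : R}
    (hm : c * m ∈ maximalIdeal R) : ∃ s : R, s + c * s * s = m := by
  -- With `r² - r = cm`, the choice `s = m / (1 - r)` works because `(1 - r) + cm = (1 - r)²`.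
  obtain ⟨r, hr, h⟩ := hR (-(c * m)) (neg_mem hm)
  have hu : IsUnit (1 - r) := by
    by_contra hc
    have := Ideal.add_mem _ ((mem_maximalIdeal _).2 hc) hr
    simp at this
  obtain ⟨u, hu⟩ := hu.exists_right_inv
  refine ⟨m * u, ?_⟩
  linear_combination (-m * u ^ 2) * h + (m + m * (1 - r) * u - m * u) * hu

theorem mem_integers_of_mul_self {x : K} (h : x * x ∈ integers R K) : x ∈ integers R K := by
  rcases mem_integers_or (R := R) x with hx | ⟨hx0, m, hm, hmx⟩
  · exact hx
  obtain ⟨r, hr⟩ := h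
  exfalso
  have h1 : (1 : R) = r * m * m := by
    apply IsFractionRing.injective R K
    rw [map_mul, map_mul, hr, hmx, map_one]
    field_simp
  exact (Ideal.ne_top_iff_one _).1 Ideal.IsPrime.ne_top' (h1 ▸ Ideal.mul_mem_left _ _ hm)

/-- An entry of least valuation; dividing by it makes the family integral and primitive. -/
theorem exists_maximal_entry {ι : Type*} [Finite ι] (f : ι → K) (hf : ∃ i, f i ≠ 0) :
    ∃ i, f i ≠ 0 ∧ ∀ j, (f i)⁻¹ * f j ∈ integers R K := by
  have := Fintype.ofFinite ι
  classical
  suffices h : ∀ s : Finset ι, (∃ i ∈ s, f i ≠ 0) →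
      ∃ i, f i ≠ 0 ∧ ∀ j ∈ s, (f i)⁻¹ * f j ∈ integers R K by
    obtain ⟨i, hi⟩ := hf
    obtain ⟨j, hj, hj'⟩ := h Finset.univ ⟨i, Finset.mem_univ _, hi⟩
    exact ⟨j, hj, fun l => hj' l (Finset.mem_univ _)⟩
  intro s
  induction s using Finset.induction_on with
  | empty => simp
  | insert a s ha ih =>
    rintro ⟨i, hi, hi0⟩
    by_cases hs : ∃ i ∈ s, f i ≠ 0
    · obtain ⟨j, hj, hj'⟩ := ih hs
      rcases mem_integers_or (R := R) ((f j)⁻¹ * f a) with h | ⟨h0, m, hm, hmx⟩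
      · refine ⟨j, hj, fun l hl => ?_⟩
        rcases Finset.mem_insert.1 hl with rfl | hl
        exacts [h, hj' l hl]
      · have ha0 : f a ≠ 0 := right_ne_zero_of_mul h0
        refine ⟨a, ha0, fun l hl => ?_⟩
        rcases Finset.mem_insert.1 hl with rfl | hl
        · rw [inv_mul_cancel₀ ha0]; exact Subring.one_mem _
        · have : (f a)⁻¹ * f l = algebraMap R K m * ((f j)⁻¹ * f l) := by
            rw [hmx]; field_simp
          rw [this]
          exact Subring.mul_mem _ ⟨m, rfl⟩ (hj' l hl)
    · push Not at hs
      have hia : i = a := by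
        rcases Finset.mem_insert.1 hi with h | h
        exacts [h, absurd (hs i h) hi0]
      subst hia
      refine ⟨i, hi0, fun l hl => ?_⟩
      rcases Finset.mem_insert.1 hl with rfl | hl
      · rw [inv_mul_cancel₀ hi0]; exact Subring.one_mem _
      · rw [hs l hl, mul_zero]; exact Subring.zero_mem _

end DVR

/-! ### Ternary quadratic forms over finite fields -/

section IsotropicForm

/-- A ternary quadratic form over a finite field has a nontrivial zero. -/
theorem exists_ternary_zero {k : Type*} [Field k] [Finite k] (a b c d e f : k) :
    ∃ x y z : k, (x ≠ 0 ∨ y ≠ 0 ∨ z ≠ 0) ∧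
      a * x * x + b * y * y + c * z * z + d * x * y + e * y * z + f * x * z = 0 := by
  classical
  have := Fintype.ofFinite k
  obtain ⟨p, hp⟩ := CharP.exists k
  have hp' := CharP.char_is_prime k p
  let X : Fin 3 → MvPolynomial (Fin 3) k := MvPolynomial.X
  let C : k → MvPolynomial (Fin 3) k := MvPolynomial.C
  let F : MvPolynomial (Fin 3) k := C a * X 0 * X 0 + C b * X 1 * X 1 + C c * X 2 * X 2 +
    C d * X 0 * X 1 + C e * X 1 * X 2 + C f * X 0 * X 2
  have hterm : ∀ (t : k) (i j : Fin 3), (C t * X i * X j).totalDegree ≤ 2 := by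
    intro t i j
    refine (MvPolynomial.totalDegree_mul _ _).trans ?_
    have h1 := MvPolynomial.totalDegree_mul (C t) (X i)
    simp only [X, C, MvPolynomial.totalDegree_C, MvPolynomial.totalDegree_X] at h1 ⊢
    omega
  have hF : F.totalDegree ≤ 2 := by
    refine (MvPolynomial.totalDegree_add _ _).trans (max_le ?_ (hterm _ _ _))
    refine (MvPolynomial.totalDegree_add _ _).trans (max_le ?_ (hterm _ _ _))
    refine (MvPolynomial.totalDegree_add _ _).trans (max_le ?_ (hterm _ _ _))
    refine (MvPolynomial.totalDegree_add _ _).trans (max_le ?_ (hterm _ _ _))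
    exact (MvPolynomial.totalDegree_add _ _).trans (max_le (hterm _ _ _) (hterm _ _ _))
  -- Chevalley–Warning: the number of zeros is divisible by `p`, and the trivial zero makes it
  -- positive.
  have hdvd := char_dvd_card_solutions p (f := F) (by simp; omega)
  have hev : ∀ v : Fin 3 → k, MvPolynomial.eval v F = a * v 0 * v 0 + b * v 1 * v 1 + c * v 2 * v 2 +
      d * v 0 * v 1 + e * v 1 * v 2 + f * v 0 * v 2 := by
    intro v; simp [F, X, C]
  have hcard : 1 < Fintype.card { v : Fin 3 → k // MvPolynomial.eval v F = 0 } := by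
    refine lt_of_lt_of_le hp'.one_lt (Nat.le_of_dvd ?_ hdvd)
    exact Fintype.card_pos_iff.2 ⟨⟨0, by rw [hev]; simp⟩⟩
  obtain ⟨⟨v, hv⟩, hne⟩ := Fintype.exists_ne_of_one_lt_card hcard ⟨0, by rw [hev]; simp⟩
  refine ⟨v 0, v 1, v 2, ?_, by rw [← hev, hv]⟩
  by_contra! h
  apply hne
  ext i
  fin_cases i <;> simp [h]

end IsotropicForm

/-! ### Orders and integrality of trace and norm -/

section Order

variable {R K B : Type*} [CommRing R] [IsDomain R] [IsDiscreteValuationRing R] [Field K]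
  [Algebra R K] [IsFractionRing R K] [Ring B] [Algebra K B] [Algebra R B] [IsScalarTower R K B]
  (hq : Quat K B)

include hq

/-- The traces of `O` have a common denominator `d`. As `2 Nrd(x)^k = Trd(x^k)² - Trd(x^(2k))`, the
products `2 d² Nrd(x)^k` are all integral, and almost integral elements are integral. -/
theorem IsOrder.nrd_mem {O : Subalgebra R B} (hO : IsOrder K O) {x : B} (hx : x ∈ O) :
    nrd K x ∈ integers R K := by
  obtain ⟨d, hd0, hd⟩ := exists_mul_mem_integers (R := R) (K := K)
    (hO.1.map ((trd K (B := B)).restrictScalars R))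
  have htr : ∀ y ∈ O, algebraMap R K d * trd K y ∈ integers R K := fun y hy =>
    hd _ ⟨y, hy, rfl⟩
  have hdK : algebraMap R K d ≠ 0 := by rwa [Ne, algebraMap_eq_zero_iff']
  have h2 := hq.two_ne_zero
  refine mem_integers_of_pow (D := 2 * algebraMap R K d * algebraMap R K d)
    (mul_ne_zero (mul_ne_zero h2 hdK) hdK) fun k => ?_
  have hk : nrd K x ^ k = nrd K (x ^ k) := (map_pow hq.nrdHom x k).symm
  have hxk : x ^ k ∈ O := O.pow_mem hx k
  have : 2 * algebraMap R K d * algebraMap R K d * nrd K x ^ k =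
      (algebraMap R K d * trd K (x ^ k)) * (algebraMap R K d * trd K (x ^ k)) -
        algebraMap R K d * (algebraMap R K d * trd K (x ^ k * x ^ k)) := by
    rw [hk, nrd]
    field_simp
  rw [this]
  exact Subring.sub_mem _ (Subring.mul_mem _ (htr _ hxk) (htr _ hxk))
    (Subring.mul_mem _ ⟨d, rfl⟩ (htr _ (O.mul_mem hxk hxk)))

/-- `Nrd(x + 1) = Nrd x + Trd x + 1`, and norms are integral. -/
theorem IsOrder.trd_mem {O : Subalgebra R B} (hO : IsOrder K O) {x : B} (hx : x ∈ O) :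
    trd K x ∈ integers R K := by
  have h1 := hO.nrd_mem hq (O.add_mem hx O.one_mem)
  rw [hq.nrd_add, hq.conj_one, mul_one, hq.nrd_one] at h1
  have h3 := Subring.sub_mem _ (Subring.sub_mem _ h1 (hO.nrd_mem hq hx)) (Subring.one_mem _)
  convert h3 using 1
  ring

theorem IsOrder.conj_mem {O : Subalgebra R B} (hO : IsOrder K O) {x : B} (hx : x ∈ O) :
    conj K x ∈ O := by
  obtain ⟨r, hr⟩ := hO.trd_mem hq hx
  rw [conj_eq, ← hr, ← IsScalarTower.algebraMap_apply]
  exact O.sub_mem (O.algebraMap_mem r) hx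

/-- The trace form `(x, y) ↦ Trd (x y)`. -/
def traceForm (K B : Type*) [Field K] [Ring B] [Algebra K B] : LinearMap.BilinForm K B :=
  (LinearMap.mul K B).compr₂ (trd K)

omit hq in
theorem traceForm_apply (x y : B) : traceForm K B x y = trd K (x * y) := rfl

theorem traceForm_nondegenerate : (traceForm K B).Nondegenerate := by
  refine ⟨fun x h => hq.trd_nondegenerate h, fun y h => hq.trd_nondegenerate fun x => ?_⟩
  rw [trd_mul_comm]
  exact h x

omit [IsFractionRing R K] in
-- `S` is contained in the trace dual of the lattice spanned by a `K`-basis taken from `S`. That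
-- dual is finitely generated and `R` is noetherian.
theorem isOrder_of_trd_mem (S : Subalgebra R B) (hspan : Submodule.span K (S : Set B) = ⊤)
    (htr : ∀ x ∈ S, trd K x ∈ integers R K) : IsOrder K S := by
  refine ⟨?_, hspan⟩
  have := hq.finite
  let b := Module.Basis.ofSpan hspan.ge
  have hb : Set.range b ⊆ S := Module.Basis.ofSpan_subset hspan.ge
  have : Finite ((linearIndepOn_empty K id).extend (Set.empty_subset (S : Set B))) :=
    Module.Finite.finite_basis b
  classical
  have hle : Subalgebra.toSubmodule S ≤
      (traceForm K B).dualSubmodule (Submodule.span R (Set.range b)) := by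
    intro x hx y hy
    rw [traceForm_apply]
    have hy' : y ∈ S := Submodule.span_le (p := Subalgebra.toSubmodule S).2 hb hy
    obtain ⟨r, hr⟩ := htr _ (S.mul_mem hx hy')
    rw [← hr]
    exact Submodule.algebraMap_mem r
  rw [LinearMap.BilinForm.dualSubmodule_span_of_basis _ (traceForm_nondegenerate hq)] at hle
  have : IsNoetherian R (Submodule.span R (Set.range
      ((traceForm K B).dualBasis (traceForm_nondegenerate hq) b))) :=
    isNoetherian_span_of_finite R (Set.finite_range _)
  have h2 := this.noetherian ((Subalgebra.toSubmodule S).comap (Submodule.subtype _))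
  have h3 := h2.map (Submodule.subtype _)
  rwa [Submodule.map_comap_subtype, inf_eq_right.2 hle] at h3

omit [IsFractionRing R K] in
-- By Nakayama, otherwise `1` and `c` would generate `O`, hence span the four-dimensional `B`. This
-- supplies elements of `O` that are independent modulo the maximal ideal.
theorem not_forall_mem_span_pair {O : Subalgebra R B} (hO : IsOrder K O) (c : B) {m : R}
    (hm : m ∈ maximalIdeal R) :
    ∃ x ∈ O, ∀ r s : R, ∀ y ∈ O,
      x ≠ algebraMap R B r + algebraMap R B s * c + algebraMap R B m * y := by
  by_contra! h
  have hle : Subalgebra.toSubmodule O ≤ Submodule.span R {1, c} := by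
    refine Submodule.le_of_le_smul_of_le_jacobson_bot (I := maximalIdeal R) hO.1
      (maximalIdeal_le_jacobson _) fun x hx => ?_
    obtain ⟨r, s, y, hy, rfl⟩ := h x hx
    refine Submodule.add_mem_sup (Submodule.mem_span_pair.2 ⟨r, s, ?_⟩) ?_
    · rw [Algebra.smul_def, Algebra.smul_def, mul_one]
    · rw [← Algebra.smul_def]
      exact Submodule.smul_mem_smul hm hy
  have htop : (⊤ : Submodule K B) ≤ Submodule.span K {1, c} := by
    rw [← hO.2, Submodule.span_le]
    intro x hx
    obtain ⟨r, s, rfl⟩ := Submodule.mem_span_pair.1 (hle hx)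
    refine Submodule.mem_span_pair.2 ⟨algebraMap R K r, algebraMap R K s, ?_⟩
    simp only [algebraMap_smul]
  classical
  have h1 := finrank_span_finset_le_card (R := K) ({1, c} : Finset B)
  have h2 : ({1, c} : Finset B).card ≤ 2 := Finset.card_le_two
  rw [Set.finrank, Finset.coe_pair, top_le_iff.1 htop, finrank_top, hq.finrank_eq] at h1
  omega

end Order

/-! ### Division algebras: the maximal order and its norm form -/

section Division

variable {R K B : Type*} [CommRing R] [IsDomain R] [IsDiscreteValuationRing R] [Field K]
  [Algebra R K] [IsFractionRing R K] [Ring B] [Algebra K B] [Algebra R B] [IsScalarTower R K B]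
  (hq : Quat K B) (hdiv : IsDivision B) (hR : HasQuadraticRoots R)

include hq hdiv

theorem eq_zero_of_nrd {x : B} (h : nrd K x = 0) : x = 0 := by
  by_contra hx
  exact (hq.isUnit_iff x).1 (hdiv.2 x hx) h

theorem mul_eq_zero_of_isDivision {x y : B} (h : x * y = 0) : x = 0 ∨ y = 0 := by
  have h1 := hq.nrd_mul x y
  rw [h, hq.nrd_zero, eq_comm, mul_eq_zero] at h1
  exact h1.imp (eq_zero_of_nrd hq hdiv) (eq_zero_of_nrd hq hdiv)

include hR

/-- Otherwise `x² - x + m = 0` factors over `R`, so in a division algebra `x` is a scalar `c`. Then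
`c² = m` or the choice of root puts `c` in the maximal ideal, against `2c = Trd x = 1`. -/
theorem nrd_ne_of_trd_eq_one {x : B} (hx : trd K x = 1) {m : R} (hm : m ∈ maximalIdeal R) :
    nrd K x ≠ algebraMap R K m := by
  intro h
  obtain ⟨t, ht, hroot⟩ := hR m hm
  have hfac : (x - algebraMap R B t) * (x - algebraMap R B (1 - t)) = 0 := by
    have h1 := hq.mul_self x
    rw [hx, h, map_one, one_mul, ← IsScalarTower.algebraMap_apply] at h1
    have h3 : algebraMap R B m = algebraMap R B t - algebraMap R B t * algebraMap R B t := by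
      rw [← map_mul, ← map_sub]; congr 1; linear_combination hroot
    rw [sub_mul, mul_sub, mul_sub, h1, h3, ← Algebra.commutes (1 - t) x, map_sub, map_one]
    noncomm_ring
  have key : ∀ c : R, x = algebraMap R B c → algebraMap R K (2 * c) = 1 ∧ c * c = m := by
    rintro c rfl
    rw [IsScalarTower.algebraMap_apply R K B, hq.trd_algebraMap] at hx
    rw [IsScalarTower.algebraMap_apply R K B, hq.nrd_algebraMap, ← map_mul] at h
    exact ⟨by rw [map_mul, map_ofNat, hx], IsFractionRing.injective R K h⟩
  have hcm : ∃ c ∈ maximalIdeal R, x = algebraMap R B c := by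
    rcases mul_eq_zero_of_isDivision hq hdiv hfac with h0 | h0
    · exact ⟨t, ht, sub_eq_zero.1 h0⟩
    · refine ⟨1 - t, ?_, sub_eq_zero.1 h0⟩
      have := (key _ (sub_eq_zero.1 h0)).2
      have hmm : (1 - t) * (1 - t) ∈ maximalIdeal R := by rwa [this]
      rcases (inferInstance : (maximalIdeal R).IsPrime).mem_or_mem hmm with h | h <;> exact h
  obtain ⟨c, hc, hxc⟩ := hcm
  have h1 := (key c hxc).1
  rw [← map_one (algebraMap R K)] at h1
  have h3 := IsFractionRing.injective R K h1
  have : (1 : R) ∈ maximalIdeal R := by rw [← h3]; exact Ideal.mul_mem_left _ _ hc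
  exact (Ideal.ne_top_iff_one _).1 Ideal.IsPrime.ne_top' this

/-- If `ϖ Nrd x` is integral then so is `Trd x`. -/
theorem trd_mem_of_mul_nrd_mem {x : B} {ϖ : R} (hϖ : Irreducible ϖ)
    (hn : algebraMap R K ϖ * nrd K x ∈ integers R K) : trd K x ∈ integers R K := by
  rcases mem_integers_or (R := R) (trd K x) with h | ⟨h0, m, hm, hmt⟩
  · exact h
  exfalso
  obtain ⟨r, hr⟩ := hn
  rw [hϖ.maximalIdeal_eq, Ideal.mem_span_singleton'] at hm
  obtain ⟨n, rfl⟩ := hm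
  -- If `Trd x` is not integral, its inverse `nϖ` lies in the maximal ideal, and `x / Trd x` has
  -- trace 1 and norm `(nϖ)² Nrd x = n r (nϖ)`.
  refine nrd_ne_of_trd_eq_one hq hdiv hR (x := algebraMap R K (n * ϖ) • x) ?_
    (m := n * r * (n * ϖ)) ?_ ?_
  · rw [map_smul, hmt, smul_eq_mul, inv_mul_cancel₀ h0]
  · rw [hϖ.maximalIdeal_eq]
    exact Ideal.mul_mem_left _ _ (Ideal.mul_mem_left _ _ (Ideal.mem_span_singleton_self _))
  · rw [hq.nrd_smul]
    simp only [map_mul, hr]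
    ring

theorem trd_mem_of_nrd_mem {x : B} (hn : nrd K x ∈ integers R K) : trd K x ∈ integers R K := by
  obtain ⟨ϖ, hϖ⟩ := IsDiscreteValuationRing.exists_irreducible R
  exact trd_mem_of_mul_nrd_mem hq hdiv hR hϖ (Subring.mul_mem _ ⟨ϖ, rfl⟩ hn)

/-- The valuation ring `{x | Nrd x ∈ R}` of a division quaternion algebra. -/
def valuationOrder : Subalgebra R B where
  carrier := {x | nrd K x ∈ integers R K}
  mul_mem' {x y} hx hy := by
    simp only [Set.mem_ofPred_eq] at *
    rw [hq.nrd_mul]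
    exact Subring.mul_mem _ hx hy
  add_mem' {x y} hx hy := by
    simp only [Set.mem_ofPred_eq] at *
    rw [hq.nrd_add]
    -- The cross term `Trd(x ȳ)` is integral because `Nrd(x ȳ)` is.
    refine Subring.add_mem _ (Subring.add_mem _ hx hy) (trd_mem_of_nrd_mem hq hdiv hR ?_)
    rw [hq.nrd_mul, hq.nrd_conj]
    exact Subring.mul_mem _ hx hy
  algebraMap_mem' r := by
    simp only [Set.mem_ofPred_eq]
    rw [IsScalarTower.algebraMap_apply R K B, hq.nrd_algebraMap, ← map_mul]
    exact ⟨_, rfl⟩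

/-- Every order lies in the valuation ring of `B`, which is itself an order because its traces are
integral. -/
theorem mem_maximalOrder_iff {O : Subalgebra R B} (hO : Maximal (IsOrder K) O) {x : B} :
    x ∈ O ↔ nrd K x ∈ integers R K := by
  have hle : O ≤ valuationOrder hq hdiv hR := fun x hx => hO.1.nrd_mem hq hx
  have hv : IsOrder K (valuationOrder hq hdiv hR) := by
    refine isOrder_of_trd_mem hq _ ?_ fun x hx => trd_mem_of_nrd_mem hq hdiv hR hx
    rw [eq_top_iff, ← hO.1.2]
    exact Submodule.span_mono hle
  exact ⟨fun hx => hle hx, fun hx => hO.2 hv hle hx⟩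

end Division

section Division

variable {R K B : Type*} [CommRing R] [IsDomain R] [IsDiscreteValuationRing R] [Field K]
  [Algebra R K] [IsFractionRing R K] [Ring B] [Algebra K B] [Algebra R B] [IsScalarTower R K B]
  (hq : Quat K B) (hdiv : IsDivision B) (hR : HasQuadraticRoots R)
  {O : Subalgebra R B} (hO : Maximal (IsOrder K) O)

omit [IsDomain R] [IsDiscreteValuationRing R] [IsFractionRing R K] in
theorem algebraMap_tower (r : R) : algebraMap R B r = algebraMap K B (algebraMap R K r) :=
  IsScalarTower.algebraMap_apply R K B r

include hq

omit [IsDomain R] [IsDiscreteValuationRing R] [IsFractionRing R K] in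
theorem nrd_algebraMap_mul (r : R) (x : B) :
    nrd K (algebraMap R B r * x) = algebraMap R K (r * r) * nrd K x := by
  rw [hq.nrd_mul, algebraMap_tower (K := K), hq.nrd_algebraMap, map_mul]

omit [IsDomain R] [IsDiscreteValuationRing R] [IsFractionRing R K] hq in
theorem trd_algebraMap_mul (r : R) (x : B) :
    trd K (algebraMap R B r * x) = algebraMap R K r * trd K x := by
  rw [algebraMap_tower (K := K), ← Algebra.smul_def, map_smul, smul_eq_mul]

omit [IsDomain R] [IsDiscreteValuationRing R] [IsFractionRing R K] in
theorem nrd_algebraMap' (r : R) : nrd K (algebraMap R B r) = algebraMap R K (r * r) := by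
  rw [algebraMap_tower (K := K), hq.nrd_algebraMap, map_mul]

omit [IsDomain R] [IsDiscreteValuationRing R] [IsFractionRing R K] in
theorem nrd_ternary (x y z : R) (e f : B) :
    nrd K (algebraMap R B x + algebraMap R B y * e + algebraMap R B z * f) =
      algebraMap R K (x * x) + algebraMap R K (y * y) * nrd K e + algebraMap R K (z * z) * nrd K f
      + algebraMap R K (x * y) * trd K e + algebraMap R K (y * z) * trd K (e * conj K f) +
      algebraMap R K (x * z) * trd K f := by
  have hc : ∀ r : R, ∀ w : B, conj K (algebraMap R B r * w) = algebraMap R B r * conj K w := by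
    intro r w
    rw [hq.conj_mul, algebraMap_tower (K := K), hq.conj_algebraMap, Algebra.commutes]
  rw [hq.nrd_add, hq.nrd_add, nrd_algebraMap' hq, nrd_algebraMap_mul hq, nrd_algebraMap_mul hq,
    hc, hc, trd_algebraMap_mul, trd_algebraMap_mul, hq.trd_conj, add_mul, map_add,
    trd_algebraMap_mul, trd_algebraMap_mul, hq.trd_conj, mul_assoc (algebraMap R B y),
    trd_algebraMap_mul, ← mul_assoc e, ← Algebra.commutes z e, mul_assoc, trd_algebraMap_mul]
  simp only [map_mul]
  ring

include hdiv hR hO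

/-- A division quaternion algebra over a local field contains an element whose reduced norm is a
uniformizer. -/
theorem exists_nrd_irreducible [Finite (ResidueField R)] :
    ∃ P : B, ∃ ϖ : R, Irreducible ϖ ∧ nrd K P = algebraMap R K ϖ := by
  have mem_iff := fun x => mem_maximalOrder_iff hq hdiv hR hO (x := x)
  obtain ⟨ϖ, hϖ⟩ := IsDiscreteValuationRing.exists_irreducible R
  have hϖm : ϖ ∈ maximalIdeal R := (mem_maximalIdeal _).2 hϖ.not_isUnit
  -- `1, e, f` are independent modulo `ϖ O`. The norm form restricted to their span is ternary, so
  -- it has a nontrivial zero over the residue field.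
  obtain ⟨e, he, hei⟩ := not_forall_mem_span_pair hq hO.1 1 hϖm
  obtain ⟨f, hf, hfi⟩ := not_forall_mem_span_pair hq hO.1 e hϖm
  obtain ⟨n₁, hn₁⟩ := hO.1.nrd_mem hq he
  obtain ⟨n₂, hn₂⟩ := hO.1.nrd_mem hq hf
  obtain ⟨t₁, ht₁⟩ := hO.1.trd_mem hq he
  obtain ⟨t₂, ht₂⟩ := hO.1.trd_mem hq hf
  obtain ⟨t₃, ht₃⟩ := hO.1.trd_mem hq (O.mul_mem he (hO.1.conj_mem hq hf))
  obtain ⟨x, y, z, hne, h0⟩ := exists_ternary_zero (1 : ResidueField R) (residue R n₁)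
    (residue R n₂) (residue R t₁) (residue R t₃) (residue R t₂)
  obtain ⟨x, rfl⟩ := residue_surjective x
  obtain ⟨y, rfl⟩ := residue_surjective y
  obtain ⟨z, rfl⟩ := residue_surjective z
  set w := algebraMap R B x + algebraMap R B y * e + algebraMap R B z * f with hw
  have hwO : w ∈ O := O.add_mem (O.add_mem (O.algebraMap_mem _)
    (O.mul_mem (O.algebraMap_mem _) he)) (O.mul_mem (O.algebraMap_mem _) hf)
  set n := x * x + y * y * n₁ + z * z * n₂ + x * y * t₁ + y * z * t₃ + x * z * t₂ with hn
  have hnw : nrd K w = algebraMap R K n := by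
    rw [hw, nrd_ternary hq, ← hn₁, ← hn₂, ← ht₁, ← ht₂, ← ht₃, hn]
    simp only [map_add, map_mul]
  have hnm : n ∈ maximalIdeal R := by
    rw [← residue_eq_zero_iff, ← h0, hn]
    simp only [map_add, map_mul]
    ring
  rw [hϖ.maximalIdeal_eq, Ideal.mem_span_singleton'] at hnm
  obtain ⟨q, hqn⟩ := hnm
  refine ⟨w, n, ?_, hnw⟩
  -- If `ϖ²` divided `Nrd w`, then `w = ϖ v` with `v` in `O` by the norm criterion, against the
  -- independence of `1, e, f`. The cases below are on the last coefficient that is a unit.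
  have hqu : IsUnit q := by
    by_contra hqu
    rw [← mem_nonunits_iff, ← mem_maximalIdeal, hϖ.maximalIdeal_eq,
      Ideal.mem_span_singleton'] at hqu
    obtain ⟨q', rfl⟩ := hqu
    have hϖ0 : algebraMap R K ϖ ≠ 0 := by rw [Ne, algebraMap_eq_zero_iff']; exact hϖ.ne_zero
    obtain ⟨v, hv, hvw⟩ : ∃ v ∈ O, w = algebraMap R B ϖ * v := by
      refine ⟨(algebraMap R K ϖ)⁻¹ • w, ?_, ?_⟩
      · rw [mem_iff, hq.nrd_smul, hnw, ← hqn]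
        refine ⟨q', ?_⟩
        simp only [map_mul]
        field_simp
      · rw [algebraMap_tower (K := K), ← Algebra.smul_def, smul_smul, mul_inv_cancel₀ hϖ0, one_smul]
    have hdich : ∀ r : R, residue R r ≠ 0 → ∃ r', r' * r = 1 := by
      intro r hr
      rw [residue_ne_zero_iff_isUnit] at hr
      exact hr.exists_left_inv
    have hdich' : ∀ r : R, ¬ residue R r ≠ 0 → ∃ r', r' * ϖ = r := by
      intro r hr
      rw [not_not, residue_eq_zero_iff, hϖ.maximalIdeal_eq, Ideal.mem_span_singleton'] at hr
      exact hr
    have hcom : ∀ r : R, ∀ u : B, u * algebraMap R B r = algebraMap R B r * u := fun r u =>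
      (Algebra.commutes r u).symm
    rw [hvw] at hw
    by_cases hz : residue R z ≠ 0
    · obtain ⟨z', hz'⟩ := hdich z hz
      refine hfi (-(z' * x)) (-(z' * y)) (algebraMap R B z' * v)
        (O.mul_mem (O.algebraMap_mem _) hv) ?_
      have h1 := congrArg (algebraMap R B z' * ·) hw
      simp only [mul_add, ← mul_assoc, ← map_mul, hz', map_one, one_mul] at h1
      rw [← mul_assoc, ← map_mul, mul_comm ϖ, h1]
      simp only [map_neg, map_mul]
      noncomm_ring
    obtain ⟨z', rfl⟩ := hdich' z hz
    by_cases hy : residue R y ≠ 0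
    · obtain ⟨y', hy'⟩ := hdich y hy
      refine hei (-(y' * x)) 0 (algebraMap R B y' * (v - algebraMap R B z' * f))
        (O.mul_mem (O.algebraMap_mem _) (O.sub_mem hv (O.mul_mem (O.algebraMap_mem _) hf))) ?_
      have h1 := congrArg (algebraMap R B y' * ·) hw
      simp only [mul_add, ← mul_assoc, ← map_mul, hy', map_one, one_mul] at h1
      rw [← mul_assoc, ← map_mul, mul_comm ϖ, mul_sub, h1, ← mul_assoc, ← map_mul]
      rw [show y' * ϖ * z' = y' * (z' * ϖ) by ring]
      simp only [map_neg, map_zero]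
      noncomm_ring
    obtain ⟨y', rfl⟩ := hdich' y hy
    have hx : residue R x ≠ 0 := by
      rcases hne with h | h | h
      exacts [h, absurd h hy, absurd h hz]
    obtain ⟨x', hx'⟩ := hdich x hx
    set v' := v - algebraMap R B y' * e - algebraMap R B z' * f with hv'
    have hv'O : v' ∈ O := O.sub_mem (O.sub_mem hv (O.mul_mem (O.algebraMap_mem _) he))
      (O.mul_mem (O.algebraMap_mem _) hf)
    have h1 : algebraMap R B x = algebraMap R B ϖ * v' := by
      rw [hv', mul_sub, mul_sub, hw, ← mul_assoc, ← mul_assoc, ← map_mul, ← map_mul,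
        mul_comm ϖ, mul_comm ϖ]
      noncomm_ring
    have h3 := congrArg (nrd K) h1
    rw [nrd_algebraMap' hq, nrd_algebraMap_mul hq] at h3
    obtain ⟨r, hr⟩ := (mem_iff v').1 hv'O
    rw [← hr, ← map_mul] at h3
    have h4 := IsFractionRing.injective R K h3
    have h5 : (1 : R) ∈ maximalIdeal R := by
      have : (1 : R) = x' * x' * ϖ * r * ϖ := by
        linear_combination (-x' * x - 1) * hx' + x' * x' * h4
      rw [this]
      exact Ideal.mul_mem_left _ _ hϖm
    exact (Ideal.ne_top_iff_one _).1 Ideal.IsPrime.ne_top' h5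
  obtain ⟨u, rfl⟩ := hqu
  rw [← hqn]
  exact (irreducible_units_mul u).2 hϖ

omit hdiv hR hO in
theorem exists_eq_mul_of_nrd {a x : B} (ha : nrd K a ≠ 0) {c : K} (h : nrd K x = nrd K a * c) :
    ∃ y, x = a * y ∧ nrd K y = c := by
  have ha' : IsUnit a := (hq.isUnit_iff a).2 ha
  obtain ⟨a, rfl⟩ := ha'
  refine ⟨(a⁻¹ : Bˣ) * x, by simp, ?_⟩
  apply mul_left_cancel₀ ha
  rw [← h, ← hq.nrd_mul]
  simp

/-- The residue algebra of the maximal order is anisotropic of rank at least two. -/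
theorem exists_anisotropic [Finite (ResidueField R)] :
    ∃ e ∈ O, ∃ t n : R, trd K e = algebraMap R K t ∧ nrd K e = algebraMap R K n ∧
      ∀ x y : R, x * x + x * y * t + y * y * n ∈ maximalIdeal R →
        x ∈ maximalIdeal R ∧ y ∈ maximalIdeal R := by
  have mem_iff := fun x => mem_maximalOrder_iff hq hdiv hR hO (x := x)
  obtain ⟨P, ϖ, hϖ, hP⟩ := exists_nrd_irreducible hq hdiv hR hO
  have hϖ0 : algebraMap R K ϖ ≠ 0 := by rw [Ne, algebraMap_eq_zero_iff']; exact hϖ.ne_zero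
  -- Otherwise `O = R + P O`, hence `O = R + R P + P² O = R + R P + ϖ O`, which Nakayama forbids.
  obtain ⟨e, he, hei⟩ : ∃ e ∈ O, ∀ r m : R, m ∈ maximalIdeal R →
      nrd K (e - algebraMap R B r) ≠ algebraMap R K m := by
    by_contra! h
    have hdecomp : ∀ x ∈ O, ∃ r : R, ∃ y ∈ O, x = algebraMap R B r + P * y := by
      intro x hx
      obtain ⟨r, m, hm, hrm⟩ := h x hx
      rw [hϖ.maximalIdeal_eq, Ideal.mem_span_singleton'] at hm
      obtain ⟨m', rfl⟩ := hm
      obtain ⟨y, hy, hny⟩ := exists_eq_mul_of_nrd hq (a := P)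
        (x := x - algebraMap R B r) (c := algebraMap R K m') (by rwa [hP])
        (by rw [hrm, hP, map_mul, mul_comm])
      exact ⟨r, y, (mem_iff _).2 ⟨m', hny.symm⟩, by rw [← hy]; abel⟩
    obtain ⟨x, hx, hxi⟩ := not_forall_mem_span_pair hq hO.1 P
      ((mem_maximalIdeal _).2 hϖ.not_isUnit)
    obtain ⟨r, y, hy, rfl⟩ := hdecomp x hx
    obtain ⟨s, z, hz, rfl⟩ := hdecomp y hy
    obtain ⟨v, hv, hnv⟩ := exists_eq_mul_of_nrd hq (a := algebraMap R B ϖ) (x := P * (P * z))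
      (c := nrd K z) (by rw [nrd_algebraMap' hq, map_mul]; exact mul_ne_zero hϖ0 hϖ0)
      (by rw [nrd_algebraMap' hq, hq.nrd_mul, hq.nrd_mul, hP, map_mul, mul_assoc])
    refine hxi r s v ((mem_iff _).2 (by rw [hnv]; exact (mem_iff _).1 hz)) ?_
    rw [mul_add, hv, Algebra.commutes s, add_assoc]
  obtain ⟨t, ht⟩ := hO.1.trd_mem hq he
  obtain ⟨n, hn⟩ := hO.1.nrd_mem hq he
  refine ⟨e, he, t, n, ht.symm, hn.symm, fun x y hxy => ?_⟩
  have hy : y ∈ maximalIdeal R := by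
    by_contra hy
    rw [mem_maximalIdeal, mem_nonunits_iff, not_not] at hy
    obtain ⟨y', hy'⟩ := hy.exists_right_inv
    refine hei (-(y' * x)) _ (Ideal.mul_mem_left _ (y' * y') hxy) ?_
    have h1 : e - algebraMap R B (-(y' * x)) =
        algebraMap R B y' * (algebraMap R B x + algebraMap R B y * e + algebraMap R B 0 * 0) := by
      rw [mul_zero, add_zero, mul_add, ← mul_assoc, ← map_mul, ← map_mul, mul_comm y' y, hy',
        map_neg, map_one, one_mul]
      abel
    rw [h1, nrd_algebraMap_mul hq, nrd_ternary hq, ← hn, ← ht]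
    simp only [map_add, map_mul, map_zero, mul_zero, zero_mul, add_zero]
    ring
  refine ⟨?_, hy⟩
  have h1 : x * x ∈ maximalIdeal R := by
    have : x * x = (x * x + x * y * t + y * y * n) - y * (x * t + y * n) := by ring
    rw [this]
    exact Ideal.sub_mem _ hxy (Ideal.mul_mem_right _ _ hy)
  rcases (inferInstance : (maximalIdeal R).IsPrime).mem_or_mem h1 with h | h <;> exact h

/-- If no trace is a unit, then `2 = Trd 1` is not one either. Over the finite residue field of
characteristic 2, `n` is a square `r²`, so the residual form becomes `(x + r y)²` and is isotropic
at `(-r, 1)`, against anisotropy. -/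
theorem exists_trd_eq_one [Finite (ResidueField R)] : ∃ c ∈ O, trd K c = 1 := by
  obtain ⟨e, he, t, n, ht, hn, hani⟩ := exists_anisotropic hq hdiv hR hO
  suffices h : ∃ c ∈ O, ∃ u : Rˣ, trd K c = algebraMap R K u by
    obtain ⟨c, hc, u, hu⟩ := h
    refine ⟨algebraMap R B (u⁻¹ : Rˣ) * c, O.mul_mem (O.algebraMap_mem _) hc, ?_⟩
    rw [trd_algebraMap_mul, hu, ← map_mul]; simp
  by_contra! h
  have hm : ∀ c ∈ O, ∀ r : R, trd K c = algebraMap R K r → r ∈ maximalIdeal R := by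
    intro c hc r hr
    rw [mem_maximalIdeal]
    rintro ⟨u, rfl⟩
    exact h c hc u hr
  have h2 : (2 : R) ∈ maximalIdeal R := hm 1 O.one_mem 2 (by rw [hq.trd_one, map_ofNat])
  have hchar : ringChar (ResidueField R) = 2 := by
    have h20 : ((2 : ℕ) : ResidueField R) = 0 := by
      have := (residue_eq_zero_iff (2 : R)).2 h2
      rw [map_ofNat] at this
      exact_mod_cast this
    have hd := (ringChar.spec (ResidueField R) 2).1 h20
    exact ((Nat.prime_dvd_prime_iff_eq (CharP.char_is_prime (ResidueField R) _)
      Nat.prime_two).1 hd)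
  obtain ⟨r, hr⟩ := FiniteField.isSquare_of_char_two hchar (residue R n)
  obtain ⟨r, rfl⟩ := residue_surjective r
  have h1 := (hani (-r) 1 (by
    rw [← residue_eq_zero_iff]
    have htm := (residue_eq_zero_iff t).2 (hm e he t ht)
    have h2' := (residue_eq_zero_iff (2 : R)).2 h2
    simp only [map_add, map_mul, map_neg, map_one, hr, htm, map_ofNat] at h2' ⊢
    linear_combination residue R r * residue R r * h2')).2
  exact (Ideal.ne_top_iff_one _).1 Ideal.IsPrime.ne_top' h1

/-- A residual zero of `x² + t x y + n y² - u z²` has `z ≠ 0` by anisotropy, so `u` is a norm up to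
a factor `≡ 1`. Such a factor is the norm `1 + s + n₁ s²` of `1 + s c` with `Trd c = 1`, by solving
for `s`. -/
theorem exists_nrd_eq_unit [Finite (ResidueField R)] (u : Rˣ) :
    ∃ y : B, nrd K y = algebraMap R K u := by
  obtain ⟨e, he, t, n, ht, hn, hani⟩ := exists_anisotropic hq hdiv hR hO
  obtain ⟨c, hc, htc⟩ := exists_trd_eq_one hq hdiv hR hO
  obtain ⟨n₁, hn₁⟩ := hO.1.nrd_mem hq hc
  obtain ⟨x, y, z, hne, h0⟩ := exists_ternary_zero (1 : ResidueField R) (residue R n)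
    (-residue R u) (residue R t) 0 0
  obtain ⟨x, rfl⟩ := residue_surjective x
  obtain ⟨y, rfl⟩ := residue_surjective y
  obtain ⟨z, rfl⟩ := residue_surjective z
  have hz : residue R z ≠ 0 := by
    intro hz
    have := hani x y (by
      rw [← residue_eq_zero_iff]
      simp only [map_add, map_mul]
      rw [hz] at h0
      linear_combination h0)
    rw [← residue_eq_zero_iff, ← residue_eq_zero_iff] at this
    rcases hne with h | h | h
    exacts [h this.1, h this.2, h hz]
  rw [residue_ne_zero_iff_isUnit] at hz
  obtain ⟨z', hz'⟩ := hz.exists_right_inv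
  set w := (u⁻¹ : Rˣ) * (z' * z') * (x * x + x * y * t + y * y * n) with hw
  have hw1 : residue R w = 1 := by
    have h1 := congrArg (residue R) hz'
    have h3 := congrArg (residue R) u.inv_mul
    rw [hw]
    simp only [map_mul, map_add, map_one] at h1 h3 ⊢
    linear_combination (residue R (u⁻¹ : Rˣ) * (residue R z' * residue R z')) * h0 + h3 +
      residue R (u⁻¹ : Rˣ) * residue R u * (residue R z * residue R z' + 1) * h1
  have hwu : IsUnit w := by
    rw [← residue_ne_zero_iff_isUnit, hw1]; exact one_ne_zero
  obtain ⟨w', hw'⟩ := hwu.exists_right_inv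
  obtain ⟨s, hs⟩ := hR.exists_root (c := n₁) (m := w' - 1) (Ideal.mul_mem_left _ _ <| by
    rw [← residue_eq_zero_iff]
    have := congrArg (residue R) hw'
    simp only [map_mul, hw1, map_one, one_mul] at this
    rw [map_sub, this, map_one, sub_self])
  refine ⟨algebraMap R B z' * (algebraMap R B x + algebraMap R B y * e + algebraMap R B 0 * 0) *
    (algebraMap R B 1 + algebraMap R B s * c + algebraMap R B 0 * 0), ?_⟩
  rw [hq.nrd_mul, nrd_algebraMap_mul hq, nrd_ternary hq, nrd_ternary hq, hn, ht, htc, ← hn₁,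
    ← map_one (algebraMap R K)]
  simp only [hq.nrd_zero, mul_zero, conj_zero, map_zero, add_zero, ← map_mul, ← map_add]
  congr 1
  have huw : (u : R) * w = z' * z' * (x * x + x * y * t + y * y * n) := by
    rw [hw, ← mul_assoc, ← mul_assoc, u.mul_inv, one_mul]
  linear_combination (-(1 + s + n₁ * s * s)) * huw + u * w * hs + u * hw'

theorem exists_nrd_eq [Finite (ResidueField R)] (x : K) : ∃ y : B, nrd K y = x := by
  by_cases hx : x = 0
  · exact ⟨0, by rw [hx, hq.nrd_zero]⟩
  obtain ⟨P, ϖ, hϖ, hP⟩ := exists_nrd_irreducible hq hdiv hR hO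
  have hϖ0 : algebraMap R K ϖ ≠ 0 := by rw [Ne, algebraMap_eq_zero_iff']; exact hϖ.ne_zero
  obtain ⟨u, k, rfl⟩ := exists_eq_unit_mul_zpow hx hϖ
  obtain ⟨y, hy⟩ := exists_nrd_eq_unit hq hdiv hR hO u
  obtain ⟨P, rfl⟩ := (hq.isUnit_iff P).2 (by rwa [hP])
  refine ⟨y * (P ^ k : Bˣ), ?_⟩
  rw [hq.nrd_mul, hy]
  congr 1
  have := congrArg Units.val (map_zpow (Units.map hq.nrdHom) P k)
  rw [Units.val_zpow_eq_zpow_val] at this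
  simp only [Units.coe_map] at this
  exact this.trans (by rw [← hP]; rfl)

/-- In valuation terms, the trace dual of `O` is `Π⁻¹ O`. If `x` has smaller order, then `ϖ⁻¹` lies
in `x O`, and pairing with an element of trace 1 produces the non-integral trace `ϖ⁻¹`. -/
theorem trd_mul_mem_iff [Finite (ResidueField R)] {ϖ : R} (hϖ : Irreducible ϖ) (x : B) :
    (∀ b ∈ O, trd K (x * b) ∈ integers R K) ↔ algebraMap R K ϖ * nrd K x ∈ integers R K := by
  have mem_iff := fun x => mem_maximalOrder_iff hq hdiv hR hO (x := x)
  have hϖ0 : algebraMap R K ϖ ≠ 0 := by rw [Ne, algebraMap_eq_zero_iff']; exact hϖ.ne_zero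
  constructor
  · intro h
    by_contra hx
    obtain ⟨c, hc, htc⟩ := exists_trd_eq_one hq hdiv hR hO
    have hx0 : nrd K x ≠ 0 := by
      intro h; apply hx; rw [h, mul_zero]; exact Subring.zero_mem _
    obtain ⟨-, m, hm, hmx⟩ := (mem_integers_or (R := R) _).resolve_left hx
    rw [hϖ.maximalIdeal_eq, Ideal.mem_span_singleton'] at hm
    obtain ⟨m', rfl⟩ := hm
    obtain ⟨y, hy, hny⟩ := exists_eq_mul_of_nrd hq (a := x)
      (x := (algebraMap R K ϖ)⁻¹ • (1 : B)) (c := algebraMap R K m') hx0 (by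
        rw [hq.nrd_smul, hq.nrd_one, mul_one]
        rw [map_mul] at hmx
        field_simp at hmx ⊢
        linear_combination -hmx)
    have h1 := h (y * c) (O.mul_mem ((mem_iff y).2 ⟨m', hny.symm⟩) hc)
    rw [← mul_assoc, ← hy, smul_mul_assoc, one_mul, map_smul, htc, smul_eq_mul, mul_one] at h1
    obtain ⟨r, hr⟩ := h1
    apply hϖ.not_isUnit
    refine IsUnit.of_mul_eq_one r (IsFractionRing.injective R K ?_)
    rw [map_mul, hr, map_one, mul_inv_cancel₀ hϖ0]
  · intro h b hb
    refine trd_mem_of_mul_nrd_mem hq hdiv hR hϖ ?_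
    rw [hq.nrd_mul, ← mul_assoc]
    exact Subring.mul_mem _ h ((mem_iff b).1 hb)

end Division

/-! ### The split case: matrix orders -/

theorem trd_matrix {K : Type*} [Field K] (h2 : (2 : K) ≠ 0) (x : Matrix (Fin 2) (Fin 2) K) :
    trd K x = x 0 0 + x 1 1 := by
  rw [trd_apply, reducedTrace, LinearMap.trace_eq_matrix_trace K (Matrix.stdBasis K (Fin 2) (Fin 2))]
  simp only [Matrix.trace, Matrix.diag, Fintype.sum_prod_type, Fin.sum_univ_two,
    LinearMap.toMatrix_apply, Matrix.stdBasis_eq_single]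
  simp [Matrix.stdBasis, Matrix.mul_apply]
  field_simp
  ring

section Split

variable {R K B : Type*} [CommRing R] [IsDomain R] [IsDiscreteValuationRing R] [Field K]
  [Algebra R K] [IsFractionRing R K] [Ring B] [Algebra K B] [Algebra R B] [IsScalarTower R K B]

/-- The order of elements with integral entries with respect to a matrix splitting. -/
def matrixOrder (R : Type*) [CommRing R] [Algebra R K] [Algebra R B] [IsScalarTower R K B]
    (e : B ≃ₐ[K] Matrix (Fin 2) (Fin 2) K) : Subalgebra R B where
  carrier := {x | ∀ i j, e x i j ∈ integers R K}
  mul_mem' {x y} hx hy i j := by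
    rw [map_mul, Matrix.mul_apply]
    exact Subring.sum_mem _ fun k _ => Subring.mul_mem _ (hx i k) (hy k j)
  add_mem' {x y} hx hy i j := by
    rw [map_add, Matrix.add_apply]
    exact Subring.add_mem _ (hx i j) (hy i j)
  algebraMap_mem' r i j := by
    rw [algebraMap_tower (K := K), AlgEquiv.commutes, Matrix.algebraMap_matrix_apply]
    split_ifs
    · exact ⟨r, rfl⟩
    · exact Subring.zero_mem _

/-- The columns of the matrices in `O` generate an `O`-stable lattice `M` in `K²`. In an `R`-basis
of `M` the order `O` has integral entries, and maximality makes it all of the matrix order. -/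
theorem exists_algEquiv_integral_matrix (hq : Quat K B) {O : Subalgebra R B}
    (hO : Maximal (IsOrder K) O) (e₀ : B ≃ₐ[K] Matrix (Fin 2) (Fin 2) K) :
    ∃ e : B ≃ₐ[K] Matrix (Fin 2) (Fin 2) K, ∀ x, x ∈ O ↔ ∀ i j, e x i j ∈ integers R K := by
  let φ : Fin 2 → B →ₗ[R] (Fin 2 → K) := fun j =>
    ((LinearMap.pi fun i => Matrix.entryLinearMap K K i j) ∘ₗ
      e₀.toLinearEquiv.toLinearMap).restrictScalars R
  have hφ : ∀ j x i, φ j x i = e₀ x i j := fun j x i => rfl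
  let M : Submodule R (Fin 2 → K) := (Subalgebra.toSubmodule O).map (φ 0) ⊔
    (Subalgebra.toSubmodule O).map (φ 1)
  have hφM : ∀ j, ∀ x ∈ O, φ j x ∈ M := by
    intro j x hx
    fin_cases j
    · exact Submodule.mem_sup_left ⟨x, hx, rfl⟩
    · exact Submodule.mem_sup_right ⟨x, hx, rfl⟩
  have hMl : Submodule.IsLattice K M := by
    refine ⟨(hO.1.1.map _).sup (hO.1.1.map _), ?_⟩
    rw [eq_top_iff]
    intro v _
    have hv : v = v 0 • φ 0 1 + v 1 • φ 1 1 := by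
      ext i
      fin_cases i <;> simp [hφ]
    rw [hv]
    exact Submodule.add_mem _
      (Submodule.smul_mem _ _ (Submodule.subset_span (hφM 0 1 O.one_mem)))
      (Submodule.smul_mem _ _ (Submodule.subset_span (hφM 1 1 O.one_mem)))
  have hstab : ∀ x ∈ O, ∀ v ∈ M, (e₀ x).mulVec v ∈ M := by
    intro x hx v hv
    have hmul : ∀ j y, (e₀ x).mulVec (φ j y) = φ j (x * y) := by
      intro j y
      ext i
      rw [hφ, map_mul, Matrix.mul_apply]
      rfl
    obtain ⟨v₁, ⟨y, hy, rfl⟩, v₂, ⟨z, hz, rfl⟩, rfl⟩ := Submodule.mem_sup.1 hv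
    rw [Matrix.mulVec_add, hmul, hmul]
    exact Submodule.add_mem _ (hφM _ _ (O.mul_mem hx hy)) (hφM _ _ (O.mul_mem hx hz))
  have : Module.Free R M := Submodule.IsLattice.free (K := K) M
  let b : Module.Basis (Fin 2) R M := Module.finBasisOfFinrankEq R M (by
    rw [Submodule.IsLattice.finrank_of_pi K M]; simp)
  let b' : Module.Basis (Fin 2) K (Fin 2 → K) := b.extendOfIsLattice K
  have hb' : ∀ i, b' i = (b i : Fin 2 → K) := fun i => b.extendOfIsLattice_apply K i
  let e : B ≃ₐ[K] Matrix (Fin 2) (Fin 2) K :=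
    e₀.trans (Matrix.toLinAlgEquiv'.trans (LinearMap.toMatrixAlgEquiv b'))
  have he : ∀ x i j, e x i j = b'.repr ((e₀ x).mulVec (b' j)) i := by
    intro x i j
    simp [e, LinearMap.toMatrixAlgEquiv_apply]
  have hle : O ≤ matrixOrder R e := by
    intro x hx i j
    rw [he, hb']
    have hmem := hstab x hx _ (b j).2
    have hrep := congrArg Subtype.val (b.sum_repr ⟨_, hmem⟩)
    simp only [Submodule.coe_sum, Submodule.coe_smul] at hrep
    rw [← hrep, map_sum, Finsupp.finsetSum_apply]
    refine Subring.sum_mem _ fun k _ => ?_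
    generalize b.repr ⟨(e₀ x).mulVec (b j), hmem⟩ k = r
    rw [← hb', ← algebraMap_smul K, map_smul, b'.repr_self, Finsupp.smul_apply, smul_eq_mul]
    refine Subring.mul_mem _ ⟨_, rfl⟩ ?_
    rw [Finsupp.single_apply]
    split_ifs
    · exact Subring.one_mem _
    · exact Subring.zero_mem _
  have hord : IsOrder K (matrixOrder R e) := by
    refine isOrder_of_trd_mem hq _ ?_ fun x hx => ?_
    · rw [eq_top_iff, ← hO.1.2]
      exact Submodule.span_mono hle
    · rw [← trd_algEquiv e, trd_matrix hq.two_ne_zero]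
      exact Subring.add_mem _ (hx _ _) (hx _ _)
  exact ⟨e, fun x => ⟨fun hx => hle hx, fun hx => hO.2 hord hle hx⟩⟩

variable (hq : Quat K B) {O : Subalgebra R B} {e : B ≃ₐ[K] Matrix (Fin 2) (Fin 2) K}
  (he : ∀ x, x ∈ O ↔ ∀ i j, e x i j ∈ integers R K)

omit [IsDomain R] [IsDiscreteValuationRing R] [IsFractionRing R K] [IsScalarTower R K B] in
include he in
theorem symm_mem_of_integral {y : Matrix (Fin 2) (Fin 2) K} (hy : ∀ i j, y i j ∈ integers R K) :
    e.symm y ∈ O := by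
  rw [he, e.apply_symm_apply]
  exact hy

omit [IsDomain R] [IsDiscreteValuationRing R] [IsFractionRing R K] [IsScalarTower R K B] in
include he in
theorem symm_single_mem (i j : Fin 2) : e.symm (Matrix.single i j 1) ∈ O := by
  refine symm_mem_of_integral he fun k l => ?_
  rw [Matrix.single_apply]
  split_ifs
  · exact Subring.one_mem _
  · exact Subring.zero_mem _

include hq

theorem nrd_symm_diagonal (e : B ≃ₐ[K] Matrix (Fin 2) (Fin 2) K) (c : K) :
    nrd K (e.symm (Matrix.diagonal ![c, 1])) = c := by
  have h2 := hq.two_ne_zero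
  rw [← nrd_algEquiv e, e.apply_symm_apply, nrd, trd_matrix h2, trd_matrix h2]
  simp
  field_simp
  ring

include he

-- Traces against the matrix units are the entries, so the matrix order contains its own trace dual.
omit [IsDomain R] [IsDiscreteValuationRing R] [IsFractionRing R K] [IsScalarTower R K B] in
theorem split_mem_of_trd {x : B} (h : ∀ b ∈ O, trd K (x * b) ∈ integers R K) : x ∈ O := by
  rw [he]
  intro i j
  have := h _ (symm_single_mem he j i)
  rw [← trd_algEquiv e, map_mul, e.apply_symm_apply, trd_matrix hq.two_ne_zero] at this
  fin_cases i <;> fin_cases j <;> simpa [Matrix.mul_apply] using this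

omit [IsScalarTower R K B] hq in
theorem split_eq_zero {x : B} {ϖ : R} (hϖ : Irreducible ϖ)
    (h : ∀ k : ℕ, (algebraMap R K ϖ)⁻¹ ^ k • x ∈ O) : x = 0 := by
  apply e.injective
  ext i j
  rw [map_zero, Matrix.zero_apply]
  by_contra h0
  have h1 : (algebraMap R K ϖ)⁻¹ ∈ integers R K := mem_integers_of_pow h0 fun k => by
    have := (he _).1 (h k) i j
    rwa [map_smul, Matrix.smul_apply, smul_eq_mul, mul_comm] at this
  obtain ⟨r, hr⟩ := h1
  have hϖ0 : algebraMap R K ϖ ≠ 0 := by rw [Ne, algebraMap_eq_zero_iff']; exact hϖ.ne_zero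
  refine hϖ.not_isUnit (IsUnit.of_mul_eq_one r (IsFractionRing.injective R K ?_))
  rw [map_mul, hr, map_one, mul_inv_cancel₀ hϖ0]

omit [IsScalarTower R K B] in
/-- An element normalizing a split maximal order is a unit of the order up to a scalar. -/
theorem split_normalizer (γ : Bˣ) (hγ : ∀ x ∈ O, ((γ⁻¹ : Bˣ) : B) * x * γ ∈ O) :
    ∃ c : K, c ≠ 0 ∧ c⁻¹ • (γ : B) ∈ O ∧ c • ((γ⁻¹ : Bˣ) : B) ∈ O := by
  have := hq.nontrivial
  have hne : ∃ p : Fin 2 × Fin 2, e γ p.1 p.2 ≠ 0 := by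
    by_contra! h
    refine γ.ne_zero (e.injective ?_)
    ext i j
    rw [h (i, j), map_zero, Matrix.zero_apply]
  obtain ⟨⟨i, j⟩, hij, hmax⟩ := exists_maximal_entry (R := R) (fun p : Fin 2 × Fin 2 => e γ p.1 p.2) hne
  refine ⟨e γ i j, hij, ?_, ?_⟩
  · rw [he]
    intro k l
    rw [map_smul, Matrix.smul_apply, smul_eq_mul]
    exact hmax (k, l)
  · set c := e γ i j with hc
    -- `E_ki γ E_jk = c E_kk` for the maximal entry `c = γ_ij`. Multiplying the sum by `γ⁻¹`
    -- exhibits `c γ⁻¹` through the elements `γ⁻¹ E_ki γ` of `O`.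
    have hone : c • (1 : B) = ∑ k, e.symm (Matrix.single k i 1) * γ * e.symm (Matrix.single j k 1) := by
      apply e.injective
      rw [map_sum, map_smul, map_one]
      simp only [map_mul, e.apply_symm_apply]
      ext k l
      simp only [Fin.sum_univ_two, Matrix.single_mul_mul_single]
      fin_cases k <;> fin_cases l <;> simp [hc]
    have : c • ((γ⁻¹ : Bˣ) : B) = ∑ k, (((γ⁻¹ : Bˣ) : B) * e.symm (Matrix.single k i 1) * γ) *
        e.symm (Matrix.single j k 1) := by
      calc c • ((γ⁻¹ : Bˣ) : B) = ((γ⁻¹ : Bˣ) : B) * (c • (1 : B)) := by rw [mul_smul_comm, mul_one]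
        _ = _ := by rw [hone, Finset.mul_sum]; simp only [mul_assoc]
    rw [this]
    exact O.sum_mem fun k _ => O.mul_mem (hγ _ (symm_single_mem he k i)) (symm_single_mem he j k)

end Split

/-! ### Hermitian forms and block families -/

/-- A nondegenerate form on `V` with values in the quaternion algebra `B` which is hermitian with
respect to the canonical involution. -/
structure Herm (K : Type*) {B V : Type*} [Field K] [Ring B] [Algebra K B] [AddCommGroup V]
    [Module B V] (h : V → V → B) : Prop where
  add_left : ∀ x y z, h (x + y) z = h x z + h y z
  smul_left : ∀ (b : B) x y, h (b • x) y = b * h x y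
  symm : ∀ x y, h y x = conj K (h x y)
  nondegenerate : ∀ x, (∀ y, h x y = 0) → x = 0

/-- The Gram matrix of the family `z` is block diagonal with all diagonal blocks equal to `M`. -/
def IsBlock {B V ι : Type*} [Zero B] (h : V → V → B) (M : ι → ι → B) {k : ℕ}
    (z : Fin k → ι → V) : Prop :=
  ∀ i a j b, h (z i a) (z j b) = if i = j then M a b else 0

section Herm

variable {K B V : Type*} [Field K] [Ring B] [Algebra K B] [AddCommGroup V] [Module B V]
  (hq : Quat K B) {h : V → V → B} (hh : Herm K h)

namespace Herm

include hh

theorem zero_left (y : V) : h 0 y = 0 := by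
  have := hh.smul_left 0 0 y
  rwa [zero_smul, zero_mul] at this

theorem neg_left (x y : V) : h (-x) y = -h x y := by
  have := hh.smul_left (-1) x y
  rwa [neg_one_smul, neg_one_mul] at this

theorem sub_left (x y z : V) : h (x - y) z = h x z - h y z := by
  rw [sub_eq_add_neg, hh.add_left, hh.neg_left, sub_eq_add_neg]

theorem sum_left {ι : Type*} (s : Finset ι) (f : ι → V) (y : V) :
    h (∑ i ∈ s, f i) y = ∑ i ∈ s, h (f i) y :=
  map_sum (AddMonoidHom.mk' (fun x => h x y) fun _ _ => hh.add_left _ _ _) f s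

theorem add_right (x y z : V) : h x (y + z) = h x y + h x z := by
  rw [hh.symm, hh.add_left, conj_add, ← hh.symm, ← hh.symm]

theorem zero_right (x : V) : h x 0 = 0 := by
  rw [hh.symm, hh.zero_left, conj_zero]

theorem sum_right {ι : Type*} (s : Finset ι) (f : ι → V) (y : V) :
    h y (∑ i ∈ s, f i) = ∑ i ∈ s, h y (f i) :=
  map_sum (AddMonoidHom.mk' (fun x => h y x) fun _ _ => hh.add_right _ _ _) f s

theorem sub_right (x y z : V) : h x (y - z) = h x y - h x z := by
  rw [hh.symm, hh.sub_left, conj_sub, ← hh.symm, ← hh.symm]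

theorem eq_zero_symm {x y : V} (hxy : h x y = 0) : h y x = 0 := by
  rw [hh.symm, hxy, conj_zero]

include hq

theorem smul_right (b : B) (x y : V) : h x (b • y) = h x y * conj K b := by
  rw [hh.symm, hh.smul_left, hq.conj_mul, ← hh.symm]

theorem smul_form {c : K} (hc : c ≠ 0) : Herm K (fun x y => c • h x y) where
  add_left x y z := by rw [hh.add_left, smul_add]
  smul_left b x y := by rw [hh.smul_left, mul_smul_comm]
  symm x y := by
    rw [hh.symm, Algebra.smul_def, Algebra.smul_def, hq.conj_mul, hq.conj_algebraMap,
      Algebra.commutes]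
  nondegenerate x hx := hh.nondegenerate x fun y => (smul_eq_zero.1 (hx y)).resolve_left hc

/-- The value `h x x` is a scalar. -/
theorem exists_self (x : V) : ∃ c : K, h x x = algebraMap K B c := by
  refine ⟨2⁻¹ * trd K (h x x), ?_⟩
  have h1 := add_conj (K := K) (h x x)
  rw [← hh.symm, ← two_smul K] at h1
  rw [map_mul, ← h1, ← Algebra.smul_def, smul_smul, inv_mul_cancel₀ hq.two_ne_zero, one_smul]

end Herm

variable {ι : Type*} [Fintype ι] [DecidableEq ι] {M N : ι → ι → B}
  (hMN : ∀ a c, ∑ b, M a b * N b c = if a = c then 1 else 0)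
  (hNM : ∀ a c, ∑ b, N a b * M b c = if a = c then 1 else 0)

include hh

omit [DecidableEq ι] in
theorem IsBlock.sum_apply {k : ℕ} {z : Fin k → ι → V} (hz : IsBlock h M z) (c : Fin k → ι → B)
    (j : Fin k) (b : ι) :
    h (∑ i, ∑ a, c i a • z i a) (z j b) = ∑ a, c j a * M a b := by
  rw [hh.sum_left, Finset.sum_eq_single j]
  · rw [hh.sum_left]
    refine Finset.sum_congr rfl fun a _ => ?_
    rw [hh.smul_left, hz, if_pos rfl]
  · intro i _ hij
    rw [hh.sum_left]
    refine Finset.sum_eq_zero fun a _ => ?_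
    rw [hh.smul_left, hz, if_neg hij, mul_zero]
  · intro hj; exact absurd (Finset.mem_univ j) hj

include hMN in
theorem IsBlock.coeff {k : ℕ} {z : Fin k → ι → V} (hz : IsBlock h M z) (c : Fin k → ι → B)
    {x : V} (hx : x = ∑ i, ∑ a, c i a • z i a) (j : Fin k) (b : ι) :
    ∑ a, h x (z j a) * N a b = c j b := by
  rw [hx]
  simp only [hz.sum_apply hh, Finset.sum_mul, mul_assoc]
  rw [Finset.sum_comm]
  simp only [← Finset.mul_sum, hMN, mul_ite, mul_one, mul_zero, Finset.sum_ite_eq',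
    Finset.mem_univ, if_true]

include hMN in
theorem IsBlock.linearIndependent {k : ℕ} {z : Fin k → ι → V} (hz : IsBlock h M z) :
    LinearIndependent B (fun p : Fin k × ι => z p.1 p.2) := by
  rw [Fintype.linearIndependent_iff]
  rintro g hg ⟨j, b⟩
  rw [← hz.coeff hh hMN (fun i a => g (i, a)) (x := 0) (by rw [← hg, Fintype.sum_prod_type]) j b]
  simp [hh.zero_left]

-- With `N` inverse to `M`, the subtracted sum is the orthogonal projection of `x` onto the span of
-- `z`.
include hNM in
theorem IsBlock.sub_apply {k : ℕ} {z : Fin k → ι → V} (hz : IsBlock h M z) (x : V)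
    (j : Fin k) (c : ι) :
    h (x - ∑ i, ∑ b, (∑ a, h x (z i a) * N a b) • z i b) (z j c) = 0 := by
  rw [hh.sub_left, hz.sum_apply hh (fun i b => ∑ a, h x (z i a) * N a b), sub_eq_zero]
  simp only [Finset.sum_mul, mul_assoc]
  rw [Finset.sum_comm]
  simp only [← Finset.mul_sum, hNM, mul_ite, mul_one, mul_zero, Finset.sum_ite_eq',
    Finset.mem_univ, if_true]

omit hh in
/-- The basis given by a spanning block family. -/
theorem exists_blockBasis (hh : Herm K h)
    (hMN : ∀ a c, ∑ b, M a b * N b c = if a = c then 1 else 0) {k : ℕ} {z : Fin k → ι → V}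
    (hz : IsBlock h M z) (hspan : ∀ x : V, ∃ c : Fin k → ι → B, x = ∑ i, ∑ a, c i a • z i a) :
    ∃ b : Module.Basis (Fin k × ι) B V, ∀ p, b p = z p.1 p.2 := by
  refine ⟨Module.Basis.mk (hz.linearIndependent hh hMN) ?_, fun p => Module.Basis.mk_apply _ _ _⟩
  intro x _
  obtain ⟨c, rfl⟩ := hspan x
  exact Submodule.sum_mem _ fun i _ => Submodule.sum_mem _ fun a _ =>
    Submodule.smul_mem _ _ (Submodule.subset_span ⟨(i, a), rfl⟩)

variable [Nonempty ι] [Module.Finite B V]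

include hq hMN hNM in
/-- If every vector of the orthogonal complement in `L` of a block family extends it to a larger
block family, then `L` is spanned by a block family. -/
theorem exists_block_span (L : AddSubgroup V)
    (hL : ∀ x ∈ L, ∀ y ∈ L, ∀ w ∈ L, ∀ a b, (h x y * N a b) • w ∈ L)
    (hstep : ∀ (k : ℕ) (z : Fin k → ι → V), IsBlock h M z → (∀ i a, z i a ∈ L) →
      ∀ x ∈ L, x ≠ 0 → (∀ i a, h x (z i a) = 0) →
      ∃ w : ι → V, (∀ a, w a ∈ L) ∧ (∀ a b, h (w a) (w b) = M a b) ∧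
        ∀ a i b, h (w a) (z i b) = 0) :
    ∃ (k : ℕ) (z : Fin k → ι → V), IsBlock h M z ∧ (∀ i a, z i a ∈ L) ∧
      ∀ x ∈ L, x = ∑ i, ∑ b, (∑ a, h x (z i a) * N a b) • z i b := by
  -- If no block family spans, subtracting the projection of a missed vector always leaves something
  -- to extend by. This gives block families of every length, but they are linearly independent in a
  -- module of finite rank.
  by_contra! hcon
  have key : ∀ k : ℕ, ∃ z : Fin k → ι → V, IsBlock h M z ∧ ∀ i a, z i a ∈ L := by
    intro k
    induction k with
    | zero => exact ⟨Fin.elim0, fun i => i.elim0, fun i => i.elim0⟩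
    | succ k ih =>
      obtain ⟨z, hz, hzL⟩ := ih
      obtain ⟨x, hxL, hx⟩ := hcon k z hz hzL
      obtain ⟨w, hwL, hw, hwz⟩ := hstep k z hz hzL
        (x - ∑ i, ∑ b, (∑ a, h x (z i a) * N a b) • z i b)
        (L.sub_mem hxL (L.sum_mem fun i _ => L.sum_mem fun b _ => by
          rw [Finset.sum_smul]
          exact L.sum_mem fun a _ => hL x hxL _ (hzL i a) _ (hzL i b) a b))
        (sub_ne_zero.2 hx) (hz.sub_apply hh hNM x)
      refine ⟨Fin.cons w z, ?_, ?_⟩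
      · intro i a j b
        refine Fin.cases ?_ (fun i => ?_) i <;> refine Fin.cases ?_ (fun j => ?_) j
        · simpa using hw a b
        · simpa [(Fin.succ_ne_zero j).symm] using hwz a j b
        · simpa [Fin.succ_ne_zero i] using hh.eq_zero_symm (hwz b i a)
        · simpa using hz i a j b
      · intro i
        refine Fin.cases ?_ (fun i => ?_) i
        · simpa using hwL
        · simpa using hzL i
  have := hq.nontrivial
  have := hq.finite
  have : IsNoetherianRing B := IsNoetherianRing.of_finite K B
  obtain ⟨z, hz, -⟩ := key (Module.finrank B V + 1)
  have h1 := (hz.linearIndependent hh hMN).fintype_card_le_finrank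
  rw [Fintype.card_prod, Fintype.card_fin] at h1
  have h2 : 0 < Fintype.card ι := Fintype.card_pos
  nlinarith

omit [Nonempty ι] [Module.Finite B V] in
include hq hMN in
theorem card_eq_finrank {k : ℕ} {z : Fin k → ι → V} (hz : IsBlock h M z)
    (hspan : ∀ x : V, ∃ c : Fin k → ι → B, x = ∑ i, ∑ a, c i a • z i a) :
    Module.finrank B V = k * Fintype.card ι := by
  have := hq.nontrivial
  have := hq.finite
  have : IsNoetherianRing B := IsNoetherianRing.of_finite K B
  obtain ⟨b, -⟩ := exists_blockBasis hh hMN hz hspan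
  rw [Module.finrank_eq_card_basis b, Fintype.card_prod, Fintype.card_fin]

end Herm

/-! ### Lattices spanned by block families -/

section Lattice

variable {R K B V : Type*} [CommRing R] [Field K] [Ring B] [Algebra K B] [Algebra R B]
  [AddCommGroup V] [Module B V] (hq : Quat K B) {h : V → V → B} (hh : Herm K h)
  {O : Subalgebra R B} {ι : Type*} [Fintype ι] [DecidableEq ι] {M N : ι → ι → B}
  (hMN : ∀ a c, ∑ b, M a b * N b c = if a = c then 1 else 0)

omit [DecidableEq ι] in
theorem exists_span_of_isLattice {L : Submodule O V} (hL : IsLattice L) {k : ℕ}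
    {z : Fin k → ι → V} {c : V → Fin k → ι → B}
    (hspan : ∀ x ∈ L, x = ∑ i, ∑ a, c x i a • z i a) (x : V) :
    ∃ c : Fin k → ι → B, x = ∑ i, ∑ a, c i a • z i a := by
  have hx : x ∈ Submodule.span B (L : Set V) := by rw [hL.2]; trivial
  induction hx using Submodule.span_induction with
  | mem x hx => exact ⟨c x, hspan x hx⟩
  | zero => exact ⟨0, by simp⟩
  | add x y _ _ hx hy =>
    obtain ⟨c, rfl⟩ := hx
    obtain ⟨d, rfl⟩ := hy
    exact ⟨c + d, by simp [add_smul, Finset.sum_add_distrib]⟩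
  | smul b x _ hx =>
    obtain ⟨c, rfl⟩ := hx
    exact ⟨fun i a => b * c i a, by simp [Finset.smul_sum, mul_smul]⟩

include hq hh hMN

/-- Lattices spanned by block families with the same Gram matrix are isometric. -/
theorem exists_isometry {L₁ L₂ : Submodule O V} {k : ℕ} {z₁ z₂ : Fin k → ι → V}
    (hz₁ : IsBlock h M z₁) (hz₂ : IsBlock h M z₂)
    (hsp₁ : ∀ x : V, ∃ c : Fin k → ι → B, x = ∑ i, ∑ a, c i a • z₁ i a)
    (hsp₂ : ∀ x : V, ∃ c : Fin k → ι → B, x = ∑ i, ∑ a, c i a • z₂ i a)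
    (hL₁ : ∀ x, x ∈ L₁ ↔ ∀ i b, ∑ a, h x (z₁ i a) * N a b ∈ O)
    (hL₂ : ∀ x, x ∈ L₂ ↔ ∀ i b, ∑ a, h x (z₂ i a) * N a b ∈ O) :
    ∃ F : V ≃ₗ[B] V, (∀ x y, h (F x) (F y) = h x y) ∧ ∀ x, F x ∈ L₂ ↔ x ∈ L₁ := by
  obtain ⟨b₁, hb₁⟩ := exists_blockBasis hh hMN hz₁ hsp₁
  obtain ⟨b₂, hb₂⟩ := exists_blockBasis hh hMN hz₂ hsp₂
  have hF : ∀ c : Fin k → ι → B, (b₁.equiv b₂ (Equiv.refl _)) (∑ i, ∑ a, c i a • z₁ i a) =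
      ∑ i, ∑ a, c i a • z₂ i a := by
    intro c
    simp only [map_sum, map_smul]
    refine Finset.sum_congr rfl fun i _ => Finset.sum_congr rfl fun a _ => ?_
    rw [← hb₁ (i, a), ← hb₂ (i, a), Module.Basis.equiv_apply, Equiv.refl_apply]
  refine ⟨b₁.equiv b₂ (Equiv.refl _), fun x y => ?_, fun x => ?_⟩
  · obtain ⟨c, rfl⟩ := hsp₁ x
    obtain ⟨d, rfl⟩ := hsp₁ y
    rw [hF, hF, hh.sum_right, hh.sum_right]
    refine Finset.sum_congr rfl fun j _ => ?_
    rw [hh.sum_right, hh.sum_right]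
    refine Finset.sum_congr rfl fun b _ => ?_
    rw [hh.smul_right hq, hh.smul_right hq, hz₁.sum_apply hh, hz₂.sum_apply hh]
  · obtain ⟨c, rfl⟩ := hsp₁ x
    rw [hL₁, hL₂]
    simp only [hz₁.coeff hh hMN c rfl, hz₂.coeff hh hMN c (hF c)]

/-- The lattice spanned by a block family is characterized by duality. -/
theorem exists_dual_lattice {k : ℕ} {z : Fin k → ι → V} (hz : IsBlock h M z)
    (hspan : ∀ x : V, ∃ c : Fin k → ι → B, x = ∑ i, ∑ a, c i a • z i a)
    (I : AddSubgroup B) (hM : ∀ a b, M a b ∈ I) (hIl : ∀ o ∈ O, ∀ w ∈ I, o * w ∈ I)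
    (hIr : ∀ o ∈ O, ∀ w ∈ I, w * o ∈ I) (hN : ∀ w ∈ I, ∀ a b, w * N a b ∈ O)
    (hconj : ∀ o ∈ O, conj K o ∈ O) :
    ∃ L : Submodule O V, IsLattice L ∧ ∀ x, x ∈ L ↔ ∀ y ∈ L, h x y ∈ I := by
  set L : Submodule O V := Submodule.span O (Set.range fun p : Fin k × ι => z p.1 p.2) with hLdef
  have hzL : ∀ i a, z i a ∈ L := fun i a => Submodule.subset_span ⟨(i, a), rfl⟩
  refine ⟨L, ⟨Submodule.fg_span (Set.finite_range _), ?_⟩, fun x => ⟨fun hx y hy => ?_, fun hx => ?_⟩⟩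
  · rw [eq_top_iff]
    intro x _
    obtain ⟨c, rfl⟩ := hspan x
    exact Submodule.sum_mem _ fun i _ => Submodule.sum_mem _ fun a _ =>
      Submodule.smul_mem _ _ (Submodule.subset_span (hzL i a))
  · have h1 : ∀ y ∈ L, ∀ j b, h y (z j b) ∈ I := by
      intro y hy j b
      induction hy using Submodule.span_induction with
      | mem x hx =>
        obtain ⟨⟨i, a⟩, rfl⟩ := hx
        simp only [hz i a j b]
        split_ifs
        · exact hM a b
        · exact I.zero_mem
      | zero => rw [hh.zero_left]; exact I.zero_mem
      | add x y _ _ hx hy => rw [hh.add_left]; exact I.add_mem hx hy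
      | smul o x _ hx =>
        rw [show o • x = (o : B) • x from rfl, hh.smul_left]
        exact hIl _ o.2 _ hx
    induction hy using Submodule.span_induction with
    | mem y hy =>
      obtain ⟨⟨i, a⟩, rfl⟩ := hy
      exact h1 x hx i a
    | zero => rw [hh.zero_right]; exact I.zero_mem
    | add y z _ _ hy hz => rw [hh.add_right]; exact I.add_mem hy hz
    | smul o y _ hy =>
      rw [show o • y = (o : B) • y from rfl, hh.smul_right hq]
      exact hIr _ (hconj _ o.2) _ hy
  · obtain ⟨c, hc⟩ := hspan x
    have hcO : ∀ i a, c i a ∈ O := by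
      intro i a
      rw [← hz.coeff hh hMN c hc i a]
      exact O.sum_mem fun b _ => hN _ (hx _ (hzL i b)) b a
    rw [hc]
    exact Submodule.sum_mem _ fun i _ => Submodule.sum_mem _ fun a _ =>
      Submodule.smul_mem L (⟨c i a, hcO i a⟩ : O) (hzL i a)

end Lattice

/-! ### Orthogonal complements and orthonormal bases -/

section Orthogonal

variable {R K B V : Type*} [CommRing R] [Field K] [Ring B] [Algebra K B] [Algebra R B]
  [AddCommGroup V] [Module B V] (hq : Quat K B) {h : V → V → B} (hh : Herm K h)
  {O : Subalgebra R B} {ι : Type*} [Fintype ι] [DecidableEq ι] {M N : ι → ι → B}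
  (hNM : ∀ a c, ∑ b, N a b * M b c = if a = c then 1 else 0)

include hq in
theorem Herm.eq_zero_of_isLattice (hh : Herm K h) {L : Submodule O V} (hL : IsLattice L) {x : V}
    (hx : ∀ y ∈ L, h x y = 0) : x = 0 := by
  refine hh.nondegenerate x fun y => ?_
  have hy : y ∈ Submodule.span B (L : Set V) := by rw [hL.2]; trivial
  induction hy using Submodule.span_induction with
  | mem y hy => exact hx y hy
  | zero => exact hh.zero_right x
  | add y z _ _ hy hz => rw [hh.add_right, hy, hz, add_zero]
  | smul b y _ hy => rw [hh.smul_right hq, hy, zero_mul]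

/-- The submodule of vectors in `L` orthogonal to the family `z`. -/
def orthogonalIn (hh : Herm K h) (L : Submodule O V) {k : ℕ} (z : Fin k → ι → V) :
    Submodule O V where
  carrier := {x | x ∈ L ∧ ∀ i a, h x (z i a) = 0}
  add_mem' {x y} hx hy := ⟨L.add_mem hx.1 hy.1, fun i a => by
    rw [hh.add_left, hx.2, hy.2, add_zero]⟩
  zero_mem' := ⟨L.zero_mem, fun i a => hh.zero_left _⟩
  smul_mem' o x hx := ⟨L.smul_mem o hx.1, fun i a => by
    rw [show o • x = (o : B) • x from rfl, hh.smul_left, hx.2, mul_zero]⟩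

-- The projection of `y` to the complement has the same pairings with the complement. So conditions
-- on `h(u, L)`, for `u` in the complement, can be checked inside the complement.
include hq hNM in
theorem exists_orthogonal_representative {L : Submodule O V} {k : ℕ} {z : Fin k → ι → V}
    (hz : IsBlock h M z) (hzL : ∀ i a, z i a ∈ L)
    (hL : ∀ x ∈ L, ∀ y ∈ L, ∀ w ∈ L, ∀ a b, (h x y * N a b) • w ∈ L) {y : V} (hy : y ∈ L) :
    ∃ y' ∈ orthogonalIn hh L z, ∀ u ∈ orthogonalIn hh L z, h u y = h u y' := by
  refine ⟨y - ∑ i, ∑ b, (∑ a, h y (z i a) * N a b) • z i b,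
    ⟨L.sub_mem hy (L.sum_mem fun i _ => L.sum_mem fun b _ => ?_), hz.sub_apply hh hNM y⟩,
    fun u hu => ?_⟩
  · rw [Finset.sum_smul]
    exact L.sum_mem fun a _ => hL y hy _ (hzL i a) _ (hzL i b) a b
  · rw [hh.sub_right, hh.sum_right]
    symm
    rw [sub_eq_self]
    refine Finset.sum_eq_zero fun i _ => ?_
    rw [hh.sum_right]
    refine Finset.sum_eq_zero fun b _ => ?_
    rw [hh.smul_right hq, hu.2, zero_mul]

-- Since `h(x + y, x + y) = r + s + 1`, one of the three values `r`, `s`, `r + s + 1` is invertible,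
-- both in a field and in a local ring. Scaling by an element of inverse norm gives length 1, even
-- in residue characteristic 2.
include hq in
theorem exists_norm_one (hh : Herm K h) {x y : V} (hxy : trd K (h x y) = 1) (S : Subring K)
    (A : Set B) (hnorm : ∀ r ∈ S, ∀ s ∈ S, ∃ o ∈ A, nrd K o * r = 1 ∨ nrd K o * s = 1 ∨
      nrd K o * (r + s + 1) = 1)
    (hx : ∀ c, h x x = algebraMap K B c → c ∈ S) (hy : ∀ c, h y y = algebraMap K B c → c ∈ S) :
    ∃ o ∈ A, ∃ w, (w = x ∨ w = y ∨ w = x + y) ∧ h (o • w) (o • w) = 1 := by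
  obtain ⟨r, hr⟩ := hh.exists_self hq x
  obtain ⟨s, hs⟩ := hh.exists_self hq y
  have hrs : h (x + y) (x + y) = algebraMap K B (r + s + 1) := by
    rw [hh.add_left, hh.add_right, hh.add_right, hr, hs, hh.symm x y, map_add, map_add, ← hxy,
      ← add_conj]
    abel
  have key : ∀ o : B, ∀ w : V, ∀ c : K, h w w = algebraMap K B c → nrd K o * c = 1 →
      h (o • w) (o • w) = 1 := by
    intro o w c hw hc
    rw [hh.smul_left, hh.smul_right hq, hw, ← mul_assoc, ← Algebra.commutes, mul_assoc,
      hq.mul_conj, ← map_mul, mul_comm, hc, map_one]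
  obtain ⟨o, ho, h1⟩ := hnorm r (hx r hr) s (hy s hs)
  rcases h1 with h1 | h1 | h1
  · exact ⟨o, ho, x, Or.inl rfl, key o x r hr h1⟩
  · exact ⟨o, ho, y, Or.inr (Or.inl rfl), key o y s hs h1⟩
  · exact ⟨o, ho, x + y, Or.inr (Or.inr rfl), key o _ _ hrs h1⟩

theorem sum_one_mul_one (a c : Fin 1) :
    ∑ _b : Fin 1, (1 : B) * 1 = if a = c then 1 else 0 := by
  rw [if_pos (Subsingleton.elim a c)]; simp

include hq in
/-- A hermitian space over a quaternion algebra all of whose norms are surjective has an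
orthonormal basis. -/
theorem exists_orthonormal_basis (hh : Herm K h) [Module.Finite B V]
    (hsurj : ∀ c : K, ∃ y : B, nrd K y = c) :
    ∃ (k : ℕ) (z : Fin k → Fin 1 → V), IsBlock h (fun _ _ => 1) z ∧
      ∀ x, x = ∑ i, ∑ b, (∑ a, h x (z i a) * 1) • z i b := by
  obtain ⟨k, z, hz, -, hsp⟩ := exists_block_span hq hh (M := fun _ _ : Fin 1 => (1 : B))
    (N := fun _ _ : Fin 1 => (1 : B)) sum_one_mul_one sum_one_mul_one ⊤
    (fun _ _ _ _ _ _ _ _ => trivial) (by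
    intro k z hz _ x _ hx0 hxz
    -- The whole space is treated as a lattice over the order `B` itself, so that the lattice lemmas
    -- apply.
    let L : Submodule (⊤ : Subalgebra K B) V := ⊤
    have hxL : x ∈ orthogonalIn hh L z := ⟨trivial, hxz⟩
    obtain ⟨y, hy⟩ : ∃ y, h x y ≠ 0 := by
      by_contra! hc
      exact hx0 (hh.nondegenerate x hc)
    obtain ⟨y', hy', hyy'⟩ := exists_orthogonal_representative hq hh (L := L)
      (N := fun _ _ : Fin 1 => (1 : B)) sum_one_mul_one hz (fun _ _ => trivial)
      (fun _ _ _ _ _ _ _ _ => trivial) (y := y) trivial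
    rw [hyy' x hxL] at hy
    obtain ⟨b, hb⟩ : ∃ b, trd K (h x y' * b) ≠ 0 := by
      by_contra! hc
      exact hy (hq.trd_nondegenerate hc)
    have hv : trd K (h x (conj K ((trd K (h x y' * b))⁻¹ • b) • y')) = 1 := by
      rw [hh.smul_right hq, hq.conj_conj, mul_smul_comm, map_smul, smul_eq_mul, inv_mul_cancel₀ hb]
    have hvL : conj K ((trd K (h x y' * b))⁻¹ • b) • y' ∈ orthogonalIn hh L z :=
      (orthogonalIn hh L z).smul_mem ⟨_, trivial⟩ hy'
    obtain ⟨o, -, w, hw, how⟩ := exists_norm_one hq hh hv ⊤ Set.univ (by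
      intro r _ s _
      by_cases hr : r = 0
      · by_cases hs : s = 0
        · exact ⟨1, trivial, Or.inr (Or.inr (by rw [hr, hs, hq.nrd_one]; norm_num))⟩
        · obtain ⟨o, ho⟩ := hsurj s⁻¹
          exact ⟨o, trivial, Or.inr (Or.inl (by rw [ho, inv_mul_cancel₀ hs]))⟩
      · obtain ⟨o, ho⟩ := hsurj r⁻¹
        exact ⟨o, trivial, Or.inl (by rw [ho, inv_mul_cancel₀ hr])⟩)
      (fun _ _ => trivial) (fun _ _ => trivial)
    have hwL : w ∈ orthogonalIn hh L z := by
      rcases hw with rfl | rfl | rfl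
      exacts [hxL, hvL, Submodule.add_mem _ hxL hvL]
    have howL : o • w ∈ orthogonalIn hh L z :=
      (orthogonalIn hh L z).smul_mem ⟨o, trivial⟩ hwL
    exact ⟨fun _ => o • w, fun _ => trivial, fun _ _ => how, fun _ i a => howL.2 i a⟩)
  exact ⟨k, z, hz, fun x => hsp x trivial⟩

end Orthogonal

/-! ### Unimodular lattices -/

section Unimodular

variable {R K B V : Type*} [CommRing R] [IsDomain R] [IsDiscreteValuationRing R] [Field K]
  [Algebra R K] [IsFractionRing R K] [Ring B] [Algebra K B] [Algebra R B] [IsScalarTower R K B]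
  [AddCommGroup V] [Module B V] [Module.Finite B V] (hq : Quat K B) {h : V → V → B}
  {O : Subalgebra R B}

include hq in
/-- Unimodular hermitian lattices have orthonormal bases. -/
theorem exists_orthonormal_span (hh : Herm K h) (hO : IsOrder K O) {ϖ : R} (hϖ : Irreducible ϖ)
    {τ : B} (hτ : ∀ x : B, (∀ b ∈ O, trd K (x * b) ∈ integers R K) → τ * x ∈ O)
    (hsep : ∀ x : B, (∀ k : ℕ, ((algebraMap R K ϖ)⁻¹ • τ) ^ k * x ∈ O) → x = 0)
    (hunit : ∀ u : Rˣ, ∃ y ∈ O, nrd K y = algebraMap R K u)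
    {L : Submodule O V} (hL : IsLattice L) (hdual : ∀ x, x ∈ L ↔ ∀ y ∈ L, h x y ∈ O) :
    ∃ (k : ℕ) (z : Fin k → Fin 1 → V), IsBlock h (fun _ _ => 1) z ∧ (∀ i a, z i a ∈ L) ∧
      ∀ x ∈ L, x = ∑ i, ∑ b, (∑ a, h x (z i a) * 1) • z i b := by
  have hϖ0 : algebraMap R K ϖ ≠ 0 := by rw [Ne, algebraMap_eq_zero_iff']; exact hϖ.ne_zero
  have hLs : ∀ x ∈ L, ∀ y ∈ L, ∀ w ∈ L, ∀ _ _ : Fin 1, (h x y * 1) • w ∈ L := by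
    intro x hx y hy w hw _ _
    rw [mul_one]
    exact L.smul_mem ⟨_, (hdual x).1 hx y hy⟩ hw
  refine exists_block_span hq hh (M := fun _ _ : Fin 1 => (1 : B))
    (N := fun _ _ : Fin 1 => (1 : B)) sum_one_mul_one sum_one_mul_one L.toAddSubgroup hLs ?_
  intro k z hz hzL x hxL hx0 hxz
  set L' := orthogonalIn hh L z with hL'
  have hxL' : x ∈ L' := ⟨hxL, hxz⟩
  have hval : ∀ u ∈ L', ∀ v ∈ L', h u v ∈ O := fun u hu v hv => (hdual u).1 hu.1 v hv.1
  -- If no trace of a pairing is a unit, every `ϖ⁻¹ h(u, v)` is in the trace dual of `O`, so `τ`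
  -- carries it into `O` and `ϖ⁻¹ τ` preserves the complement by duality. Iterating on `x`
  -- contradicts `hsep`.
  obtain ⟨u, hu, v, hv, huv⟩ : ∃ u ∈ L', ∃ v ∈ L', trd K (h u v) = 1 := by
    by_contra! hcon
    have hm : ∀ u ∈ L', ∀ v ∈ L', (algebraMap R K ϖ)⁻¹ * trd K (h u v) ∈ integers R K := by
      intro u hu v hv
      obtain ⟨r, hr⟩ := hO.trd_mem hq (hval u hu v hv)
      have hrm : r ∈ maximalIdeal R := by
        rw [mem_maximalIdeal]
        rintro ⟨w, rfl⟩
        refine hcon ((⟨algebraMap R B (w⁻¹ : Rˣ), O.algebraMap_mem _⟩ : O) • u)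
          (L'.smul_mem _ hu) v hv ?_
        rw [show (⟨algebraMap R B (w⁻¹ : Rˣ), O.algebraMap_mem _⟩ : O) • u =
          algebraMap R B (w⁻¹ : Rˣ) • u from rfl, hh.smul_left, trd_algebraMap_mul, ← hr, ← map_mul]
        simp
      rw [hϖ.maximalIdeal_eq, Ideal.mem_span_singleton'] at hrm
      obtain ⟨r', rfl⟩ := hrm
      refine ⟨r', ?_⟩
      rw [← hr, map_mul]
      field_simp
    have hstab : ∀ u ∈ L', ((algebraMap R K ϖ)⁻¹ • τ) • u ∈ L' := by
      intro u hu
      refine ⟨(hdual _).2 fun y hy => ?_, fun i a => by rw [hh.smul_left, hu.2, mul_zero]⟩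
      obtain ⟨y', hy', hyy'⟩ := exists_orthogonal_representative hq hh
        (N := fun _ _ : Fin 1 => (1 : B)) sum_one_mul_one hz hzL hLs hy
      rw [hh.smul_left, hyy' u hu, smul_mul_assoc, ← mul_smul_comm]
      refine hτ _ fun b hb => ?_
      rw [smul_mul_assoc, map_smul, smul_eq_mul]
      have h1 : h u y' * b = h u (conj K b • y') := by rw [hh.smul_right hq, hq.conj_conj]
      rw [h1]
      exact hm u hu _ (L'.smul_mem ⟨_, hO.conj_mem hq hb⟩ hy')
    have hpow : ∀ k : ℕ, (((algebraMap R K ϖ)⁻¹ • τ) ^ k) • x ∈ L' := by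
      intro k
      induction k with
      | zero => simpa using hxL'
      | succ k ih => rw [pow_succ', mul_smul]; exact hstab _ ih
    refine hx0 (hh.eq_zero_of_isLattice hq hL fun y hy => hsep _ fun k => ?_)
    rw [← hh.smul_left]
    exact (hdual _).1 (hpow k).1 y hy
  have hself : ∀ u ∈ L', ∀ c, h u u = algebraMap K B c → c ∈ integers R K := by
    intro u hu c hc
    apply mem_integers_of_mul_self
    rw [← hq.nrd_algebraMap, ← hc]
    exact hO.nrd_mem hq (hval u hu u hu)
  obtain ⟨o, ho, w, hw, how⟩ := exists_norm_one hq hh huv (integers R K) O (by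
    rintro _ ⟨r, rfl⟩ _ ⟨s, rfl⟩
    have key : ∀ w : R, IsUnit w → ∃ o ∈ O, nrd K o * algebraMap R K w = 1 := by
      rintro _ ⟨w, rfl⟩
      obtain ⟨o, ho, ho'⟩ := hunit w⁻¹
      exact ⟨o, ho, by rw [ho', ← map_mul]; simp⟩
    by_cases hr : IsUnit r
    · obtain ⟨o, ho, ho'⟩ := key r hr
      exact ⟨o, ho, Or.inl ho'⟩
    by_cases hs : IsUnit s
    · obtain ⟨o, ho, ho'⟩ := key s hs
      exact ⟨o, ho, Or.inr (Or.inl ho')⟩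
    have : IsUnit (r + s + 1) := by
      by_contra hu
      have h1 := Ideal.sub_mem _ (Ideal.sub_mem _ ((mem_maximalIdeal _).2 hu)
        ((mem_maximalIdeal _).2 hr)) ((mem_maximalIdeal _).2 hs)
      rw [show r + s + 1 - r - s = 1 by ring] at h1
      exact (Ideal.ne_top_iff_one _).1 Ideal.IsPrime.ne_top' h1
    obtain ⟨o, ho, ho'⟩ := key _ this
    refine ⟨o, ho, Or.inr (Or.inr ?_)⟩
    simpa only [map_add, map_one] using ho') (hself u hu) (hself v hv)
  have hwL : w ∈ L' := by
    rcases hw with rfl | rfl | rfl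
    exacts [hu, hv, Submodule.add_mem _ hu hv]
  have howL : o • w ∈ L' := L'.smul_mem ⟨o, ho⟩ hwL
  exact ⟨fun _ => o • w, fun _ => howL.1, fun _ _ => how, fun _ i a => howL.2 i a⟩

end Unimodular

/-! ### Hyperbolic planes and prime-modular lattices -/

/-- The Gram matrix of a hyperbolic plane with `h(x, y) = P`. -/
def hypGram (K : Type*) {B : Type*} [Field K] [Ring B] [Algebra K B] (P : B) :
    Fin 2 → Fin 2 → B := ![![0, P], ![conj K P, 0]]

section Hyperbolic

variable {K B : Type*} [Field K] [Ring B] [Algebra K B] (hq : Quat K B)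

include hq

theorem conj_mul_conj_inv (P : Bˣ) : conj K (P : B) * conj K ((P⁻¹ : Bˣ) : B) = 1 := by
  rw [← hq.conj_mul, P.inv_mul, hq.conj_one]

theorem conj_inv_mul_conj (P : Bˣ) : conj K ((P⁻¹ : Bˣ) : B) * conj K (P : B) = 1 := by
  rw [← hq.conj_mul, P.mul_inv, hq.conj_one]

/-- The inverse of the Gram matrix of a hyperbolic plane. -/
theorem hypGram_mul (P : Bˣ) (a c : Fin 2) :
    ∑ b, hypGram K (P : B) a b * hypGram K (conj K ((P⁻¹ : Bˣ) : B)) b c =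
      if a = c then 1 else 0 := by
  fin_cases a <;> fin_cases c <;>
    simp [hypGram, Fin.sum_univ_two, hq.conj_conj, conj_mul_conj_inv hq]

theorem mul_hypGram (P : Bˣ) (a c : Fin 2) :
    ∑ b, hypGram K (conj K ((P⁻¹ : Bˣ) : B)) a b * hypGram K (P : B) b c =
      if a = c then 1 else 0 := by
  fin_cases a <;> fin_cases c <;>
    simp [hypGram, Fin.sum_univ_two, hq.conj_conj, conj_inv_mul_conj hq]

variable {V : Type*} [AddCommGroup V] [Module B V] {h : V → V → B}

/-- A hermitian space with an orthonormal basis of even length has a hyperbolic basis. -/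
theorem exists_hyperbolic_basis (hh : Herm K h) (hsurj : ∃ y : B, nrd K y = -1) (P : Bˣ) {k : ℕ}
    {z : Fin (k * 2) → Fin 1 → V} (hz : IsBlock h (fun _ _ => 1) z)
    (hsp : ∀ x : V, ∃ c : Fin (k * 2) → Fin 1 → B, x = ∑ i, ∑ a, c i a • z i a) :
    ∃ w : Fin k → Fin 2 → V, IsBlock h (hypGram K (P : B)) w ∧
      ∀ x : V, ∃ c : Fin k → Fin 2 → B, x = ∑ i, ∑ a, c i a • w i a := by
  obtain ⟨c, hc⟩ := hsurj
  have hcc : c * conj K c = -1 := by rw [hq.mul_conj, hc, map_neg, map_one]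
  have hcc' : conj K c * c = -1 := by rw [hq.conj_mul_self, hc, map_neg, map_one]
  set t : B := algebraMap K B 2⁻¹ with ht
  have htt : t + t = 1 := by
    rw [ht, ← map_add, ← two_mul, mul_inv_cancel₀ hq.two_ne_zero, map_one]
  have htc : ∀ x : B, x * t = t * x := fun x => (Algebra.commutes _ x).symm
  have hct : conj K t = t := hq.conj_algebraMap _
  clear_value t
  set e : Fin k → Fin 2 → V := fun i b => z (finProdFinEquiv (i, b)) 0 with he
  have hee : ∀ i a j b, h (e i a) (e j b) = if i = j ∧ a = b then 1 else 0 := by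
    intro i a j b
    rw [he]
    simp only [hz _ _ _ _, EmbeddingLike.apply_eq_iff_eq, Prod.mk.injEq]
  have hes : ∀ x : V, ∃ c : Fin k → Fin 2 → B, x = ∑ i, ∑ a, c i a • e i a := by
    intro x
    obtain ⟨c, hx⟩ := hsp x
    refine ⟨fun i b => c (finProdFinEquiv (i, b)) 0, ?_⟩
    rw [hx, ← finProdFinEquiv.sum_comp, Fintype.sum_prod_type]
    simp [he]
  clear_value e
  -- As `1 + c c̄ = 0`, both `e₀ ± c e₁` are isotropic, and they pair to `1 - c c̄ = 2`. The factor
  -- `t P̄` with `t = 1/2` changes this to `P`.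
  refine ⟨fun i => ![e i 0 + c • e i 1, (t * conj K (P : B)) • (e i 0 - c • e i 1)], ?_, ?_⟩
  · have key : ∀ (i j : Fin k) (b₁ b₂ : B), h (e i 0 + b₁ • e i 1) (e j 0 + b₂ • e j 1) =
        if i = j then 1 + b₁ * conj K b₂ else 0 := by
      intro i j b₁ b₂
      rw [hh.add_left, hh.add_right, hh.add_right, hh.smul_left, hh.smul_left,
        hh.smul_right hq, hh.smul_right hq]
      have h01 : (0 : Fin 2) ≠ 1 := by decide
      have h10 : (1 : Fin 2) ≠ 0 := by decide
      simp only [hee, h01, h10, and_true, and_false, if_false, zero_mul, mul_zero, add_zero,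
        zero_add, ite_mul, mul_ite, one_mul]
      split_ifs <;> simp
    have hneg : ∀ i, e i 0 - c • e i 1 = e i 0 + (-c) • e i 1 := fun i => by
      rw [neg_smul, sub_eq_add_neg]
    have h2 : ∀ x : B, t * x * (1 + 1) = x := fun x => by
      rw [mul_add, mul_one, ← add_mul, htt, one_mul]
    have hcn : c * conj K (-c) = 1 := by rw [conj_neg, mul_neg, hcc, neg_neg]
    have hcn' : -c * conj K c = 1 := by rw [neg_mul, hcc, neg_neg]
    have hcn'' : -c * conj K (-c) = -1 := by rw [conj_neg, neg_mul_neg, hcc]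
    have hconj : conj K (t * conj K (P : B)) = t * P := by
      rw [hq.conj_mul, hq.conj_conj, hct, htc]
    intro i a j b
    fin_cases a <;> fin_cases b
    · simp [key, hcc, hypGram]
    · simp only [hneg, Fin.zero_eta, Fin.mk_one, Matrix.cons_val_zero, Matrix.cons_val_one,
        hh.smul_right hq, key, hcn, hconj, hypGram]
      rw [ite_mul, zero_mul, add_mul, one_mul, ← add_mul, htt, one_mul]
    · simp only [hneg, Fin.zero_eta, Fin.mk_one, Matrix.cons_val_zero, Matrix.cons_val_one,
        hh.smul_left, key, hcn', hypGram, mul_ite, h2, mul_zero]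
    · simp only [hneg, Fin.mk_one, Matrix.cons_val_one, Matrix.cons_val_fin_one,
        hh.smul_right hq, hh.smul_left, key, hcn'', hypGram]
      simp
  · intro x
    obtain ⟨d, rfl⟩ := hes x
    set Q : B := conj K ((P⁻¹ : Bˣ) : B) with hQ
    have hQP : Q * (t * conj K (P : B)) = t := by
      rw [← mul_assoc, htc, mul_assoc, conj_inv_mul_conj hq, mul_one]
    refine ⟨fun i => ![d i 0 * t - d i 1 * conj K c * t, d i 0 * Q + d i 1 * conj K c * Q], ?_⟩
    refine Finset.sum_congr rfl fun i _ => ?_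
    have h1 : ∀ a : B, (a * t) • (e i 0 + c • e i 1) + (a * Q) • (t * conj K (P : B)) •
        (e i 0 - c • e i 1) = a • e i 0 := fun a => by
      rw [← mul_smul (a * Q), mul_assoc a Q, hQP, ← smul_add, add_add_sub_cancel, smul_add,
        ← add_smul, ← mul_add, htt, mul_one]
    have h2 : ∀ a : B, (a * Q) • (t * conj K (P : B)) • (e i 0 - c • e i 1) -
        (a * t) • (e i 0 + c • e i 1) = -((a * c) • e i 1) := fun a => by
      rw [← mul_smul (a * Q), mul_assoc a Q, hQP, ← smul_sub, mul_smul a c, ← smul_neg,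
        show e i 0 - c • e i 1 - (e i 0 + c • e i 1) = -(c • e i 1) + -(c • e i 1) by abel,
        smul_add, ← add_smul, ← mul_add, htt, mul_one]
    simp only [Fin.sum_univ_two, Matrix.cons_val_zero, Matrix.cons_val_one]
    have h3 := h2 (d i 1 * conj K c)
    rw [mul_assoc (d i 1) _ c, hcc', mul_neg, mul_one, neg_smul, neg_neg] at h3
    rw [← h3, ← h1 (d i 0), sub_smul, add_smul]
    abel

end Hyperbolic

section Plane

variable {R K B V : Type*} [CommRing R] [IsDomain R] [IsDiscreteValuationRing R] [Field K]
  [Algebra R K] [IsFractionRing R K] [Ring B] [Algebra K B] [Algebra R B] [IsScalarTower R K B]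
  [AddCommGroup V] [Module B V] (hq : Quat K B) {h : V → V → B} (hh : Herm K h)
  (hdiv : IsDivision B) (hR : HasQuadraticRoots R)
  {O : Subalgebra R B} (hO : Maximal (IsOrder K) O)
  {ϖ : R} (hϖ : Irreducible ϖ) {P : Bˣ} (hP : nrd K (P : B) = algebraMap R K ϖ)

include hq

omit [IsDomain R] [IsDiscreteValuationRing R] [IsFractionRing R K] in
theorem conj_algebraMap' (r : R) : conj K (algebraMap R B r) = algebraMap R B r := by
  rw [algebraMap_tower (K := K), hq.conj_algebraMap]

include hP in
omit [IsDomain R] [IsDiscreteValuationRing R] [IsFractionRing R K] in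
theorem mul_conj_prime : (P : B) * conj K (P : B) = algebraMap R B ϖ := by
  rw [hq.mul_conj, hP, ← algebraMap_tower]

include hP in
omit [IsDomain R] [IsDiscreteValuationRing R] [IsFractionRing R K] in
theorem conj_mul_prime : conj K (P : B) * (P : B) = algebraMap R B ϖ := by
  rw [hq.conj_mul_self, hP, ← algebraMap_tower]

include hdiv hR hO in
theorem exists_inverse_mem {w : B} {u : Rˣ} (hu : nrd K w = algebraMap R K u) :
    ∃ w' ∈ O, w * w' = 1 := by
  have hw : IsUnit w := (hq.isUnit_iff w).2 (by
    rw [hu, Ne, algebraMap_eq_zero_iff']; exact u.ne_zero)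
  obtain ⟨w, rfl⟩ := hw
  refine ⟨((w⁻¹ : Bˣ) : B), (mem_maximalOrder_iff hq hdiv hR hO).2 ⟨(u⁻¹ : Rˣ), ?_⟩, w.mul_inv⟩
  have h1 : nrd K (w : B) * nrd K ((w⁻¹ : Bˣ) : B) = 1 := by
    rw [← hq.nrd_mul, w.mul_inv, hq.nrd_one]
  rw [hu] at h1
  have h2 : algebraMap R K u * algebraMap R K (u⁻¹ : Rˣ) = 1 := by rw [← map_mul]; simp
  exact mul_left_cancel₀ (left_ne_zero_of_mul_eq_one h1) (h2.trans h1.symm)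

include hdiv hR hO hϖ hP in
/-- Two vectors of a lattice pairing to a prime element can be moved to a hyperbolic pair if the
norm form is divisible by the uniformizer. -/
theorem exists_hyperbolic_pair (hh : Herm K h) [Finite (ResidueField R)] (L : Submodule O V)
    (hself : ∀ u ∈ L, ∃ a : R, h u u = algebraMap R B (ϖ * a))
    {u v : V} (hu : u ∈ L) (hv : v ∈ L) (huv : h u v = P) :
    ∃ x ∈ L, ∃ y ∈ L, h x x = 0 ∧ h y y = 0 ∧ h x y = P := by
  obtain ⟨c₁, hc₁, htc⟩ := exists_trd_eq_one hq hdiv hR hO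
  obtain ⟨n₁, hn₁⟩ := hO.1.nrd_mem hq hc₁
  have mem_iff := fun x => mem_maximalOrder_iff hq hdiv hR hO (x := x)
  have hPO : (P : B) ∈ O := (mem_iff _).2 ⟨ϖ, hP.symm⟩
  have hcom : ∀ r : R, ∀ u : B, u * algebraMap R B r = algebraMap R B r * u := fun r u =>
    (Algebra.commutes r u).symm
  have hϖm : ϖ ∈ maximalIdeal R := (mem_maximalIdeal _).2 hϖ.not_isUnit
  have hsm : ∀ o ∈ O, ∀ w ∈ L, o • w ∈ L := fun o ho w hw => L.smul_mem ⟨o, ho⟩ hw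
  obtain ⟨a, ha⟩ := hself u hu
  obtain ⟨b, hb⟩ := hself v hv
  -- For `x = u + s P c₁ v` with `Trd c₁ = 1`, `h(x, x) = ϖ (a + s + n₁ ϖ b s²)`; this `s` makes it
  -- vanish.
  obtain ⟨s, hs⟩ := hR.exists_root (c := n₁ * (ϖ * b)) (m := -a) (by
    rw [show n₁ * (ϖ * b) * -a = -(n₁ * b * a) * ϖ by ring]
    exact Ideal.mul_mem_left _ _ hϖm)
  have hc₁t : c₁ + conj K c₁ = 1 := by rw [add_conj, htc, map_one]
  -- the isotropic vector
  set e : B := algebraMap R B s * (P * c₁) with he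
  have heO : e ∈ O := O.mul_mem (O.algebraMap_mem _) (O.mul_mem hPO hc₁)
  have hce : conj K e = algebraMap R B s * (conj K c₁ * conj K (P : B)) := by
    rw [he, hq.conj_mul, hq.conj_mul, conj_algebraMap' hq, hcom]
  set x := u + e • v with hx
  have hxL : x ∈ L := L.add_mem hu (hsm e heO v hv)
  have hvu : h v u = conj K (P : B) := by rw [hh.symm, huv]
  have hxx : h x x = 0 := by
    have h1 : (P : B) * conj K e + e * conj K (P : B) = algebraMap R B (s * ϖ) := by
      have h4 : (P : B) * conj K c₁ * conj K (P : B) + P * (c₁ * conj K (P : B)) =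
          P * (c₁ + conj K c₁) * conj K (P : B) := by noncomm_ring
      rw [hce, he, ← mul_assoc, hcom s (P : B), mul_assoc, mul_assoc, ← mul_add, ← mul_assoc,
        mul_assoc (P : B) c₁, h4, hc₁t, mul_one, mul_conj_prime hq hP, ← map_mul]
    have h2 : e * conj K e = algebraMap R B (s * s * (ϖ * n₁)) := by
      rw [hq.mul_conj, he, nrd_algebraMap_mul hq, hq.nrd_mul, hP, ← hn₁, ← map_mul,
        ← map_mul, ← algebraMap_tower]
    have h3 : h x x = h u u + (h u v * conj K e + e * h v u) + e * (h v v * conj K e) := by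
      rw [hx, hh.add_left, hh.add_right, hh.add_right, hh.smul_right hq, hh.smul_left,
        hh.smul_left, hh.smul_right hq]
      abel
    rw [h3, huv, hvu, h1, ha, hb, ← hcom _ (conj K e), ← mul_assoc, h2, ← map_mul, ← map_add,
      ← map_add]
    have : ϖ * a + s * ϖ + s * s * (ϖ * n₁) * (ϖ * b) = 0 := by
      linear_combination ϖ * hs
    rw [this, map_zero]
  -- the pairing of `x` and `v`
  set w : B := algebraMap R B 1 + algebraMap R B (s * (ϖ * b)) * c₁ + algebraMap R B 0 * 0 with hw
  have hxv : h x v = P * w := by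
    rw [hx, hh.add_left, hh.smul_left, huv, hb, he, hw, mul_zero, add_zero, map_one, mul_add,
      mul_one, hcom, ← mul_assoc, ← map_mul, mul_comm (ϖ * b) s, ← mul_assoc (P : B),
      hcom _ (P : B), mul_assoc]
  obtain ⟨w', hw', hww'⟩ : ∃ w' ∈ O, w * w' = 1 := by
    have hnw : nrd K w = algebraMap R K (1 + s * (ϖ * b) * (1 + s * (ϖ * b) * n₁)) := by
      rw [hw, nrd_ternary hq, htc, ← hn₁]
      simp only [map_add, map_mul, map_one, map_zero, mul_zero, zero_mul, add_zero]
      ring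
    have hunit : IsUnit (1 + s * (ϖ * b) * (1 + s * (ϖ * b) * n₁)) := by
      by_contra hc
      have h1 := Ideal.sub_mem _ ((mem_maximalIdeal _).2 hc)
        (Ideal.mul_mem_left _ (s * b * (1 + s * (ϖ * b) * n₁)) hϖm)
      rw [show 1 + s * (ϖ * b) * (1 + s * (ϖ * b) * n₁) - s * b * (1 + s * (ϖ * b) * n₁) * ϖ = 1 by
        ring] at h1
      exact (Ideal.ne_top_iff_one _).1 Ideal.IsPrime.ne_top' h1
    obtain ⟨y, hy⟩ := hunit
    rw [← hy] at hnw
    exact exists_inverse_mem hq hdiv hR hO hnw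
  set v₂ := conj K w' • v with hv₂
  have hv₂L : v₂ ∈ L := hsm _ (hO.1.conj_mem hq hw') _ hv
  have hxv₂ : h x v₂ = P := by
    rw [hv₂, hh.smul_right hq, hq.conj_conj, hxv, mul_assoc, hww', mul_one]
  clear_value v₂ x
  -- the second isotropic vector
  obtain ⟨b₂, hb₂⟩ := hself v₂ hv₂L
  -- `Trd(d P) = -b₂ ϖ Trd c₁` cancels `h(v₂, v₂) = ϖ b₂`; since `x` is isotropic there is no
  -- quadratic term.
  set d : B := algebraMap R B (-b₂) * (c₁ * conj K (P : B)) with hd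
  have hdO : d ∈ O := O.mul_mem (O.algebraMap_mem _) (O.mul_mem hc₁ (hO.1.conj_mem hq hPO))
  refine ⟨x, hxL, v₂ + d • x, L.add_mem hv₂L (hsm _ hdO _ hxL), hxx, ?_, ?_⟩
  · have h1 : d * (P : B) + conj K (d * (P : B)) = algebraMap R B (-(ϖ * b₂)) := by
      rw [add_conj, hd, mul_assoc, mul_assoc, conj_mul_prime hq hP, hcom, trd_algebraMap_mul,
        trd_algebraMap_mul, htc, mul_one, ← map_mul, ← algebraMap_tower]
      congr 1; ring
    have h2 : h v₂ x = conj K (P : B) := by rw [hh.symm, hxv₂]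
    rw [hh.add_left, hh.add_right, hh.add_right, hh.smul_left, hh.smul_left, hh.smul_right hq,
      hh.smul_right hq, hxx, zero_mul, mul_zero, add_zero, hxv₂, h2, ← hq.conj_mul, add_assoc,
      add_comm _ (d * (P : B)), h1, hb₂, ← map_add, add_neg_cancel, map_zero]
  · rw [hh.add_right, hh.smul_right hq, hxx, zero_mul, add_zero, hxv₂]

include hdiv hR hO hϖ hP in
/-- Prime-modular hermitian lattices over a division algebra are orthogonal sums of hyperbolic
planes. -/
theorem exists_hyperbolic_span [Module.Finite B V] (hh : Herm K h) [Finite (ResidueField R)]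
    {L : Submodule O V} (hL : IsLattice L)
    (hdual : ∀ x, x ∈ L ↔ ∀ y ∈ L, ((P⁻¹ : Bˣ) : B) * h x y ∈ O) :
    ∃ (k : ℕ) (z : Fin k → Fin 2 → V), IsBlock h (hypGram K (P : B)) z ∧ (∀ i a, z i a ∈ L) ∧
      ∀ x ∈ L, x = ∑ i, ∑ b, (∑ a, h x (z i a) *
        hypGram K (conj K ((P⁻¹ : Bˣ) : B)) a b) • z i b := by
  have mem_iff := fun x => mem_maximalOrder_iff hq hdiv hR hO (x := x)
  have hϖ0 : algebraMap R K ϖ ≠ 0 := by rw [Ne, algebraMap_eq_zero_iff']; exact hϖ.ne_zero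
  have hPinv : nrd K ((P⁻¹ : Bˣ) : B) = (algebraMap R K ϖ)⁻¹ := by
    refine eq_inv_of_mul_eq_one_left ?_
    rw [← hP, ← hq.nrd_mul, P.inv_mul, hq.nrd_one]
  have hdual' : ∀ x, x ∈ L ↔ ∀ y ∈ L, (algebraMap R K ϖ)⁻¹ * nrd K (h x y) ∈ integers R K := by
    intro x
    rw [hdual]
    refine forall₂_congr fun y _ => ?_
    rw [mem_iff, hq.nrd_mul, hPinv]
  have hLs : ∀ x ∈ L, ∀ y ∈ L, ∀ w ∈ L, ∀ a b,
      (h x y * hypGram K (conj K ((P⁻¹ : Bˣ) : B)) a b) • w ∈ L := by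
    intro x hx y hy w hw a b
    have h1 := (hdual' x).1 hx y hy
    have h2 : ∀ c : B, nrd K c = (algebraMap R K ϖ)⁻¹ → (h x y * c) • w ∈ L := by
      intro c hc
      refine L.smul_mem ⟨h x y * c, (mem_iff _).2 ?_⟩ hw
      rwa [hq.nrd_mul, hc, mul_comm]
    fin_cases a <;> fin_cases b <;> simp [hypGram, hq.conj_conj]
    · exact h2 _ (by rw [hq.nrd_conj, hPinv])
    · exact h2 _ hPinv
  refine exists_block_span hq hh (hypGram_mul hq P) (mul_hypGram hq P) L.toAddSubgroup hLs ?_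
  intro k z hz hzL x hxL hx0 hxz
  set L' := orthogonalIn hh L z with hL'
  have hxL' : x ∈ L' := ⟨hxL, hxz⟩
  have hval : ∀ u ∈ L', ∀ v ∈ L', ∃ r : R, nrd K (h u v) = algebraMap R K (ϖ * r) := by
    intro u hu v hv
    obtain ⟨r, hr⟩ := (hdual' u).1 hu.1 v hv.1
    refine ⟨r, ?_⟩
    rw [map_mul, hr, ← mul_assoc, mul_inv_cancel₀ hϖ0, one_mul]
  -- If no pairing has order exactly one, `P⁻¹` preserves the complement by duality, and iterating
  -- it on `x` makes the norms of the pairings unbounded.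
  obtain ⟨u, hu, v, hv, huv⟩ : ∃ u ∈ L', ∃ v ∈ L', h u v = P := by
    by_contra! hcon
    have hm : ∀ u ∈ L', ∀ v ∈ L', ∃ r : R, nrd K (h u v) = algebraMap R K (ϖ * (ϖ * r)) := by
      intro u hu v hv
      obtain ⟨r, hr⟩ := hval u hu v hv
      have hrm : r ∈ maximalIdeal R := by
        rw [mem_maximalIdeal]
        rintro ⟨y, rfl⟩
        obtain ⟨w, hw, hnw⟩ := exists_eq_mul_of_nrd hq (a := (P : B)) (x := h u v)
          (c := algebraMap R K y) (by rwa [hP]) (by rw [hr, hP, map_mul])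
        obtain ⟨w', hw', hww'⟩ := exists_inverse_mem hq hdiv hR hO hnw
        refine hcon u hu (conj K w' • v) (L'.smul_mem ⟨_, hO.1.conj_mem hq hw'⟩ hv) ?_
        rw [hh.smul_right hq, hq.conj_conj, hw, mul_assoc, hww', mul_one]
      rw [hϖ.maximalIdeal_eq, Ideal.mem_span_singleton] at hrm
      obtain ⟨r', rfl⟩ := hrm
      exact ⟨r', hr⟩
    have hstab : ∀ u ∈ L', ((P⁻¹ : Bˣ) : B) • u ∈ L' := by
      intro u hu
      refine ⟨(hdual' _).2 fun y hy => ?_, fun i a => by rw [hh.smul_left, hu.2, mul_zero]⟩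
      obtain ⟨y', hy', hyy'⟩ := exists_orthogonal_representative hq hh (mul_hypGram hq P) hz hzL
        hLs hy
      obtain ⟨r, hr⟩ := hm u hu y' hy'
      rw [hh.smul_left, hyy' u hu, hq.nrd_mul, hPinv, hr]
      refine ⟨r, ?_⟩
      simp only [map_mul]
      field_simp
    have hpow : ∀ k : ℕ, (((P⁻¹ : Bˣ) : B) ^ k) • x ∈ L' := by
      intro k
      induction k with
      | zero => simpa using hxL'
      | succ k ih => rw [pow_succ', mul_smul]; exact hstab _ ih
    refine hx0 (hh.eq_zero_of_isLattice hq hL fun y hy => ?_)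
    by_contra hne
    have hD : (algebraMap R K ϖ)⁻¹ * nrd K (h x y) ≠ 0 :=
      mul_ne_zero (inv_ne_zero hϖ0) fun h0 => hne (eq_zero_of_nrd hq hdiv h0)
    obtain ⟨r, hr⟩ : (algebraMap R K ϖ)⁻¹ ∈ integers R K := mem_integers_of_pow hD fun k => by
      have h1 := (hdual' _).1 (hpow k).1 y hy
      have h2 : nrd K (((P⁻¹ : Bˣ) : B) ^ k) = (algebraMap R K ϖ)⁻¹ ^ k := by
        rw [← hPinv]; exact map_pow hq.nrdHom _ k
      rw [hh.smul_left, hq.nrd_mul, h2] at h1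
      convert h1 using 1
      ring
    refine hϖ.not_isUnit (IsUnit.of_mul_eq_one r (IsFractionRing.injective R K ?_))
    rw [map_mul, hr, map_one, mul_inv_cancel₀ hϖ0]
  -- A scalar whose square, its reduced norm, is divisible by `ϖ` is itself divisible by `ϖ`. So no
  -- vector can split off alone.
  have hself : ∀ u ∈ L', ∃ a : R, h u u = algebraMap R B (ϖ * a) := by
    intro u hu
    obtain ⟨c, hc⟩ := hh.exists_self hq u
    obtain ⟨r, hr⟩ := hval u hu u hu
    rw [hc, hq.nrd_algebraMap] at hr
    obtain ⟨d, rfl⟩ := mem_integers_of_mul_self (R := R) (x := c) (by rw [hr]; exact ⟨_, rfl⟩)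
    rw [← map_mul] at hr
    have h1 := IsFractionRing.injective R K hr
    have h2 : ϖ ∣ d := by
      rcases hϖ.prime.dvd_or_dvd (Dvd.intro _ h1.symm : ϖ ∣ d * d) with h | h <;> exact h
    obtain ⟨a, rfl⟩ := h2
    exact ⟨a, by rw [hc, ← algebraMap_tower]⟩
  obtain ⟨x, hx, y, hy, hxx, hyy, hxy⟩ :=
    exists_hyperbolic_pair hq hdiv hR hO hϖ hP hh L' hself hu hv huv
  refine ⟨![x, y], fun a => ?_, fun a b => ?_, fun a i b => ?_⟩
  · fin_cases a
    exacts [hx.1, hy.1]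
  · fin_cases a <;> fin_cases b
    · simpa [hypGram] using hxx
    · simpa [hypGram] using hxy
    · simpa [hypGram, ← hxy] using hh.symm x y
    · simpa [hypGram] using hyy
  · fin_cases a
    exacts [hx.2 i b, hy.2 i b]

end Plane

/-! ### From `ψ` to a `B`-valued hermitian form -/

open nonZeroDivisors in
/-- The codifferent of a discrete valuation ring over its ground ring is principal. -/
theorem exists_codifferent (A F : Type*) {R K : Type*} [CommRing A] [IsDomain A]
    [IsIntegrallyClosed A] [Field F] [CommRing R] [IsDomain R] [IsDiscreteValuationRing R] [Field K]
    [Algebra A F] [IsFractionRing A F] [Algebra R K] [IsFractionRing R K] [Algebra A R]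
    [Algebra F K] [Algebra A K] [IsScalarTower A F K] [IsScalarTower A R K]
    [IsIntegralClosure R A K] [FiniteDimensional F K] [Algebra.IsSeparable F K] :
    ∃ δ : K, δ ≠ 0 ∧ ∀ c : K,
      (∀ r : R, Algebra.trace F K (algebraMap R K r * c) ∈ (algebraMap A F).range) ↔
        δ * c ∈ integers R K := by
  let D : FractionalIdeal R⁰ K := FractionalIdeal.dual A F 1
  obtain ⟨d, hd⟩ := (FractionalIdeal.isPrincipal_iff D).1 inferInstance
  have hd0 : d ≠ 0 := by
    rintro rfl
    rw [FractionalIdeal.spanSingleton_zero] at hd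
    exact FractionalIdeal.dual_ne_zero A F (one_ne_zero (α := FractionalIdeal R⁰ K)) hd
  have h10 : (1 : FractionalIdeal R⁰ K) ≠ 0 := one_ne_zero
  refine ⟨d⁻¹, inv_ne_zero hd0, fun c => ?_⟩
  have h1 : (∀ r : R, Algebra.trace F K (algebraMap R K r * c) ∈ (algebraMap A F).range) ↔
      c ∈ D := by
    rw [FractionalIdeal.mem_dual h10]
    constructor
    · intro h a ha
      obtain ⟨r, rfl⟩ := (FractionalIdeal.mem_one_iff _).1 ha
      rw [Algebra.traceForm_apply, mul_comm]
      exact h r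
    · intro h r
      rw [mul_comm]
      exact h _ ((FractionalIdeal.mem_one_iff _).2 ⟨r, rfl⟩)
  rw [h1, hd, FractionalIdeal.mem_spanSingleton]
  constructor
  · rintro ⟨r, rfl⟩
    refine ⟨r, ?_⟩
    rw [Algebra.smul_def, mul_left_comm, inv_mul_cancel₀ hd0, mul_one]
  · rintro ⟨r, hr⟩
    refine ⟨r, ?_⟩
    rw [Algebra.smul_def, hr, mul_comm, ← mul_assoc, mul_inv_cancel₀ hd0, one_mul]

section Descent

theorem conj_inv_eq_neg {K B : Type*} [Field K] [Ring B] [Algebra K B] (hq : Quat K B)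
    {γ : Bˣ} (hγ : conj K (γ : B) = -γ) :
    conj K ((γ⁻¹ : Bˣ) : B) = -((γ⁻¹ : Bˣ) : B) := by
  have h1 := conj_inv_mul_conj hq γ
  rw [hγ, mul_neg, ← neg_mul] at h1
  rw [← neg_eq_iff_eq_neg]
  exact Units.eq_inv_of_mul_eq_one_right h1

variable {K₀ K B V : Type*} [Field K₀] [Field K] [Algebra K₀ K] [FiniteDimensional K₀ K]
  [Algebra.IsSeparable K₀ K] [Ring B] [Algebra K B] [Algebra K₀ B] [IsScalarTower K₀ K B]
  (hq : Quat K B)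

/-- The bilinear form `Tr_{K/K₀} Trd(xy)` on `B`. -/
def absTraceForm (K₀ K B : Type*) [Field K₀] [Field K] [Algebra K₀ K] [Ring B] [Algebra K B]
    [Algebra K₀ B] [IsScalarTower K₀ K B] : LinearMap.BilinForm K₀ B :=
  (LinearMap.mul K₀ B).compr₂ (Algebra.trace K₀ K ∘ₗ (trd K).restrictScalars K₀)

omit [FiniteDimensional K₀ K] [Algebra.IsSeparable K₀ K] in
theorem absTraceForm_apply (x y : B) :
    absTraceForm K₀ K B x y = Algebra.trace K₀ K (trd K (x * y)) := rfl

include hq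

theorem absTraceForm_nondegenerate : (absTraceForm K₀ K B).Nondegenerate := by
  have h1 : ∀ x : B, (∀ y, Algebra.trace K₀ K (trd K (x * y)) = 0) → x = 0 := by
    intro x hx
    refine hq.trd_nondegenerate fun y => ?_
    refine (_root_.traceForm_nondegenerate K₀ K).1 _ fun c => ?_
    rw [Algebra.traceForm_apply, ← hx (c • y), mul_smul_comm, map_smul, smul_eq_mul, mul_comm]
  refine ⟨h1, fun x hx => h1 x fun y => ?_⟩
  rw [trd_mul_comm]
  exact hx y

variable [AddCommGroup V] [Module K₀ V] [Module B V] [IsScalarTower K₀ B V]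

/-- A skew-hermitian form with values in `K₀` comes from a `B`-valued hermitian form. -/
theorem exists_herm {s : B → B} {γ : Bˣ} (hγ : conj K (γ : B) + γ = 0)
    (hs : ∀ x : B, s x = γ * conj K x * (γ⁻¹ : Bˣ)) {ψ : LinearMap.BilinForm K₀ V}
    (hψ : IsHermitianForm (-1) s ψ) :
    ∃ h : V → V → B, Herm K h ∧
      ∀ x y, ψ x y = -Algebra.trace K₀ K (trd K (((γ⁻¹ : Bˣ) : B) * h x y)) := by
  have := hq.finite
  have : Module.Finite K₀ B := Module.Finite.trans K B
  have hT := absTraceForm_nondegenerate (K₀ := K₀) hq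
  have hcγ : conj K (γ : B) = -γ := eq_neg_of_add_eq_zero_left hγ
  have hcγ' := conj_inv_eq_neg hq hcγ
  -- `h x y` represents the functional `b ↦ ψ(b x, γ y)` under the trace form. Inserting `γ` turns
  -- `*` into the canonical involution, and `γ̄ = -γ` turns the sign `-1` into `+1`.
  have hex : ∀ x y : V, ∃ c : B, ∀ b : B,
      Algebra.trace K₀ K (trd K (c * b)) = ψ (b • x) ((γ : B) • y) := by
    intro x y
    let f : B →ₗ[K₀] K₀ := (ψ.flip ((γ : B) • y)) ∘ₗ
      ((LinearMap.toSpanSingleton B V x).restrictScalars K₀)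
    exact ⟨(LinearMap.BilinForm.toDual _ hT).symm f, fun b =>
      LinearMap.BilinForm.apply_toDual_symm_apply (hB := hT) f b⟩
  choose h hh using hex
  have heq : ∀ c d : B, (∀ b, Algebra.trace K₀ K (trd K (c * b)) =
      Algebra.trace K₀ K (trd K (d * b))) → c = d := by
    intro c d hcd
    rw [← sub_eq_zero]
    refine hT.1 _ fun b => ?_
    rw [absTraceForm_apply, sub_mul, map_sub, map_sub, hcd, sub_self]
  have hleft : ∀ (b : B) x y, h (b • x) y = b * h x y := by
    intro b x y
    refine heq _ _ fun c => ?_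
    rw [hh, ← mul_smul, ← hh, mul_assoc b, trd_mul_comm b, mul_assoc]
  have hsymm : ∀ x y, h y x = conj K (h x y) := by
    intro x y
    refine heq _ _ fun b => ?_
    have h1 : trd K (conj K (h x y) * b) = trd K (h x y * conj K b) := by
      rw [← hq.trd_conj, hq.conj_mul, hq.conj_conj, trd_mul_comm]
    rw [h1, hh, hh, hψ.smul_left b y, hs, hψ.symm ((γ : B) • y), hψ.smul_left _ y, hs, hcγ]
    simp [← mul_smul]
  have hval : ∀ x y, ψ x y = -Algebra.trace K₀ K (trd K (((γ⁻¹ : Bˣ) : B) * h x y)) := by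
    intro x y
    have h1 := hh x (((γ⁻¹ : Bˣ) : B) • y) 1
    rw [← mul_smul, γ.mul_inv, one_smul, one_smul, mul_one, hsymm, hleft, hq.conj_mul, hcγ',
      ← hsymm, mul_neg, map_neg, map_neg, trd_mul_comm] at h1
    exact h1.symm
  refine ⟨h, ⟨?_, hleft, hsymm, ?_⟩, hval⟩
  · intro x y z
    refine heq _ _ fun b => ?_
    rw [hh, smul_add, map_add, LinearMap.add_apply, ← hh, ← hh, add_mul, map_add, map_add]
  · intro x hx
    refine hψ.nondegenerate.1 x fun y => ?_
    rw [hval, hx, mul_zero, map_zero, map_zero, neg_zero]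

end Descent

section Dual

variable {K₀ K B V : Type*} [Field K₀] [ValuativeRel K₀] [TopologicalSpace K₀]
  [IsNonarchimedeanLocalField K₀] [Field K] [Algebra K₀ K] [FiniteDimensional K₀ K]
  [Algebra.IsSeparable K₀ K] [Ring B] [Algebra K B]
  (hq : Quat K B) [AddCommGroup V] [Module K₀ V] [Module B V]

include hq

/-- The dual lattice in terms of the `B`-valued hermitian form. -/
theorem exists_mem_dual_iff {γ : Bˣ} {ψ : LinearMap.BilinForm K₀ V} {h : V → V → B}
    (hh : Herm K h) (hψ : ∀ x y, ψ x y = -Algebra.trace K₀ K (trd K (((γ⁻¹ : Bˣ) : B) * h x y)))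
    {O : Subalgebra (IntegerRing K₀ K) B} (hO : IsOrder K O) :
    ∃ δ : K, δ ≠ 0 ∧ ∀ (L : Submodule O V) (x : V), x ∈ dual ψ (L : Set V) ↔ ∀ y ∈ L, ∀ b ∈ O,
      trd K (δ • (((γ⁻¹ : Bˣ) : B) * h x y) * b) ∈ integers (IntegerRing K₀ K) K := by
  obtain ⟨_, -, -⟩ := integerRing_structure K₀ K
  obtain ⟨δ, hδ, hδi⟩ := exists_codifferent 𝒪[K₀] K₀ (R := IntegerRing K₀ K) (K := K)
  refine ⟨δ, hδ, fun L x => ?_⟩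
  have hrange : ∀ c : K₀, c ∈ (algebraMap 𝒪[K₀] K₀).range ↔ c ∈ 𝒪[K₀] := fun c =>
    ⟨by rintro ⟨c, rfl⟩; exact c.2, fun hc => ⟨⟨c, hc⟩, rfl⟩⟩
  have hx : ∀ y, ∀ b, h x (conj K b • y) = h x y * b := fun y b => by
    rw [hh.smul_right hq, hq.conj_conj]
  constructor
  · intro hx' y hy b hb
    rw [smul_mul_assoc, map_smul, smul_eq_mul, ← hδi]
    intro r
    -- `L` absorbs both `r` and `b`, so integrality over `K₀` holds for all multiples of the trace
    -- by `r`; the codifferent converts this into integrality over `R`.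
    have h1 := hx' (conj K (algebraMap _ B r * b) • y)
      (L.smul_mem ⟨_, hO.conj_mem hq (O.mul_mem (O.algebraMap_mem r) hb)⟩ hy)
    rw [hψ, hx, neg_mem_iff, Algebra.left_comm, Algebra.left_comm,
      trd_algebraMap_mul, ← mul_assoc] at h1
    exact (hrange _).2 h1
  · intro hx' y hy
    have h1 := hx' y hy 1 O.one_mem
    rw [smul_mul_assoc, map_smul, smul_eq_mul, ← hδi] at h1
    have h2 := h1 1
    rw [map_one, one_mul, mul_one, hrange] at h2
    rw [hψ, neg_mem_iff]
    exact h2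

end Dual

/-! ### Classification of unimodular and prime-modular lattices -/

section Span

variable {R K B V : Type*} [CommRing R] [Field K] [Ring B] [Algebra K B] [Algebra R B]
  [AddCommGroup V] [Module B V] (hq : Quat K B) {h : V → V → B} (hh : Herm K h)
  {O : Subalgebra R B} {ι : Type*} [Fintype ι] [DecidableEq ι] {M N : ι → ι → B}
  (hMN : ∀ a c, ∑ b, M a b * N b c = if a = c then 1 else 0)

include hh hMN

theorem mem_iff_of_span {L : Submodule O V} {k : ℕ} {z : Fin k → ι → V} (hz : IsBlock h M z)
    (hsp : ∀ x : V, ∃ c : Fin k → ι → B, x = ∑ i, ∑ a, c i a • z i a) (hzL : ∀ i a, z i a ∈ L)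
    (hLs : ∀ x ∈ L, ∀ i b, ∑ a, h x (z i a) * N a b ∈ O) (x : V) :
    x ∈ L ↔ ∀ i b, ∑ a, h x (z i a) * N a b ∈ O := by
  refine ⟨fun hx i b => hLs x hx i b, fun hx => ?_⟩
  obtain ⟨c, hc⟩ := hsp x
  rw [hc]
  refine Submodule.sum_mem _ fun i _ => Submodule.sum_mem _ fun a _ => ?_
  have h1 := hx i a
  rw [hz.coeff hh hMN c hc] at h1
  exact L.smul_mem ⟨_, h1⟩ (hzL i a)

include hq in
/-- Two lattices spanned by block families with the same Gram matrix are isometric. -/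
theorem exists_isometry_of_span [Nonempty ι] {L₁ L₂ : Submodule O V} (hL₁ : IsLattice L₁)
    (hL₂ : IsLattice L₂)
    {k₁ k₂ : ℕ} {z₁ : Fin k₁ → ι → V} {z₂ : Fin k₂ → ι → V}
    (hz₁ : IsBlock h M z₁) (hz₂ : IsBlock h M z₂)
    (hzL₁ : ∀ i a, z₁ i a ∈ L₁) (hzL₂ : ∀ i a, z₂ i a ∈ L₂)
    (hsp₁ : ∀ x ∈ L₁, x = ∑ i, ∑ b, (∑ a, h x (z₁ i a) * N a b) • z₁ i b)
    (hsp₂ : ∀ x ∈ L₂, x = ∑ i, ∑ b, (∑ a, h x (z₂ i a) * N a b) • z₂ i b)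
    (hLs₁ : ∀ x ∈ L₁, ∀ y ∈ L₁, ∀ a b, h x y * N a b ∈ O)
    (hLs₂ : ∀ x ∈ L₂, ∀ y ∈ L₂, ∀ a b, h x y * N a b ∈ O) :
    ∃ F : V ≃ₗ[B] V, (∀ x y, h (F x) (F y) = h x y) ∧ ∀ x, F x ∈ L₂ ↔ x ∈ L₁ := by
  have hs₁ := exists_span_of_isLattice hL₁ hsp₁
  have hs₂ := exists_span_of_isLattice hL₂ hsp₂
  obtain rfl : k₁ = k₂ := Nat.eq_of_mul_eq_mul_right Fintype.card_pos
    ((card_eq_finrank hq hh hMN hz₁ hs₁).symm.trans (card_eq_finrank hq hh hMN hz₂ hs₂))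
  exact exists_isometry hq hh hMN hz₁ hz₂ hs₁ hs₂
    (mem_iff_of_span hh hMN hz₁ hs₁ hzL₁ fun x hx i b =>
      O.sum_mem fun a _ => hLs₁ x hx _ (hzL₁ i a) a b)
    (mem_iff_of_span hh hMN hz₂ hs₂ hzL₂ fun x hx i b =>
      O.sum_mem fun a _ => hLs₂ x hx _ (hzL₂ i a) a b)

end Span

section Classification

variable {R K B V : Type*} [CommRing R] [IsDomain R] [IsDiscreteValuationRing R] [Field K]
  [Algebra R K] [IsFractionRing R K] [Ring B] [Algebra K B] [Algebra R B] [IsScalarTower R K B]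
  [AddCommGroup V] [Module B V] [Module.Finite B V] (hq : Quat K B) {h : V → V → B}
  (hh : Herm K h) {O : Subalgebra R B}

include hq hh

/-- Unimodular lattices are unique up to isometry. -/
theorem exists_isometry_of_unimodular (hO : IsOrder K O) {ϖ : R} (hϖ : Irreducible ϖ)
    {τ : B} (hτ : ∀ x : B, (∀ b ∈ O, trd K (x * b) ∈ integers R K) → τ * x ∈ O)
    (hsep : ∀ x : B, (∀ k : ℕ, ((algebraMap R K ϖ)⁻¹ • τ) ^ k * x ∈ O) → x = 0)
    (hunit : ∀ u : Rˣ, ∃ y ∈ O, nrd K y = algebraMap R K u)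
    {L₁ L₂ : Submodule O V} (hL₁ : IsLattice L₁) (hL₂ : IsLattice L₂)
    (hdual₁ : ∀ x, x ∈ L₁ ↔ ∀ y ∈ L₁, h x y ∈ O) (hdual₂ : ∀ x, x ∈ L₂ ↔ ∀ y ∈ L₂, h x y ∈ O) :
    ∃ F : V ≃ₗ[B] V, (∀ x y, h (F x) (F y) = h x y) ∧ ∀ x, F x ∈ L₂ ↔ x ∈ L₁ := by
  obtain ⟨k₁, z₁, hz₁, hzL₁, hsp₁⟩ :=
    exists_orthonormal_span hq hh hO hϖ hτ hsep hunit hL₁ hdual₁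
  obtain ⟨k₂, z₂, hz₂, hzL₂, hsp₂⟩ :=
    exists_orthonormal_span hq hh hO hϖ hτ hsep hunit hL₂ hdual₂
  exact exists_isometry_of_span hq hh (M := fun _ _ : Fin 1 => (1 : B))
    (N := fun _ _ : Fin 1 => (1 : B)) sum_one_mul_one hL₁ hL₂ hz₁ hz₂ hzL₁ hzL₂ hsp₁ hsp₂
    (fun x hx y hy _ _ => by rw [mul_one]; exact (hdual₁ x).1 hx y hy)
    (fun x hx y hy _ _ => by rw [mul_one]; exact (hdual₂ x).1 hx y hy)

/-- Unimodular lattices exist. -/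
theorem exists_unimodular (hO : IsOrder K O) (hsurj : ∀ c : K, ∃ y : B, nrd K y = c) :
    ∃ L : Submodule O V, IsLattice L ∧ ∀ x, x ∈ L ↔ ∀ y ∈ L, h x y ∈ O := by
  obtain ⟨k, z, hz, hsp⟩ := exists_orthonormal_basis hq hh hsurj
  exact exists_dual_lattice hq hh (M := fun _ _ : Fin 1 => (1 : B))
    (N := fun _ _ : Fin 1 => (1 : B)) sum_one_mul_one hz (fun x => ⟨_, hsp x⟩)
    (Subalgebra.toSubmodule O).toAddSubgroup (fun _ _ => O.one_mem)
    (fun o ho w hw => O.mul_mem ho hw) (fun o ho w hw => O.mul_mem hw ho)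
    (fun w hw _ _ => by rw [mul_one]; exact hw) (fun o ho => hO.conj_mem hq ho)

variable (hdiv : IsDivision B) (hR : HasQuadraticRoots R) (hO : Maximal (IsOrder K) O)
  [Finite (ResidueField R)] {ϖ : R} (hϖ : Irreducible ϖ) {P : Bˣ}
  (hP : nrd K (P : B) = algebraMap R K ϖ)

omit hh [AddCommGroup V] [Module B V] [Module.Finite B V] [Finite (ResidueField R)] in
include hdiv hR hO in
theorem mul_hypGram_inv_mem {w : B} (hw : ((P⁻¹ : Bˣ) : B) * w ∈ O) (a b : Fin 2) :
    w * hypGram K (conj K ((P⁻¹ : Bˣ) : B)) a b ∈ O := by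
  have mem_iff := fun x => mem_maximalOrder_iff hq hdiv hR hO (x := x)
  rw [mem_iff, hq.nrd_mul] at hw
  fin_cases a <;> fin_cases b <;> simp [hypGram, hq.conj_conj, O.zero_mem]
  · rwa [mem_iff, hq.nrd_mul, hq.nrd_conj, mul_comm]
  · rwa [mem_iff, hq.nrd_mul, mul_comm]

include hdiv hR hO hϖ hP

/-- Prime-modular lattices are unique up to isometry. -/
theorem exists_isometry_of_primeModular {L₁ L₂ : Submodule O V} (hL₁ : IsLattice L₁)
    (hL₂ : IsLattice L₂) (hdual₁ : ∀ x, x ∈ L₁ ↔ ∀ y ∈ L₁, ((P⁻¹ : Bˣ) : B) * h x y ∈ O)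
    (hdual₂ : ∀ x, x ∈ L₂ ↔ ∀ y ∈ L₂, ((P⁻¹ : Bˣ) : B) * h x y ∈ O) :
    ∃ F : V ≃ₗ[B] V, (∀ x y, h (F x) (F y) = h x y) ∧ ∀ x, F x ∈ L₂ ↔ x ∈ L₁ := by
  obtain ⟨k₁, z₁, hz₁, hzL₁, hsp₁⟩ := exists_hyperbolic_span hq hdiv hR hO hϖ hP hh hL₁ hdual₁
  obtain ⟨k₂, z₂, hz₂, hzL₂, hsp₂⟩ := exists_hyperbolic_span hq hdiv hR hO hϖ hP hh hL₂ hdual₂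
  exact exists_isometry_of_span hq hh (hypGram_mul hq P) hL₁ hL₂ hz₁ hz₂ hzL₁ hzL₂ hsp₁ hsp₂
    (fun x hx y hy => mul_hypGram_inv_mem hq hdiv hR hO ((hdual₁ x).1 hx y hy))
    (fun x hx y hy => mul_hypGram_inv_mem hq hdiv hR hO ((hdual₂ x).1 hx y hy))

/-- A hermitian space over a division algebra contains a prime-modular lattice if and only if its
rank is even. -/
theorem exists_primeModular_iff :
    (∃ L : Submodule O V, IsLattice L ∧ ∀ x, x ∈ L ↔ ∀ y ∈ L, ((P⁻¹ : Bˣ) : B) * h x y ∈ O) ↔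
      Even (Module.finrank B V) := by
  have mem_iff := fun x => mem_maximalOrder_iff hq hdiv hR hO (x := x)
  have hPinv : nrd K ((P⁻¹ : Bˣ) : B) = (algebraMap R K ϖ)⁻¹ := by
    refine eq_inv_of_mul_eq_one_left ?_
    rw [← hP, ← hq.nrd_mul, P.inv_mul, hq.nrd_one]
  constructor
  · rintro ⟨L, hL, hdual⟩
    obtain ⟨k, z, hz, -, hsp⟩ := exists_hyperbolic_span hq hdiv hR hO hϖ hP hh hL hdual
    rw [card_eq_finrank hq hh (hypGram_mul hq P) hz (exists_span_of_isLattice hL hsp),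
      Fintype.card_fin]
    exact even_two.mul_left k
  · rintro ⟨m, hm⟩
    obtain ⟨k, z, hz, hsp⟩ := exists_orthonormal_basis hq hh (exists_nrd_eq hq hdiv hR hO)
    have hk : k = m * 2 := by
      have h1 := card_eq_finrank hq hh (M := fun _ _ : Fin 1 => (1 : B))
        (N := fun _ _ : Fin 1 => (1 : B)) sum_one_mul_one hz fun x => ⟨_, hsp x⟩
      rw [Fintype.card_fin] at h1
      omega
    subst hk
    obtain ⟨w, hw, hwsp⟩ := exists_hyperbolic_basis hq hh (exists_nrd_eq hq hdiv hR hO (-1)) P hz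
      fun x => ⟨_, hsp x⟩
    let I : AddSubgroup B :=
      (Subalgebra.toSubmodule O).toAddSubgroup.comap (AddMonoidHom.mulLeft ((P⁻¹ : Bˣ) : B))
    have hI : ∀ x, x ∈ I ↔ ((P⁻¹ : Bˣ) : B) * x ∈ O := fun x => Iff.rfl
    have hI' : ∀ x, x ∈ I ↔ (algebraMap R K ϖ)⁻¹ * nrd K x ∈ integers R K := fun x => by
      rw [hI, mem_iff, hq.nrd_mul, hPinv]
    have hϖ0 : algebraMap R K ϖ ≠ 0 := by rw [Ne, algebraMap_eq_zero_iff']; exact hϖ.ne_zero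
    have hPI : ∀ x, nrd K x = algebraMap R K ϖ → x ∈ I := fun x hx => by
      rw [hI', hx, inv_mul_cancel₀ hϖ0]; exact Subring.one_mem _
    obtain ⟨L, hL, hLI⟩ := exists_dual_lattice hq hh (hypGram_mul hq P) hw hwsp I (O := O)
      (fun a b => by
        fin_cases a <;> fin_cases b <;> simp only [hypGram, Fin.zero_eta, Fin.mk_one,
          Matrix.cons_val_zero, Matrix.cons_val_one, Matrix.cons_val_fin_one]
        exacts [I.zero_mem, hPI _ hP, hPI _ (by rw [hq.nrd_conj, hP]), I.zero_mem])
      (fun o ho w hw => by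
        rw [hI'] at hw ⊢
        rw [hq.nrd_mul, mul_left_comm]
        exact Subring.mul_mem _ ((mem_iff o).1 ho) hw)
      (fun o ho w hw => by
        rw [hI, ← mul_assoc]
        exact O.mul_mem hw ho)
      (fun w hw a b => mul_hypGram_inv_mem hq hdiv hR hO hw a b)
      (fun o ho => hO.1.conj_mem hq ho)
    exact ⟨L, hL, hLI⟩

end Classification

/-! ### Reduction of self-duality to modularity of a scaled form -/

section Transfer

variable {K₀ R B V : Type*} [Field K₀] [ValuativeRel K₀] [CommRing R] [Ring B] [Algebra R B]
  [AddCommGroup V] [Module K₀ V] [Module B V] {O : Subalgebra R B} {ψ : LinearMap.BilinForm K₀ V}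

theorem isSelfDualLattice_iff {L : Submodule O V} :
    IsSelfDualLattice ψ L ↔ IsLattice L ∧ ∀ x, x ∈ L ↔ x ∈ dual ψ (L : Set V) :=
  and_congr_right fun _ => Set.ext_iff.trans (forall_congr' fun _ => Iff.comm)

omit [ValuativeRel K₀] in
theorem areIsometric_of_equiv {L₁ L₂ : Submodule O V} (F : V ≃ₗ[B] V)
    (hF : ∀ x, F x ∈ L₂ ↔ x ∈ L₁) (hψ : ∀ x y, ψ (F x) (F y) = ψ x y) : AreIsometric ψ L₁ L₂ := by
  refine ⟨LinearEquiv.ofSubmodules (F.restrictScalars O) L₁ L₂ ?_, fun x y => hψ x y⟩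
  ext x
  constructor
  · rintro ⟨y, hy, rfl⟩
    exact (hF y).2 hy
  · intro hx
    refine ⟨F.symm x, (hF _).1 ?_, F.apply_symm_apply x⟩
    rwa [F.apply_symm_apply]

end Transfer

section Reduction

theorem unit_mul_mem_integers {R K : Type*} [CommRing R] [Field K] [Algebra R K] (u : Rˣ) (x : K) :
    algebraMap R K u * x ∈ integers R K ↔ x ∈ integers R K := by
  constructor
  · intro h
    have := Subring.mul_mem _ (algebraMap_mem_integers (K := K) ((u⁻¹ : Rˣ) : R)) h
    rwa [← mul_assoc, ← map_mul, u.inv_mul, map_one, one_mul] at this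
  · exact Subring.mul_mem _ (algebraMap_mem_integers (u : R))

variable {R K B : Type*} [CommRing R] [IsDomain R] [IsDiscreteValuationRing R] [Field K]
  [Algebra R K] [IsFractionRing R K] [Ring B] [Algebra K B] [Algebra R B] [IsScalarTower R K B]
  (hq : Quat K B) {O : Subalgebra R B}

include hq

/-- In the split case the trace dual of the order, twisted by an element of the normalizer, is
a scalar multiple of the order. -/
theorem exists_smul_mem_iff_of_split (hO : IsOrder K O) {e : B ≃ₐ[K] Matrix (Fin 2) (Fin 2) K}
    (he : ∀ x, x ∈ O ↔ ∀ i j, e x i j ∈ integers R K) {γ : Bˣ}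
    (hγ : ∀ x ∈ O, ((γ⁻¹ : Bˣ) : B) * x * γ ∈ O) {δ : K} (hδ : δ ≠ 0) :
    ∃ c : K, c ≠ 0 ∧ ∀ x : B,
      (∀ b ∈ O, trd K (δ • (((γ⁻¹ : Bˣ) : B) * x) * b) ∈ integers R K) ↔ c • x ∈ O := by
  obtain ⟨c, hc, h1, h2⟩ := split_normalizer hq he γ hγ
  refine ⟨c⁻¹ * δ, mul_ne_zero (inv_ne_zero hc) hδ, fun x => ?_⟩
  have h3 : (∀ b ∈ O, trd K (δ • (((γ⁻¹ : Bˣ) : B) * x) * b) ∈ integers R K) ↔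
      δ • (((γ⁻¹ : Bˣ) : B) * x) ∈ O :=
    ⟨split_mem_of_trd hq he, fun h b hb => hO.trd_mem hq (O.mul_mem h hb)⟩
  rw [h3]
  constructor
  · intro h
    have := O.mul_mem h1 h
    rwa [smul_mul_smul_comm, ← mul_assoc, γ.mul_inv, one_mul] at this
  · intro h
    have := O.mul_mem h2 h
    rwa [smul_mul_smul_comm, ← mul_assoc, mul_inv_cancel₀ hc, one_mul] at this

theorem nrd_zpow (P : Bˣ) (k : ℤ) : nrd K ((P ^ k : Bˣ) : B) = nrd K (P : B) ^ k := by
  have h1 := congrArg Units.val (map_zpow (Units.map hq.nrdHom) P k)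
  rw [Units.val_zpow_eq_zpow_val] at h1
  exact h1

variable (hdiv : IsDivision B) (hR : HasQuadraticRoots R) (hO : Maximal (IsOrder K) O)
  {ϖ : R} (hϖ : Irreducible ϖ) {P : Bˣ} (hP : nrd K (P : B) = algebraMap R K ϖ)

include hdiv hR hO hϖ hP

/-- Membership in `O` depends only on the norm and `Nrd P = ϖ`, so the set defining the order is all
of `r ≤ m`. -/
theorem ordAt_eq {γ : Bˣ} {u : Rˣ} {m : ℤ}
    (hγ : nrd K (γ : B) = algebraMap R K u * algebraMap R K ϖ ^ m) : ordAt O P γ = m := by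
  have hϖ0 : algebraMap R K ϖ ≠ 0 := by rw [Ne, algebraMap_eq_zero_iff']; exact hϖ.ne_zero
  have h1 : {r : ℤ | ((P ^ (-r) * γ : Bˣ) : B) ∈ O} = Set.Iic m := by
    ext r
    rw [Set.mem_ofPred_eq, Set.mem_Iic, mem_maximalOrder_iff hq hdiv hR hO, Units.val_mul,
      hq.nrd_mul, nrd_zpow hq, hP, hγ, mul_left_comm, ← zpow_add₀ hϖ0,
      unit_mul_zpow_mem_integers hϖ]
    omega
  rw [ordAt, h1, csSup_Iic]

/-- An element of `O` is a unit exactly when its norm is one. Otherwise `ϖ = Nrd P` divides its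
norm, and dividing by `P` on the left stays in `O`. -/
theorem isPrimeElement_of_nrd : IsPrimeElement K O P := by
  have mem_iff := fun x => mem_maximalOrder_iff hq hdiv hR hO (x := x)
  have hϖ0 : algebraMap R K ϖ ≠ 0 := by rw [Ne, algebraMap_eq_zero_iff']; exact hϖ.ne_zero
  refine ⟨(mem_iff _).2 ⟨ϖ, hP.symm⟩, fun x => ⟨fun hx => ?_, ?_⟩, ϖ, hϖ, mul_conj_prime hq hP⟩
  · have := hdiv.1
    obtain ⟨r, hr⟩ := (mem_iff x).1 x.2
    have hrm : r ∈ maximalIdeal R := by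
      rw [mem_maximalIdeal]
      rintro ⟨u, rfl⟩
      obtain ⟨w, hw, hxw⟩ := exists_inverse_mem hq hdiv hR hO hr.symm
      have hu : IsUnit (x : B) := hdiv.2 _ (left_ne_zero_of_mul_eq_one hxw)
      obtain ⟨y, hy⟩ := hu
      refine hx ⟨⟨x, ⟨w, hw⟩, Subtype.ext hxw, Subtype.ext ?_⟩, rfl⟩
      change w * (x : B) = 1
      rw [← hy] at hxw ⊢
      rw [Units.eq_inv_of_mul_eq_one_left hxw, y.inv_mul]
    rw [hϖ.maximalIdeal_eq, Ideal.mem_span_singleton] at hrm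
    obtain ⟨r, rfl⟩ := hrm
    obtain ⟨y, hy, hny⟩ := exists_eq_mul_of_nrd hq (a := (P : B)) (x := (x : B))
      (c := algebraMap R K r) (by rwa [hP]) (by rw [← hr, hP, map_mul])
    exact ⟨⟨y, (mem_iff y).2 ⟨r, hny.symm⟩⟩, hy⟩
  · rintro ⟨y, hy⟩ ⟨z, hz⟩
    obtain ⟨r, hr⟩ := (mem_iff y).1 y.2
    obtain ⟨t, ht⟩ := (mem_iff _).1 ((z⁻¹ : Oˣ) : O).2
    have h1 : (P : B) * y * ((z⁻¹ : Oˣ) : O) = 1 := by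
      rw [← hy, ← hz]
      exact congrArg Subtype.val z.mul_inv
    have h2 := congrArg (nrd K) h1
    rw [hq.nrd_mul, hq.nrd_mul, hq.nrd_one, hP, ← hr, ← ht, mul_assoc, ← map_mul, ← map_mul,
      ← map_one (algebraMap R K)] at h2
    exact hϖ.not_isUnit (IsUnit.of_mul_eq_one _ (IsFractionRing.injective R K h2))

variable [Finite (ResidueField R)]

-- Norm valuations add up: the trace dual of `O` contributes `1`, the scalar `δ` contributes `2d`,
-- and `γ⁻¹` contributes `-m`.
omit hP in
theorem exists_twisted_dual_exponent {γ : Bˣ} {u : Rˣ} {m : ℤ}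
    (hγ : nrd K (γ : B) = algebraMap R K u * algebraMap R K ϖ ^ m) {δ : K} (hδ : δ ≠ 0) :
    ∃ d : ℤ, ∀ x : B, (∀ b ∈ O, trd K (δ • (((γ⁻¹ : Bˣ) : B) * x) * b) ∈ integers R K) ↔
      algebraMap R K ϖ ^ (1 + 2 * d - m) * nrd K x ∈ integers R K := by
  have hϖ0 : algebraMap R K ϖ ≠ 0 := by rw [Ne, algebraMap_eq_zero_iff']; exact hϖ.ne_zero
  obtain ⟨v, d, hv⟩ := exists_eq_unit_mul_zpow (R := R) hδ hϖ
  refine ⟨d, fun x => ?_⟩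
  have hγi : nrd K ((γ⁻¹ : Bˣ) : B) = algebraMap R K (u⁻¹ : Rˣ) * algebraMap R K ϖ ^ (-m) := by
    have h1 := nrd_zpow (K := K) hq γ (-1)
    rw [zpow_neg_one, zpow_neg_one] at h1
    rw [h1, hγ, mul_inv, zpow_neg]
    congr 1
    refine inv_eq_of_mul_eq_one_left ?_
    rw [← map_mul, u.inv_mul, map_one]
  rw [trd_mul_mem_iff hq hdiv hR hO hϖ, hq.nrd_smul, hq.nrd_mul, hγi, hv,
    ← unit_mul_mem_integers (K := K) (v * v * u⁻¹) (algebraMap R K ϖ ^ (1 + 2 * d - m) * nrd K x)]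
  rw [zpow_sub₀ hϖ0, zpow_add₀ hϖ0, two_mul, zpow_add₀ hϖ0, zpow_one, zpow_neg]
  simp only [Units.val_mul, map_mul]
  refine iff_of_eq (congrArg (· ∈ integers R K) ?_)
  ring

/-- For `m = 2l + 1` the exponent `1 + 2d - m = 2(d - l)` is the norm valuation of the scalar `ϖ ^
(d - l)`. -/
theorem exists_smul_mem_iff_of_odd {γ : Bˣ} (hm : Odd (ordAt O P γ)) {δ : K} (hδ : δ ≠ 0) :
    ∃ c : K, c ≠ 0 ∧ ∀ x : B,
      (∀ b ∈ O, trd K (δ • (((γ⁻¹ : Bˣ) : B) * x) * b) ∈ integers R K) ↔ c • x ∈ O := by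
  have hϖ0 : algebraMap R K ϖ ≠ 0 := by rw [Ne, algebraMap_eq_zero_iff']; exact hϖ.ne_zero
  obtain ⟨u, m, hγ⟩ := exists_eq_unit_mul_zpow (R := R) ((hq.isUnit_iff _).1 γ.isUnit) hϖ
  rw [ordAt_eq hq hdiv hR hO hϖ hP hγ] at hm
  obtain ⟨l, rfl⟩ := hm
  obtain ⟨d, hd⟩ := exists_twisted_dual_exponent hq hdiv hR hO hϖ hγ hδ
  refine ⟨algebraMap R K ϖ ^ (d - l), zpow_ne_zero _ hϖ0, fun x => ?_⟩
  rw [hd, mem_maximalOrder_iff hq hdiv hR hO, hq.nrd_smul, ← zpow_add₀ hϖ0]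
  ring_nf

/-- For `m = 2l` the exponent is `2(d - l + 1) - 1`: a scalar and one factor `P⁻¹` remain. -/
theorem exists_smul_mem_iff_of_even {γ : Bˣ} (hm : Even (ordAt O P γ)) {δ : K} (hδ : δ ≠ 0) :
    ∃ c : K, c ≠ 0 ∧ ∀ x : B,
      (∀ b ∈ O, trd K (δ • (((γ⁻¹ : Bˣ) : B) * x) * b) ∈ integers R K) ↔
        ((P⁻¹ : Bˣ) : B) * c • x ∈ O := by
  have hϖ0 : algebraMap R K ϖ ≠ 0 := by rw [Ne, algebraMap_eq_zero_iff']; exact hϖ.ne_zero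
  obtain ⟨u, m, hγ⟩ := exists_eq_unit_mul_zpow (R := R) ((hq.isUnit_iff _).1 γ.isUnit) hϖ
  rw [ordAt_eq hq hdiv hR hO hϖ hP hγ] at hm
  obtain ⟨l, rfl⟩ := hm
  obtain ⟨d, hd⟩ := exists_twisted_dual_exponent hq hdiv hR hO hϖ hγ hδ
  refine ⟨algebraMap R K ϖ ^ (d - l + 1), zpow_ne_zero _ hϖ0, fun x => ?_⟩
  have h1 := nrd_zpow (K := K) hq P (-1)
  rw [zpow_neg_one, hP] at h1
  rw [hd, mem_maximalOrder_iff hq hdiv hR hO, hq.nrd_mul, hq.nrd_smul, h1, ← zpow_add₀ hϖ0,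
    ← mul_assoc, ← zpow_add₀ hϖ0]
  ring_nf

/-- Left multiplication by a prime element maps the trace dual of the order into the order. -/
theorem prime_mul_mem {x : B} (hx : ∀ b ∈ O, trd K (x * b) ∈ integers R K) : (P : B) * x ∈ O := by
  rwa [mem_maximalOrder_iff hq hdiv hR hO, hq.nrd_mul, hP, ← trd_mul_mem_iff hq hdiv hR hO hϖ]

omit [Finite (ResidueField R)] in
theorem eq_zero_of_forall_pow_mul_mem {x : B}
    (hx : ∀ k : ℕ, ((algebraMap R K ϖ)⁻¹ • (P : B)) ^ k * x ∈ O) : x = 0 := by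
  have hϖ0 : algebraMap R K ϖ ≠ 0 := by rw [Ne, algebraMap_eq_zero_iff']; exact hϖ.ne_zero
  refine eq_zero_of_nrd hq hdiv ?_
  by_contra hne
  obtain ⟨r, hr⟩ : (algebraMap R K ϖ)⁻¹ ∈ integers R K := mem_integers_of_pow hne fun k => by
    have h1 := (mem_maximalOrder_iff hq hdiv hR hO).1 (hx k)
    have h2 : nrd K (((algebraMap R K ϖ)⁻¹ • (P : B)) ^ k) = (algebraMap R K ϖ)⁻¹ ^ k := by
      refine (map_pow hq.nrdHom _ k).trans (congrArg (· ^ k) ?_)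
      change nrd K _ = _
      rw [hq.nrd_smul, hP, mul_assoc, inv_mul_cancel₀ hϖ0, mul_one]
    rwa [hq.nrd_mul, h2, mul_comm] at h1
  refine hϖ.not_isUnit (IsUnit.of_mul_eq_one r (IsFractionRing.injective R K ?_))
  rw [map_mul, hr, map_one, mul_inv_cancel₀ hϖ0]

end Reduction

/-! ### Self-dual lattices -/

section SelfDual

variable {K₀ K B V : Type*} [Field K₀] [ValuativeRel K₀] [TopologicalSpace K₀]
  [IsNonarchimedeanLocalField K₀] [Field K] [Algebra K₀ K] [FiniteDimensional K₀ K]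
  [Algebra.IsSeparable K₀ K] [Ring B] [Algebra K B] (hq : Quat K B)
  [AddCommGroup V] [Module K₀ V] [Module B V] [Module.Finite B V]
  {γ : Bˣ} {ψ : LinearMap.BilinForm K₀ V} {h : V → V → B} (hh : Herm K h)
  (hψ : ∀ x y, ψ x y = -Algebra.trace K₀ K (trd K (((γ⁻¹ : Bˣ) : B) * h x y)))
  {O : Subalgebra (IntegerRing K₀ K) B} (hO : Maximal (IsOrder K) O)

include hψ in
omit [ValuativeRel K₀] [TopologicalSpace K₀] [IsNonarchimedeanLocalField K₀]
  [FiniteDimensional K₀ K] [Algebra.IsSeparable K₀ K] [Module.Finite B V] in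
theorem areIsometric_of_herm {R : Type*} [CommRing R] [Algebra R B] {O : Subalgebra R B}
    {L₁ L₂ : Submodule O V} {c : K} (hc : c ≠ 0)
    (hF : ∃ F : V ≃ₗ[B] V, (∀ x y, c • h (F x) (F y) = c • h x y) ∧ ∀ x, F x ∈ L₂ ↔ x ∈ L₁) :
    AreIsometric ψ L₁ L₂ := by
  obtain ⟨F, hF, hFL⟩ := hF
  refine areIsometric_of_equiv F hFL fun x y => ?_
  rw [hψ, hψ, smul_right_injective B hc (hF x y)]

include hq hh hψ hO

/-- Over a split quaternion algebra self-dual lattices exist and are unique up to isometry. -/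
theorem selfDual_of_split (hdiv : ¬ IsDivision B)
    (hγ : ∀ x ∈ O, ((γ⁻¹ : Bˣ) : B) * x * γ ∈ O) :
    (∃ L : Submodule O V, IsSelfDualLattice ψ L) ∧
      ∀ L₁ L₂ : Submodule O V, IsSelfDualLattice ψ L₁ → IsSelfDualLattice ψ L₂ →
        AreIsometric ψ L₁ L₂ := by
  obtain ⟨_, -, -⟩ := integerRing_structure K₀ K
  obtain ⟨δ, hδ, hdual⟩ := exists_mem_dual_iff hq hh hψ hO.1
  obtain ⟨e₀⟩ := hq.exists_algEquiv_matrix hdiv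
  obtain ⟨e, he⟩ := exists_algEquiv_integral_matrix hq hO e₀
  obtain ⟨c, hc, hcO⟩ := exists_smul_mem_iff_of_split hq hO.1 he hγ hδ
  simp_rw [isSelfDualLattice_iff, hdual, hcO]
  have hh' := hh.smul_form hq hc
  obtain ⟨ϖ, hϖ⟩ := IsDiscreteValuationRing.exists_irreducible (IntegerRing K₀ K)
  refine ⟨exists_unimodular hq hh' hO.1 fun a => ⟨_, nrd_symm_diagonal hq e a⟩, ?_⟩
  rintro L₁ L₂ ⟨hL₁, hd₁⟩ ⟨hL₂, hd₂⟩
  -- `τ = 1` suffices because the trace dual of `O` lies in `O`; in the division case `τ` has to be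
  -- a prime element.
  refine areIsometric_of_herm hψ hc (exists_isometry_of_unimodular hq hh' hO.1 hϖ (τ := 1)
    (fun x hx => ?_) (fun x hx => split_eq_zero he hϖ fun k => ?_) (fun u => ?_) hL₁ hL₂ hd₁ hd₂)
  · rw [one_mul]
    exact split_mem_of_trd hq he hx
  · have := hx k
    rwa [smul_pow, one_pow, smul_mul_assoc, one_mul] at this
  · refine ⟨_, symm_mem_of_integral he ?_, nrd_symm_diagonal hq e _⟩
    intro i j
    fin_cases i <;> fin_cases j
    · exact algebraMap_mem_integers _
    · exact Subring.zero_mem _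
    · exact Subring.zero_mem _
    · exact Subring.one_mem _

/-- Over a division quaternion algebra self-dual lattices are unique up to isometry, and they exist
unless the rank is odd and the order of `γ` is even. -/
theorem selfDual_of_division (hdiv : IsDivision B) {P : Bˣ} {ϖ : IntegerRing K₀ K}
    (hϖ : Irreducible ϖ) (hP : nrd K (P : B) = algebraMap (IntegerRing K₀ K) K ϖ) :
    ((∃ L : Submodule O V, IsSelfDualLattice ψ L) ↔
      (Even (ordAt O P γ) → Even (Module.finrank B V))) ∧
      ∀ L₁ L₂ : Submodule O V, IsSelfDualLattice ψ L₁ → IsSelfDualLattice ψ L₂ →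
        AreIsometric ψ L₁ L₂ := by
  obtain ⟨_, _, hR⟩ := integerRing_structure K₀ K
  obtain ⟨δ, hδ, hdual⟩ := exists_mem_dual_iff hq hh hψ hO.1
  rcases Int.even_or_odd (ordAt O P γ) with hm | hm
  · obtain ⟨c, hc, hcO⟩ := exists_smul_mem_iff_of_even hq hdiv hR hO hϖ hP hm hδ
    simp_rw [isSelfDualLattice_iff, hdual, hcO]
    have hh' := hh.smul_form hq hc
    refine ⟨(exists_primeModular_iff hq hh' hdiv hR hO hϖ hP).trans ⟨fun h _ => h, fun h => h hm⟩,
      ?_⟩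
    rintro L₁ L₂ ⟨hL₁, hd₁⟩ ⟨hL₂, hd₂⟩
    exact areIsometric_of_herm hψ hc
      (exists_isometry_of_primeModular hq hh' hdiv hR hO hϖ hP hL₁ hL₂ hd₁ hd₂)
  · obtain ⟨c, hc, hcO⟩ := exists_smul_mem_iff_of_odd hq hdiv hR hO hϖ hP hm hδ
    simp_rw [isSelfDualLattice_iff, hdual, hcO]
    have hh' := hh.smul_form hq hc
    refine ⟨⟨fun _ he => absurd he (Int.not_even_iff_odd.2 hm), fun _ =>
      exists_unimodular hq hh' hO.1 (exists_nrd_eq hq hdiv hR hO)⟩, ?_⟩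
    rintro L₁ L₂ ⟨hL₁, hd₁⟩ ⟨hL₂, hd₂⟩
    refine areIsometric_of_herm hψ hc (exists_isometry_of_unimodular hq hh' hO.1 hϖ (τ := (P : B))
      (fun x hx => prime_mul_mem hq hdiv hR hO hϖ hP hx)
      (fun x hx => eq_zero_of_forall_pow_mul_mem hq hdiv hR hO hϖ hP hx) (fun u => ?_)
      hL₁ hL₂ hd₁ hd₂)
    obtain ⟨y, hy⟩ := exists_nrd_eq hq hdiv hR hO (algebraMap _ K (u : IntegerRing K₀ K))
    exact ⟨y, (mem_maximalOrder_iff hq hdiv hR hO).2 ⟨_, hy.symm⟩, hy⟩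

end SelfDual

end QuatHerm

end

/-! ### The theorem -/

theorem proposition8p2
    {K₀ K B V : Type*}
    [Field K₀] [ValuativeRel K₀] [TopologicalSpace K₀] [IsNonarchimedeanLocalField K₀]
    (h2 : (2 : K₀) ≠ 0)
    [Field K] [Algebra K₀ K] [FiniteDimensional K₀ K] [Algebra.IsSeparable K₀ K]
    [Ring B] [Algebra K B] [Algebra K₀ B] [IsScalarTower K₀ K B]
    (hB : QuatHerm.IsQuaternionAlgebra K B)
    (s : B →ₗ[K] B) (hs : QuatHerm.IsOrthogonalInvolution s)
    (γ : Bˣ) (hγ : QuatHerm.conj K (γ : B) + γ = 0)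
    (hsγ : ∀ x : B, s x = γ * QuatHerm.conj K x * (γ⁻¹ : Bˣ))
    (O : Subalgebra (QuatHerm.IntegerRing K₀ K) B) (hO : Maximal (QuatHerm.IsOrder K) O)
    (hsO : ∀ x ∈ O, s x ∈ O)
    [AddCommGroup V] [Module K₀ V] [Module B V] [IsScalarTower K₀ B V]
    [Module.Free B V] [Module.Finite B V] (n : ℕ) (hn : Module.finrank B V = n)
    (ψ : LinearMap.BilinForm K₀ V) (hψ : QuatHerm.IsHermitianForm (-1) s ψ) :
    ((¬ ∃ L : Submodule O V, QuatHerm.IsSelfDualLattice ψ L) ↔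
      QuatHerm.IsDivision B ∧ Odd n ∧
        ∃ P : Bˣ, QuatHerm.IsPrimeElement K O P ∧ Even (QuatHerm.ordAt O P γ)) ∧
    (∀ L₁ L₂ : Submodule O V, QuatHerm.IsSelfDualLattice ψ L₁ →
      QuatHerm.IsSelfDualLattice ψ L₂ → QuatHerm.AreIsometric ψ L₁ L₂) := by
  have h2K : (2 : K) ≠ 0 := by
    rw [← map_ofNat (algebraMap K₀ K) 2, Ne, map_eq_zero]
    exact h2
  have hq : QuatHerm.Quat K B := ⟨h2K, hB⟩
  obtain ⟨h, hh, hψh⟩ := QuatHerm.exists_herm hq hγ hsγ hψ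
  obtain ⟨_, _, hR⟩ := QuatHerm.integerRing_structure K₀ K
  by_cases hdiv : QuatHerm.IsDivision B
  · obtain ⟨P₀, ϖ, hϖ, hP⟩ := QuatHerm.exists_nrd_irreducible hq hdiv hR hO
    obtain ⟨P, rfl⟩ := (hq.isUnit_iff P₀).2 (by
      rw [hP, Ne, QuatHerm.algebraMap_eq_zero_iff']; exact hϖ.ne_zero)
    obtain ⟨hex, huniq⟩ := QuatHerm.selfDual_of_division hq hh hψh hO hdiv hϖ hP
    refine ⟨⟨fun hno => ?_, ?_⟩, huniq⟩
    · rw [hex, Classical.not_imp, hn, Nat.not_even_iff_odd] at hno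
      exact ⟨hdiv, hno.2, P, QuatHerm.isPrimeElement_of_nrd hq hdiv hR hO hϖ hP, hno.1⟩
    · rintro ⟨-, hodd, P', ⟨-, -, ϖ', hϖ', hPϖ'⟩, heven⟩ hL
      have hP' : QuatHerm.nrd K (P' : B) = algebraMap (QuatHerm.IntegerRing K₀ K) K ϖ' := by
        refine hq.algebraMap_injective ?_
        rw [← hq.mul_conj, hPϖ', ← QuatHerm.algebraMap_tower]
      -- The criterion is applied to the given prime `P'` itself, so orders at two primes need not
      -- be compared.
      have := (QuatHerm.selfDual_of_division hq hh hψh hO hdiv hϖ' hP').1.1 hL heven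
      rw [hn] at this
      exact Nat.not_even_iff_odd.2 hodd this
  · have hnorm : ∀ x ∈ O, ((γ⁻¹ : Bˣ) : B) * x * γ ∈ O := by
      intro x hx
      have hcγ : QuatHerm.conj K (γ : B) = -γ := eq_neg_of_add_eq_zero_left hγ
      -- Applying the canonical involution after `*` is `x ↦ γ⁻¹ x γ`; both preserve `O`, so `γ`
      -- normalizes it.
      have h1 := hO.1.conj_mem hq (hsO x hx)
      rwa [hsγ, hq.conj_mul, hq.conj_mul, hq.conj_conj, hcγ,
        QuatHerm.conj_inv_eq_neg hq hcγ, mul_neg, neg_mul_neg, ← mul_assoc] at h1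
    obtain ⟨hex, huniq⟩ := QuatHerm.selfDual_of_split hq hh hψh hO hdiv hnorm
    exact ⟨⟨fun hno => absurd hex hno, fun h => absurd h.1 hdiv⟩, huniq⟩
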